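/- **Conventions.** Let $A$ be a commutative ring. An $A$-module is called $A$-*profinite* if it is finitely generated and projective; $P^*=\mathrm{Hom}_A(P,A)$. *Cocommutative right Hopf algebroids.* A cocommutative right bialgebroid over $A$ (source and target then coincide) is a ring $U$ with a ring homomorphism $\mathsf s:A\to U$, not assumed central, such that the right $A$-module $U$ (with $u\cdot a=u\,\mathsf s(a)$) is a cocommutative $A$-coalgebra $(U,\Delta,\varepsilon)$, $\Delta(u)=u_1\otimes_A u_2$, with $\mathsf s(a)u_1\otimes_A u_2=u_1\otimes_A\mathsf s(a)u_2$, $\Delta(1)=1\otimes_A 1$, $\Delta(uv)=u_1v_1\otimes_A u_2v_2$, $\varepsilon(1)=1$, $\varepsilon(uv)=\varepsilon(\mathsf s(\varepsilon(u))v)$. It is a right Hopf algebroid if the map $x\otimes u\mapsto xu_1\otimes_A u_2$ from $U\otimes U/\langle x\,\mathsf s(a)\otimes u-x\otimes\mathsf s(a)u\rangle$ to $U\otimes_A U$ is bijective. *The category $\mathcal A_U$.* Its objects are the right $U$-modules that are $A$-profinite (through $\mathsf s$), its morphisms the $U$-linear maps. It is symmetric monoidal with $P\otimes_A Q$, $(p\otimes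 q)u=pu_1\otimes qu_2$, unit $A$ with $a\cdot u=\varepsilon(\mathsf s(a)u)$, and the flip as symmetry. *The finite dual.* $U^\circ$ is the quotient of $\bigoplus_{P\in\mathcal A_U}P^*\otimes P$ by the subgroup generated by the elements $\varphi\otimes f(p)-\varphi f\otimes p$, for all $f:P\to Q$ in $\mathcal A_U$, $\varphi\in Q^*$, $p\in P$. It is a commutative ring with $\overline{\varphi\otimes p}\;\overline{\psi\otimes q}=\overline{(\psi\star\varphi)\otimes(q\otimes_A p)}$, where $(\psi\star\varphi)(q\otimes p)=\psi(q)\varphi(p)$, and a commutative bialgebroid over $A$ with source $\mathsf s^\circ(a)=\overline{a\,\mathrm{id}_A\otimes 1}$, target $\mathsf t^\circ(a)=\overline{\mathrm{id}_A\otimes a}$, counit $\overline{\varphi\otimes p}\mapsto\varphi(p)$ and comultiplication $\overline{\varphi\otimes p}\mapsto\sum_i\overline{\varphi\otimes e_i}\otimes_A\overline{e_i^*\otimes p}$ ($\{e_i,e_i^*\}$ a finite dual basis of $P$). Let $\zeta:U^\circ\to U^*$ be the map $\zeta(\overline{\varphi\otimes p})(u)=\varphi(pu)$. *The category $\mathcal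 A^{U^\circ}$.* Its objects are the $A$-profinite right $U^\circ$-comodules, that is, $A$-profinite modules $M$ with a coassociative counital coaction $\varrho:M\to M\otimes_A{}_{\mathsf s^\circ}U^\circ$, $\varrho(m)=m_{(0)}\otimes m_{(1)}$, such that $\varrho(am)=m_{(0)}\otimes\mathsf t^\circ(a)m_{(1)}$; its morphisms are the $A$-linear maps compatible with the coactions. It is symmetric monoidal with $M\otimes_A N$, $m\otimes n\mapsto (m_{(0)}\otimes n_{(0)})\otimes m_{(1)}n_{(1)}$, unit $A$ with $a\mapsto 1\otimes\mathsf t^\circ(a)$, and the flip as symmetry. *Lie–Rinehart algebras.* Let $K$ be a commutative ring, $A$ a commutative $K$-algebra and $L$ a Lie–Rinehart algebra over $(K,A)$: an $A$-module and $K$-Lie algebra acting on $A$ by $K$-derivations through a Lie algebra map, with $(aX)(b)=a\,X(b)$ and $[X,aY]=a[X,Y]+X(a)Y$. Let $V(L)$ be the quotient of the universal enveloping algebra of the Lie algebra $A\oplus L$, $[(a,X),(b,Y)]=(X(b)-Y(a),[X,Y])$, by the two-sided ideal generated by $(1,0)-1$ and all $(a,0)(b,Y)-(ab,aY)$. Let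 $\mathcal U(L)=V(L)^{\mathrm{op}}$, so that right $\mathcal U(L)$-modules are the representations of $L$, i.e. the $A$-modules $M$ with an action of $L$ such that $(aX)m=a(Xm)$, $X(am)=a(Xm)+X(a)m$ and $[X,Y]m=X(Ym)-Y(Xm)$. With $\mathsf s$ the canonical map of $A$, $\Delta(X)=X\otimes 1+1\otimes X$ and $\varepsilon(X)=0$ for $X\in L$, it is a cocommutative right bialgebroid over $A$. **Theorem.** 1. Let $U$ be a cocommutative right Hopf algebroid over a Dedekind domain $A$. Then $U^\circ$ has an antipode (so it is a commutative Hopf algebroid over $A$), and $\mathcal A_U$ is isomorphic to $\mathcal A^{U^\circ}$ as a symmetric monoidal category: there is an isomorphism of categories $\mathcal A_U\to\mathcal A^{U^\circ}$ that is a strict monoidal functor, preserves the symmetry and commutes with the forgetful functors to $A$-modules. 2. Let $L$ be a Lie–Rinehart algebra over a commutative $K$-algebra $A$. Then $\mathcal U(L)$ is a right Hopf algebroid over $A$, and $\mathcal U(L)^\circ$ has an antipode, so it is a commutative Hopf algebroid. If $\zeta:\mathcal U(L)^\circ\to\mathcal U(L)^*$ is injective, which is the case when $A$ is a Dedekind domain,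 then $\mathcal A_{\mathcal U(L)}$ and $\mathcal A^{\mathcal U(L)^\circ}$ are rigid, and there is an isomorphism of categories between them that is a strict monoidal functor, preserves the symmetry and commutes with the forgetful functors to $A$-modules. -/

import Mathlib

open CategoryTheory MonoidalCategory TensorProduct MulOpposite

universe u v w x

set_option linter.unusedSectionVars false

namespace FiniteDual

/-- An `A`-ring `U`: a ring with a homomorphism `src : A → U` (not assumed central). `U` is regarded
as an `A`-module through right multiplication, `a • x = x * src a`. -/
class RightARing (A : Type u) (U : Type v) [CommRing A] [Ring U] extends Module A U where
  src : A →+* U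
  smul_eq : ∀ (a : A) (x : U), a • x = x * src a

open RightARing (src)

section
variable (A : Type u) {U : Type v} [CommRing A] [Ring U] [RightARing A U]

instance : SMulCommClass A U U where
  smul_comm a x y := by simp [RightARing.smul_eq, mul_assoc]

/-- `mulBoth A x y` is the map `u ⊗ v ↦ x u ⊗ y v`. -/
noncomputable abbrev mulBoth (x y : U) : U ⊗[A] U →ₗ[A] U ⊗[A] U :=
  TensorProduct.map (LinearMap.mulLeft A x) (LinearMap.mulLeft A y)

theorem src_eq (a : A) : (src a : U) = a • (1 : U) := by simp [RightARing.smul_eq]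

variable (U) in
/-- A cocommutative right bialgebroid over the commutative ring `A`. Its source and target maps
agree (both are `src`), so the underlying `A`-coring is a cocommutative coalgebra over `A` on the
module `U` with `a • x = x * src a`. The comultiplication takes values in the Takeuchi product
(`src_comul`) and is multiplicative (`comul_mul`: if `Δ x = ∑ l i ⊗ r i` then
`Δ (x y) = ∑ l i y₁ ⊗ r i y₂`), and the counit satisfies `ε (x y) = ε (src (ε x) y)`. -/
class CocommRightBialgebroid extends Coalgebra A U, Coalgebra.IsCocomm A U where
  comul_one : CoalgebraStruct.comul (R := A) (1 : U) = (1 : U) ⊗ₜ[A] (1 : U)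
  src_comul : ∀ (a : A) (x : U), mulBoth A (src a) 1 (CoalgebraStruct.comul x) =
    mulBoth A 1 (src a) (CoalgebraStruct.comul x)
  comul_mul : ∀ (x y : U) {n : ℕ} (l r : Fin n → U),
    CoalgebraStruct.comul (R := A) x = ∑ i, l i ⊗ₜ[A] r i →
    CoalgebraStruct.comul (R := A) (x * y) = ∑ i, mulBoth A (l i) (r i) (CoalgebraStruct.comul y)
  counit_one : CoalgebraStruct.counit (R := A) (1 : U) = (1 : A)
  counit_mul : ∀ x y : U, CoalgebraStruct.counit (R := A) (x * y) =
    CoalgebraStruct.counit (R := A) (src (CoalgebraStruct.counit (R := A) x) * y)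

end

open Coalgebra (comul counit)

section ProfMod
variable (A : Type u) (U : Type v) [CommRing A] [Ring U] [RightARing A U]

/-- An `A`-profinite right `U`-module: a right `U`-module which is finitely generated and projective
over `A`. The tower condition says that `A` acts through `src`. -/
structure ProfMod where
  carrier : Type u
  [addCommGroup : AddCommGroup carrier]
  [moduleA : Module A carrier]
  [moduleU : Module Uᵐᵒᵖ carrier]
  [tower : IsScalarTower A Uᵐᵒᵖ carrier]
  [finite : Module.Finite A carrier]
  [projective : Module.Projective A carrier]

namespace ProfMod
variable {A U}

instance : CoeSort (ProfMod A U) (Type u) := ⟨carrier⟩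

attribute [instance] addCommGroup moduleA moduleU tower finite projective

/-- Morphisms are the `U`-linear maps. -/
@[ext] structure Hom (P Q : ProfMod A U) where
  lin : P →ₗ[A] Q
  map_act : ∀ (x : Uᵐᵒᵖ) (p : P), lin (x • p) = x • lin p

instance : Category (ProfMod A U) where
  Hom := Hom
  id P := ⟨LinearMap.id, fun _ _ => rfl⟩
  comp f g := ⟨g.lin ∘ₗ f.lin, fun x p => by simp [f.map_act, g.map_act]⟩

@[simp] theorem id_lin (P : ProfMod A U) : Hom.lin (𝟙 P) = LinearMap.id := rfl
@[simp] theorem comp_lin {P Q R : ProfMod A U} (f : P ⟶ Q) (g : Q ⟶ R) :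
    Hom.lin (f ≫ g) = Hom.lin g ∘ₗ Hom.lin f := rfl

@[ext] theorem hom_ext {P Q : ProfMod A U} {f g : P ⟶ Q} (h : Hom.lin f = Hom.lin g) : f = g :=
  Hom.ext h

variable (A U) in
/-- The fibre functor to `A`-modules. -/
def forget : ProfMod A U ⥤ ModuleCat.{u} A where
  obj P := ModuleCat.of A P
  map f := ModuleCat.ofHom (Hom.lin f)

instance : (forget A U).Faithful where
  map_injective h := hom_ext (ModuleCat.hom_ext_iff.mp h)

/-- An isomorphism from a bijective `U`-linear map. -/
def mkIso {P Q : ProfMod A U} (e : P ≃ₗ[A] Q) (h : ∀ (x : Uᵐᵒᵖ) (p : P), e (x • p) = x • e p) :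
    P ≅ Q where
  hom := ⟨e, h⟩
  inv := ⟨e.symm, fun x q => e.injective (by simp [h])⟩
  hom_inv_id := by ext; simp
  inv_hom_id := by ext; simp

/-- The map `x ↦ p x`. -/
def orbit {P : Type*} [AddCommGroup P] [Module A P] [Module Uᵐᵒᵖ P] [IsScalarTower A Uᵐᵒᵖ P] (p : P) :
    U →ₗ[A] P where
  toFun x := op x • p
  map_add' x y := by simp [add_smul]
  map_smul' a x := by simp

@[simp] theorem orbit_apply {P : Type*} [AddCommGroup P] [Module A P] [Module Uᵐᵒᵖ P] [IsScalarTower A Uᵐᵒᵖ P]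
  (p : P) (x : U) : orbit (A := A) p x = op x • p := rfl

theorem src_smul {P : Type*} [AddCommGroup P] [Module A P] [Module Uᵐᵒᵖ P] [IsScalarTower A Uᵐᵒᵖ P] (a : A) (p : P) :
    op (src a : U) • p = a • p := by
  rw [src_eq, op_smul, smul_assoc, op_one, one_smul]

section
variable (P Q : Type*) [AddCommGroup P] [Module A P] [Module Uᵐᵒᵖ P] [IsScalarTower A Uᵐᵒᵖ P]
  [AddCommGroup Q] [Module A Q] [Module Uᵐᵒᵖ Q] [IsScalarTower A Uᵐᵒᵖ Q]

theorem orbit_src (a : A) (p : P) : orbit (A := A) (U := U) (a • p) =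
    orbit p ∘ₗ LinearMap.mulLeft A (src a) := by
  ext x; simp [mul_smul, src_smul]

variable [CocommRightBialgebroid A U]

/-- The diagonal action: `(p ⊗ q) x = p x₁ ⊗ q x₂`. -/
noncomputable def tensorAct (x : U) : P ⊗[A] Q →+ P ⊗[A] Q :=
  liftAddHom
    (AddMonoidHom.mk' (fun p => AddMonoidHom.mk'
      (fun q => TensorProduct.map (orbit p) (orbit q) (comul (R := A) x))
      (fun q q' => by
        have : orbit (A := A) (U := U) (q + q') = orbit q + orbit q' := by ext; simp
        rw [this, TensorProduct.map_add_right]; rfl))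
      (fun p p' => by
        ext q
        have : orbit (A := A) (U := U) (p + p') = orbit p + orbit p' := by ext; simp
        simp [this, TensorProduct.map_add_left]))
    (fun a p q => by
      have := congrArg (TensorProduct.map (orbit (A := A) p) (orbit (A := A) q))
        (CocommRightBialgebroid.src_comul a x)
      simp only [mulBoth, TensorProduct.map_map, LinearMap.mulLeft_one, LinearMap.comp_id] at this
      simpa [orbit_src] using this)

theorem tensorAct_tmul (x : U) (p : P) (q : Q) : tensorAct P Q x (p ⊗ₜ q) =
    TensorProduct.map (orbit p) (orbit q) (comul (R := A) x) := rfl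

theorem tensorAct_mul (x y : U) (t : P ⊗[A] Q) :
    tensorAct P Q (x * y) t = tensorAct P Q y (tensorAct P Q x t) := by
  induction t with
  | zero => simp
  | add t t' h h' => simp [h, h']
  | tmul p q =>
    obtain ⟨n, l, r, h⟩ := TensorProduct.exists_sum_tmul_eq (comul (R := A) x)
    rw [tensorAct_tmul, tensorAct_tmul, CocommRightBialgebroid.comul_mul x y l r h, h]
    simp only [map_sum, TensorProduct.map_tmul, tensorAct_tmul, orbit_apply]
    refine Finset.sum_congr rfl fun i _ => ?_
    rw [mulBoth, ← LinearMap.comp_apply, ← TensorProduct.map_comp]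
    congr 2 <;> (ext; simp [mul_smul])

theorem tensorAct_add (x y : U) (t : P ⊗[A] Q) :
    tensorAct P Q (x + y) t = tensorAct P Q x t + tensorAct P Q y t := by
  induction t with
  | zero => simp
  | add t t' h h' => simp only [map_add, h, h']; abel
  | tmul p q => simp [tensorAct_tmul]

theorem tensorAct_zero (t : P ⊗[A] Q) : tensorAct P Q (0 : U) t = 0 := by
  have := tensorAct_add P Q (0 : U) 0 t
  simpa using this

theorem tensorAct_one (t : P ⊗[A] Q) : tensorAct P Q (1 : U) t = t := by
  induction t with
  | zero => simp
  | add t t' h h' => simp [h, h']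
  | tmul p q => simp [tensorAct_tmul, CocommRightBialgebroid.comul_one]

theorem tensorAct_smul (a : A) (x : U) (t : P ⊗[A] Q) :
    tensorAct P Q (a • x) t = a • tensorAct P Q x t := by
  induction t with
  | zero => simp
  | add t t' h h' => simp [h, h']
  | tmul p q => simp [tensorAct_tmul]

/-- `P ⊗ Q` as a right `U`-module through the diagonal action. -/
@[reducible] noncomputable def tensorModule : Module Uᵐᵒᵖ (P ⊗[A] Q) where
  smul x t := tensorAct P Q x.unop t
  one_smul t := tensorAct_one P Q t
  mul_smul x y t := tensorAct_mul P Q y.unop x.unop t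
  smul_zero x := map_zero (tensorAct P Q x.unop)
  smul_add x := map_add (tensorAct P Q x.unop)
  add_smul x y t := tensorAct_add P Q x.unop y.unop t
  zero_smul t := tensorAct_zero P Q t


attribute [local instance] tensorModule

theorem tensorTower : IsScalarTower A Uᵐᵒᵖ (P ⊗[A] Q) :=
  ⟨fun a x t => tensorAct_smul P Q a x.unop t⟩

attribute [local instance] tensorTower

variable {P Q}

theorem tensor_smul (x : Uᵐᵒᵖ) (p : P) (q : Q) : x • (p ⊗ₜ[A] q) =
    TensorProduct.map (orbit p) (orbit q) (comul (R := A) x.unop) := rfl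

theorem orbit_tensor (p : P) (q : Q) : orbit (p ⊗ₜ[A] q) =
    TensorProduct.map (orbit p) (orbit q) ∘ₗ comul (R := A) (A := U) := rfl

/-- The right action `a · x = ε(s(a) x)`. -/
@[reducible] noncomputable def unitModule : Module Uᵐᵒᵖ A where
  smul x a := counit (R := A) (src a * x.unop)
  one_smul a := by
    change counit (R := A) (src a * (1 : U)) = a
    rw [src_eq, mul_one, map_smul, CocommRightBialgebroid.counit_one, smul_eq_mul, mul_one]
  mul_smul x y a := by
    change counit (R := A) (src a * (y.unop * x.unop)) =
      counit (R := A) (src (counit (R := A) (src a * y.unop)) * x.unop)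
    rw [← mul_assoc, CocommRightBialgebroid.counit_mul]
  smul_zero x := by
    change counit (R := A) (src 0 * x.unop) = 0
    simp
  smul_add x a b := by
    change counit (R := A) (src (a + b) * x.unop) =
      counit (R := A) (src a * x.unop) + counit (R := A) (src b * x.unop)
    simp [add_mul]
  add_smul x y a := by
    change counit (R := A) (src a * (x + y).unop) =
      counit (R := A) (src a * x.unop) + counit (R := A) (src a * y.unop)
    simp [mul_add]
  zero_smul a := by
    change counit (R := A) (src a * (0 : U)) = 0
    simp

attribute [local instance] unitModule

theorem unitTower : IsScalarTower A Uᵐᵒᵖ A := ⟨fun a x b => by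
  change counit (R := A) (src b * (a • x.unop)) = a • counit (R := A) (src b * x.unop)
  rw [mul_smul_comm, map_smul]⟩

attribute [local instance] unitTower

theorem orbit_one : orbit (A := A) (U := U) (1 : A) = counit := by
  ext x
  change counit (R := A) (src 1 * x) = _
  simp

theorem orbit_unit (a : A) : orbit (A := A) (U := U) a = counit ∘ₗ LinearMap.mulLeft A (src a) := rfl

theorem map_smul_tensor {P' Q' : Type*}
    [AddCommGroup P'] [Module A P'] [Module Uᵐᵒᵖ P'] [IsScalarTower A Uᵐᵒᵖ P']
    [AddCommGroup Q'] [Module A Q'] [Module Uᵐᵒᵖ Q'] [IsScalarTower A Uᵐᵒᵖ Q']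
    (f : P →ₗ[A] P') (g : Q →ₗ[A] Q') (hf : ∀ (x : Uᵐᵒᵖ) p, f (x • p) = x • f p)
    (hg : ∀ (x : Uᵐᵒᵖ) q, g (x • q) = x • g q) (x : Uᵐᵒᵖ) (t : P ⊗[A] Q) :
    TensorProduct.map f g (x • t) = x • TensorProduct.map f g t := by
  induction t with
  | zero => simp
  | add t t' h h' => simp only [smul_add, map_add, h, h']
  | tmul p q =>
    rw [tensor_smul, map_tmul, tensor_smul, TensorProduct.map_map]
    congr 2 <;> (ext; simp [hf, hg])

theorem comm_smul (x : Uᵐᵒᵖ) (t : P ⊗[A] Q) :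
    TensorProduct.comm A P Q (x • t) = x • TensorProduct.comm A P Q t := by
  induction t with
  | zero => simp
  | add t t' h h' => simp only [smul_add, map_add, h, h']
  | tmul p q =>
    rw [tensor_smul, comm_tmul, tensor_smul, ← TensorProduct.map_comm, Coalgebra.comm_comul]

theorem assoc_smul {R : Type*} [AddCommGroup R] [Module A R] [Module Uᵐᵒᵖ R]
    [IsScalarTower A Uᵐᵒᵖ R] (x : Uᵐᵒᵖ) (t : (P ⊗[A] Q) ⊗[A] R) :
    TensorProduct.assoc A P Q R (x • t) = x • TensorProduct.assoc A P Q R t := by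
  induction t with
  | zero => simp
  | add t t' h h' => simp only [smul_add, map_add, h, h']
  | tmul t r =>
    induction t with
    | zero => simp
    | add t t' h h' => simp only [add_tmul, smul_add, map_add, h, h']
    | tmul p q =>
      rw [tensor_smul, assoc_tmul, tensor_smul, orbit_tensor, orbit_tensor]
      have h := Coalgebra.coassoc_apply (R := A) x.unop
      rw [← LinearMap.comp_id (orbit r), TensorProduct.map_comp, LinearMap.comp_apply,
        ← LinearMap.comp_id (orbit p), TensorProduct.map_comp (f₁ := LinearMap.id),
        LinearMap.comp_apply]
      simp only [LinearMap.comp_id]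
      change _ = TensorProduct.map _ _ ((LinearMap.lTensor U (comul (R := A))) _)
      rw [← h, TensorProduct.map_map_assoc]
      rfl

theorem lid_smul (x : Uᵐᵒᵖ) (t : A ⊗[A] P) :
    TensorProduct.lid A P (x • t) = x • TensorProduct.lid A P t := by
  induction t with
  | zero => simp
  | add t t' h h' => simp only [smul_add, map_add, h, h']
  | tmul a p =>
    rw [← mul_one a, ← smul_eq_mul, smul_tmul, tensor_smul, orbit_one, lid_tmul, one_smul]
    have h := Coalgebra.rTensor_counit_comul (R := A) x.unop
    have : TensorProduct.map counit (orbit (a • p)) (comul (R := A) x.unop) =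
      (orbit (a • p)).lTensor A (counit.rTensor U (comul (R := A) x.unop)) := by
      rw [← LinearMap.comp_apply (LinearMap.lTensor A _), LinearMap.lTensor_comp_rTensor]
    rw [this, h]
    simp

theorem rid_smul (x : Uᵐᵒᵖ) (t : P ⊗[A] A) :
    TensorProduct.rid A P (x • t) = x • TensorProduct.rid A P t := by
  rw [← TensorProduct.lid_comm, comm_smul, lid_smul, TensorProduct.lid_comm]

end

variable [CocommRightBialgebroid A U]

/-- The tensor product over `A` with the diagonal action. -/
noncomputable def tensorObj (P Q : ProfMod A U) : ProfMod A U :=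
  letI := tensorModule (A := A) (U := U) P Q
  { carrier := P ⊗[A] Q
    tower := tensorTower P Q }

variable (A U) in
/-- The unit object `A`, with `a · x = ε (src a * x)`. -/
noncomputable def unitObj : ProfMod A U :=
  letI := unitModule (A := A) (U := U)
  { carrier := A
    tower := unitTower }

/-- The tensor product of two morphisms. -/
noncomputable def tensorMap {P Q P' Q' : ProfMod A U} (f : P ⟶ P') (g : Q ⟶ Q') :
    tensorObj P Q ⟶ tensorObj P' Q' where
  lin := TensorProduct.map (Hom.lin f) (Hom.lin g)
  map_act := map_smul_tensor _ _ (Hom.map_act f) (Hom.map_act g)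

noncomputable instance : MonoidalCategoryStruct (ProfMod A U) where
  tensorObj := tensorObj
  tensorUnit := unitObj A U
  tensorHom := tensorMap
  whiskerLeft P _ _ g := tensorMap (𝟙 P) g
  whiskerRight f Q := tensorMap f (𝟙 Q)
  associator P Q R := mkIso (P := tensorObj (tensorObj P Q) R) (Q := tensorObj P (tensorObj Q R))
    (TensorProduct.assoc A P Q R) (letI := tensorModule (A := A) (U := U); letI := tensorTower (A := A) (U := U); assoc_smul (P := P) (Q := Q) (R := R))
  leftUnitor P := mkIso (P := tensorObj (unitObj A U) P) (Q := P) (TensorProduct.lid A P)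
    (lid_smul (A := A) (U := U) (P := P))
  rightUnitor P := mkIso (P := tensorObj P (unitObj A U)) (Q := P) (TensorProduct.rid A P)
    (rid_smul (A := A) (U := U) (P := P))

/-- The constraints are those of `A`-modules. -/
noncomputable instance : MonoidalCategory (ProfMod A U) :=
  Monoidal.induced (forget A U)
    { μIso := fun P Q => Iso.refl _
      εIso := Iso.refl _
      whiskerLeft_eq := fun X Y Z f => by ext; rfl
      whiskerRight_eq := fun f Z => by ext; rfl
      tensorHom_eq := fun f g => by ext; rfl
      associator_eq := fun X Y Z => ModuleCat.hom_ext <|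
        TensorProduct.ext_threefold fun x y z => rfl
      leftUnitor_eq := fun X => ModuleCat.hom_ext <| TensorProduct.ext' fun a x => rfl
      rightUnitor_eq := fun X => ModuleCat.hom_ext <| TensorProduct.ext' fun a x => rfl }

noncomputable instance : (forget A U).Monoidal := Monoidal.fromInducedMonoidal _ _

/-- The braiding is the flip. -/
noncomputable instance : BraidedCategory (ProfMod A U) :=
  .ofFaithful (forget A U) (fun P Q => mkIso (P := tensorObj P Q) (Q := tensorObj Q P) (TensorProduct.comm A P Q) comm_smul)
    (fun P Q => by ext; rfl)

noncomputable instance : SymmetricCategory (ProfMod A U) where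
  symmetry P Q := by
    apply hom_ext
    exact LinearMap.ext (TensorProduct.comm_comm A Q P)

end ProfMod
end ProfMod

section Along
variable {A : Type u} {H : Type v} [CommRing A] [CommRing H]

/-- A copy of the ring `H`, regarded as an `A`-algebra through `f : A → H`. -/
def Along (_f : A →+* H) : Type v := H

instance (f : A →+* H) : CommRing (Along f) := inferInstanceAs (CommRing H)

instance (f : A →+* H) : Algebra A (Along f) := RingHom.toAlgebra (S := Along f) f

/-- The identity map from `H` to its copy. -/
def toAlong (f : A →+* H) : H ≃+* Along f := RingEquiv.refl H

theorem algebraMap_along (f : A →+* H) (a : A) : algebraMap A (Along f) a = toAlong f (f a) := rfl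
theorem smul_along (f : A →+* H) (a : A) (x : H) : a • toAlong f x = toAlong f (f a * x) := rfl

end Along

/-- The structure maps of a commutative bialgebroid `(A, H)`: source `s`, target `t`,
comultiplication `Δ` and counit `ε`, all ring homomorphisms and compatible with `s` and `t`. In
`H ⊗ H` the first factor is an `A`-module through `t` and the second one through `s`. -/
structure CommBialgebroidData (A : Type u) (H : Type v) [CommRing A] [CommRing H] where
  s : A →+* H
  t : A →+* H
  Δ : H →+* Along t ⊗[A] Along s
  ε : H →+* A
  Δ_s : ∀ a, Δ (s a) = toAlong t (s a) ⊗ₜ 1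
  Δ_t : ∀ a, Δ (t a) = 1 ⊗ₜ toAlong s (t a)
  ε_s : ∀ a, ε (s a) = a
  ε_t : ∀ a, ε (t a) = a

namespace CommBialgebroidData
variable {A : Type u} {H : Type v} [CommRing A] [CommRing H] (D : CommBialgebroidData A H)

/-- `H ⊗ H` as an `A`-algebra through `a ↦ s a ⊗ 1`. -/
abbrev HH : Type v :=
  Along ((Algebra.TensorProduct.includeLeftRingHom.comp
    ((toAlong D.t).toRingHom.comp D.s) : A →+* Along D.t ⊗[A] Along D.s))

/-- `Δ` as a map of `A`-algebras, `A` acting through `s`. -/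
def comulAlg : Along D.s →ₐ[A] D.HH :=
  { ((toAlong _).toRingHom.comp (D.Δ.comp (toAlong D.s).symm.toRingHom) : Along D.s →+* D.HH) with
    commutes' := D.Δ_s }

/-- `h ↦ h ⊗ 1`. -/
noncomputable def inl : Along D.s →ₐ[A] D.HH :=
  { ((toAlong _).toRingHom.comp ((Algebra.TensorProduct.includeLeftRingHom :
      Along D.t →+* Along D.t ⊗[A] Along D.s).comp
        ((toAlong D.t).toRingHom.comp (toAlong D.s).symm.toRingHom)) : Along D.s →+* D.HH) with
    commutes' := fun _ => rfl }

/-- `h ↦ 1 ⊗ h`. -/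
noncomputable def inr : Along D.s →+* D.HH :=
  (toAlong _).toRingHom.comp (Algebra.TensorProduct.includeRight :
      Along D.s →ₐ[A] Along D.t ⊗[A] Along D.s).toRingHom

theorem inr_s (a : A) : D.inr (toAlong D.s (D.s a)) = D.inl (toAlong D.s (D.t a)) := by
  change (1 : Along D.t) ⊗ₜ[A] (algebraMap A (Along D.s) a) = (algebraMap A (Along D.t) a) ⊗ₜ[A] 1
  rw [Algebra.algebraMap_eq_smul_one, Algebra.algebraMap_eq_smul_one, smul_tmul]

/-- `ε` as a map of `A`-algebras, `A` acting on `H` through `s`. -/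
def εs : Along D.s →ₐ[A] A :=
  { (D.ε.comp (toAlong D.s).symm.toRingHom : Along D.s →+* A) with commutes' := D.ε_s }

/-- `ε` as a map of `A`-algebras, `A` acting on `H` through `t`. -/
def εt : Along D.t →ₐ[A] A :=
  { (D.ε.comp (toAlong D.t).symm.toRingHom : Along D.t →+* A) with commutes' := D.ε_t }

section
variable (M : Type*) [AddCommGroup M] [Module A M] {X : Type*} [CommRing X] [Algebra A X]
/-- `m ⊗ y ↦ m ⊗ x y`. -/
noncomputable abbrev mulR (x : X) : M ⊗[A] X →ₗ[A] M ⊗[A] X :=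
  LinearMap.lTensor M (LinearMap.mulLeft A x)
end

variable {M : Type*} [AddCommGroup M] [Module A M]

theorem mulR_mul {X : Type*} [CommRing X] [Algebra A X] (x y : X) (z : M ⊗[A] X) :
    mulR M (x * y) z = mulR M x (mulR M y z) := by
  simp [mulR, LinearMap.lTensor_comp]

theorem mulR_map {X Y : Type*} [CommRing X] [Algebra A X] [CommRing Y] [Algebra A Y] (f : X →ₐ[A] Y)
   (x : X) (z : M ⊗[A] X) :
    LinearMap.lTensor M f.toLinearMap (mulR M x z) = mulR M (f x) (LinearMap.lTensor M f.toLinearMap z) := by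
  induction z with
  | zero => simp
  | add t t' h h' => simp only [map_add, h, h']
  | tmul p q => simp

/-- The map `ρ ⊗ H : M ⊗ H → M ⊗ (H ⊗ H)`, `m ⊗ h ↦ m₀ ⊗ (m₁ ⊗ h)`, for `ρ m = m₀ ⊗ m₁`. -/
noncomputable def coactTensor (ρ : M →+ M ⊗[A] Along D.s)
    (hρ : ∀ (a : A) (m : M), ρ (a • m) = mulR M (toAlong D.s (D.t a)) (ρ m)) :
    M ⊗[A] Along D.s →+ M ⊗[A] D.HH :=
  liftAddHom
    (AddMonoidHom.mk' (fun m => AddMonoidHom.mk'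
      (fun h => mulR M (D.inr h) (LinearMap.lTensor M D.inl.toLinearMap (ρ m)))
      (fun h h' => by
        have : LinearMap.mulLeft A (D.inr (h + h')) =
          LinearMap.mulLeft A (D.inr h) + LinearMap.mulLeft A (D.inr h') := by
            ext; simp [add_mul]
        rw [mulR, this, LinearMap.lTensor_add]; rfl))
      (fun m m' => by ext h; simp))
    (fun a m h => by
      change mulR M (D.inr h) (LinearMap.lTensor M D.inl.toLinearMap (ρ (a • m))) =
        mulR M (D.inr (toAlong D.s (D.s a) * h)) (LinearMap.lTensor M D.inl.toLinearMap (ρ m))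
      rw [hρ, mulR_map, map_mul, inr_s, mul_comm, mulR_mul])

theorem coactTensor_tmul (ρ : M →+ M ⊗[A] Along D.s)
    (hρ : ∀ (a : A) (m : M), ρ (a • m) = mulR M (toAlong D.s (D.t a)) (ρ m)) (m : M) (h : Along D.s) :
    D.coactTensor ρ hρ (m ⊗ₜ h) = mulR M (D.inr h) (LinearMap.lTensor M D.inl.toLinearMap (ρ m)) := rfl

variable (M) in
/-- A right comodule structure on the `A`-module `M`: a coaction `ρ : M → M ⊗ H`, where `H` is an
`A`-module through `s`, which is `A`-linear for the target (`ρ (a m) = t a ρ m`), counital and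
coassociative. -/
structure Coaction where
  ρ : M →+ M ⊗[A] Along D.s
  map_smul : ∀ (a : A) (m : M), ρ (a • m) = mulR M (toAlong D.s (D.t a)) (ρ m)
  counit : ∀ m, TensorProduct.rid A M (LinearMap.lTensor M D.εs.toLinearMap (ρ m)) = m
  coassoc : ∀ m, LinearMap.lTensor M D.comulAlg.toLinearMap (ρ m) = D.coactTensor ρ map_smul (ρ m)

/-- `Δ` on the copy of `H` on which `A` acts through `t`. -/
noncomputable def Δadd : Along D.t →+ Along D.t ⊗[A] Along D.s :=
  D.Δ.toAddMonoidHom.comp (toAlong D.t).symm.toAddMonoidHom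

theorem Δadd_smul (a : A) (h : Along D.t) :
    D.Δadd (a • h) = mulR (Along D.t) (toAlong D.s (D.t a)) (D.Δadd h) := by
  have : ∀ z : Along D.t ⊗[A] Along D.s,
      (1 ⊗ₜ[A] toAlong D.s (D.t a)) * z = mulR (Along D.t) (toAlong D.s (D.t a)) z := by
    intro z
    induction z with
    | zero => simp
    | add t t' h h' => simp only [map_add, mul_add, h, h']
    | tmul p q => simp
  rw [← this, ← D.Δ_t]
  exact map_mul D.Δ (D.t a) h


section mulT
variable (M) (N : Type*) [AddCommGroup N] [Module A N] (X : Type*) [CommRing X] [Algebra A X]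

/-- `(m ⊗ x, n ⊗ y) ↦ (m ⊗ n) ⊗ x y` -/
noncomputable def mulT : M ⊗[A] X →ₗ[A] N ⊗[A] X →ₗ[A] (M ⊗[A] N) ⊗[A] X :=
  TensorProduct.curry (LinearMap.lTensor (M ⊗[A] N) (LinearMap.mul' A X) ∘ₗ
    (TensorProduct.tensorTensorTensorComm A M X N X).toLinearMap)

variable {M N X}

@[simp] theorem mulT_tmul (m : M) (x : X) (n : N) (y : X) :
    mulT (A := A) M N X (m ⊗ₜ x) (n ⊗ₜ y) = (m ⊗ₜ n) ⊗ₜ (x * y) := by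
  simp [mulT]

theorem tensor_induction₂ {P Q P' Q' : Type*} [AddCommGroup P] [AddCommGroup Q] [AddCommGroup P']
    [AddCommGroup Q'] [Module A P] [Module A Q] [Module A P'] [Module A Q']
    {p : P ⊗[A] Q → P' ⊗[A] Q' → Prop} (h0 : ∀ y, p 0 y) (h0' : ∀ x, p x 0)
    (ht : ∀ a b c d, p (a ⊗ₜ b) (c ⊗ₜ d)) (ha : ∀ x x' y, p x y → p x' y → p (x + x') y)
    (ha' : ∀ x y y', p x y → p x y' → p x (y + y')) (x : P ⊗[A] Q) (y : P' ⊗[A] Q') : p x y := by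
  induction x with
  | zero => exact h0 y
  | add x x' h h' => exact ha _ _ _ h h'
  | tmul a b =>
    induction y with
    | zero => exact h0' _
    | add y y' h h' => exact ha' _ _ _ h h'
    | tmul c d => exact ht a b c d

theorem lTensor_mulT {Y : Type*} [CommRing Y] [Algebra A Y] (f : X →ₐ[A] Y) (x : M ⊗[A] X)
    (y : N ⊗[A] X) : LinearMap.lTensor (M ⊗[A] N) f.toLinearMap (mulT M N X x y) =
      mulT M N Y (LinearMap.lTensor M f.toLinearMap x) (LinearMap.lTensor N f.toLinearMap y) := by
  induction x, y using tensor_induction₂ with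
  | h0 y => simp
  | h0' x => simp
  | ht m h n k => simp
  | ha x x' y h h' => simp only [map_add, LinearMap.add_apply, h, h']
  | ha' x x' y h h' => simp only [map_add, h, h']

theorem mulR_mulT (a b : X) (x : M ⊗[A] X) (y : N ⊗[A] X) :
    mulR (M ⊗[A] N) (a * b) (mulT M N X x y) = mulT M N X (mulR M a x) (mulR N b y) := by
  induction x, y using tensor_induction₂ with
  | h0 y => simp
  | h0' x => simp
  | ht m h n k =>
    simp only [mulR, LinearMap.lTensor_tmul, LinearMap.mulLeft_apply, mulT_tmul, mul_mul_mul_comm]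
  | ha x x' y h h' => simp only [map_add, LinearMap.add_apply, h, h']
  | ha' x x' y h h' => simp only [map_add, h, h']

theorem mulR_mulT_left (a : X) (x : M ⊗[A] X) (y : N ⊗[A] X) :
    mulT M N X (mulR M a x) y = mulR (M ⊗[A] N) a (mulT M N X x y) := by
  have := mulR_mulT a 1 x y
  rw [mul_one] at this
  rw [this]; simp [mulR]

theorem mulR_mulT_right (a : X) (x : M ⊗[A] X) (y : N ⊗[A] X) :
    mulT M N X x (mulR N a y) = mulR (M ⊗[A] N) a (mulT M N X x y) := by
  have := mulR_mulT 1 a x y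
  rw [one_mul] at this
  rw [this]; simp [mulR]

theorem rid_mulT (f : X →ₐ[A] A) (x : M ⊗[A] X) (y : N ⊗[A] X) :
    TensorProduct.rid A _ (LinearMap.lTensor (M ⊗[A] N) f.toLinearMap (mulT M N X x y)) =
      TensorProduct.rid A _ (LinearMap.lTensor M f.toLinearMap x) ⊗ₜ
        TensorProduct.rid A _ (LinearMap.lTensor N f.toLinearMap y) := by
  induction x, y using tensor_induction₂ with
  | h0 y => simp
  | h0' x => simp
  | ht m h n k => simp [smul_tmul', smul_smul, mul_comm]
  | ha x x' y h h' => simp only [map_add, LinearMap.add_apply, h, h', add_tmul]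
  | ha' x x' y h h' => simp only [map_add, h, h', tmul_add]

theorem map_mulT {M' N' : Type*} [AddCommGroup M'] [Module A M'] [AddCommGroup N'] [Module A N']
    (f : M →ₗ[A] M') (g : N →ₗ[A] N') (x : M ⊗[A] X) (y : N ⊗[A] X) :
    LinearMap.rTensor X (TensorProduct.map f g) (mulT M N X x y) =
      mulT M' N' X (LinearMap.rTensor X f x) (LinearMap.rTensor X g y) := by
  induction x, y using tensor_induction₂ with
  | h0 y => simp
  | h0' x => simp
  | ht m h n k => simp
  | ha x x' y h h' => simp only [map_add, LinearMap.add_apply, h, h']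
  | ha' x x' y h h' => simp only [map_add, h, h']

theorem comm_mulT (x : M ⊗[A] X) (y : N ⊗[A] X) :
    LinearMap.rTensor X (TensorProduct.comm A M N).toLinearMap (mulT M N X x y) =
      mulT N M X y x := by
  induction x, y using tensor_induction₂ with
  | h0 y => simp
  | h0' x => simp
  | ht m h n k => simp [mul_comm]
  | ha x x' y h h' => simp only [map_add, LinearMap.add_apply, h, h']
  | ha' x x' y h h' => simp only [map_add, LinearMap.add_apply, h, h']

theorem assoc_mulT {R : Type*} [AddCommGroup R] [Module A R] (x : M ⊗[A] X) (y : N ⊗[A] X)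
    (z : R ⊗[A] X) :
    LinearMap.rTensor X (TensorProduct.assoc A M N R).toLinearMap
      (mulT (M ⊗[A] N) R X (mulT M N X x y) z) = mulT M (N ⊗[A] R) X x (mulT N R X y z) := by
  induction z with
  | zero => simp
  | add t t' h h' => simp only [map_add, h, h']
  | tmul r c =>
    induction x, y using tensor_induction₂ with
    | h0 y => simp
    | h0' x => simp
    | ht m h n k => simp [mul_assoc]
    | ha x x' y h h' => simp only [map_add, LinearMap.add_apply, h, h']
    | ha' x x' y h h' => simp only [map_add, LinearMap.add_apply, h, h']

theorem lid_mulT (a : X) (x : M ⊗[A] X) :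
    LinearMap.rTensor X (TensorProduct.lid A M).toLinearMap (mulT A M X (1 ⊗ₜ a) x) =
      mulR M a x := by
  induction x with
  | zero => simp
  | add t t' h h' => simp only [map_add, h, h']
  | tmul r c => simp

theorem rid_mulT' (a : X) (x : M ⊗[A] X) :
    LinearMap.rTensor X (TensorProduct.rid A M).toLinearMap (mulT M A X x (1 ⊗ₜ a)) =
      mulR M a x := by
  induction x with
  | zero => simp
  | add t t' h h' => simp only [map_add, LinearMap.add_apply, h, h']
  | tmul r c => simp [mul_comm]

end mulT

namespace Coaction
variable {D} {N : Type*} [AddCommGroup N] [Module A N]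

/-- The diagonal coaction `m ⊗ n ↦ (m₀ ⊗ n₀) ⊗ m₁ n₁` -/
noncomputable def tensorMap (r : D.Coaction M) (r' : D.Coaction N) :
    M ⊗[A] N →+ (M ⊗[A] N) ⊗[A] Along D.s :=
  liftAddHom
    (AddMonoidHom.mk' (fun m => AddMonoidHom.mk' (fun n => mulT M N _ (r.ρ m) (r'.ρ n))
      (fun n n' => by simp)) (fun m m' => by ext n; simp))
    (fun a m n => by
      change mulT M N _ (r.ρ (a • m)) (r'.ρ n) = mulT M N _ (r.ρ m) (r'.ρ (a • n))
      rw [r.map_smul, r'.map_smul, mulR_mulT_left, mulR_mulT_right])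

theorem tensorMap_tmul (r : D.Coaction M) (r' : D.Coaction N) (m : M) (n : N) :
    tensorMap r r' (m ⊗ₜ n) = mulT M N _ (r.ρ m) (r'.ρ n) := rfl

theorem tensorMap_smul (r : D.Coaction M) (r' : D.Coaction N) (a : A) (z : M ⊗[A] N) :
    tensorMap r r' (a • z) = mulR _ (toAlong D.s (D.t a)) (tensorMap r r' z) := by
  induction z with
  | zero => simp
  | add t t' h h' => simp only [map_add, smul_add, h, h']
  | tmul m n => rw [smul_tmul', tensorMap_tmul, r.map_smul, mulR_mulT_left, tensorMap_tmul]

/-- The tensor product of comodules. -/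
noncomputable def tensor (r : D.Coaction M) (r' : D.Coaction N) : D.Coaction (M ⊗[A] N) where
  ρ := tensorMap r r'
  map_smul := tensorMap_smul r r'
  counit z := by
    induction z with
    | zero => simp
    | add t t' h h' => simp only [map_add, h, h']
    | tmul m n => rw [tensorMap_tmul, rid_mulT, r.counit, r'.counit]
  coassoc z := by
    induction z with
    | zero => simp
    | add t t' h h' => simp only [map_add, h, h']
    | tmul m n =>
      have key : ∀ x y, D.coactTensor (tensorMap r r') (tensorMap_smul r r') (mulT M N _ x y) =
          mulT M N _ (D.coactTensor r.ρ r.map_smul x) (D.coactTensor r'.ρ r'.map_smul y) := by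
        intro x y
        induction x, y using tensor_induction₂ with
        | h0 y => simp
        | h0' x => simp
        | ht m h n k =>
          rw [mulT_tmul, coactTensor_tmul, coactTensor_tmul, coactTensor_tmul, tensorMap_tmul,
            lTensor_mulT, map_mul, mulR_mulT]
        | ha x x' y h h' => simp only [map_add, LinearMap.add_apply, h, h']
        | ha' x x' y h h' => simp only [map_add, h, h']
      rw [tensorMap_tmul, lTensor_mulT, r.coassoc, r'.coassoc, key]

variable (D) in
/-- The unit comodule `A`, with coaction `a ↦ 1 ⊗ t a`. -/
noncomputable def unit : D.Coaction A where
  ρ := AddMonoidHom.mk' (fun a => 1 ⊗ₜ toAlong D.s (D.t a)) (fun a b => by simp [tmul_add])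
  map_smul a b := by simp
  counit a := by
    change (D.ε (D.t a)) • (1 : A) = a
    rw [D.ε_t]; simp
  coassoc a := by
    change (1 : A) ⊗ₜ[A] (D.comulAlg (toAlong D.s (D.t a))) = 1 ⊗ₜ[A] (D.inr (toAlong D.s (D.t a)) * D.inl (toAlong D.s (D.t 1)))
    rw [map_one, map_one, map_one, mul_one]
    congr 1
    exact D.Δ_t a

theorem map_tensorMap {M' N' : Type*} [AddCommGroup M'] [Module A M'] [AddCommGroup N'] [Module A N']
    (r : D.Coaction M) (r' : D.Coaction N) (q : D.Coaction M') (q' : D.Coaction N')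
    (f : M →ₗ[A] M') (g : N →ₗ[A] N') (hf : ∀ m, LinearMap.rTensor _ f (r.ρ m) = q.ρ (f m))
    (hg : ∀ n, LinearMap.rTensor _ g (r'.ρ n) = q'.ρ (g n)) (z : M ⊗[A] N) :
    LinearMap.rTensor _ (TensorProduct.map f g) (tensorMap r r' z) =
      tensorMap q q' (TensorProduct.map f g z) := by
  induction z with
  | zero => simp
  | add t t' h h' => simp only [map_add, h, h']
  | tmul m n => rw [tensorMap_tmul, map_mulT, hf, hg, map_tmul, tensorMap_tmul]

theorem comm_tensorMap (r : D.Coaction M) (r' : D.Coaction N) (z : M ⊗[A] N) :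
    LinearMap.rTensor _ (TensorProduct.comm A M N).toLinearMap (tensorMap r r' z) =
      tensorMap r' r (TensorProduct.comm A M N z) := by
  induction z with
  | zero => simp
  | add t t' h h' => simp only [map_add, h, h']
  | tmul m n => rw [tensorMap_tmul, comm_mulT, comm_tmul, tensorMap_tmul]

theorem assoc_tensorMap {R : Type*} [AddCommGroup R] [Module A R]
    (r : D.Coaction M) (r' : D.Coaction N) (r'' : D.Coaction R) (z : (M ⊗[A] N) ⊗[A] R) :
    LinearMap.rTensor _ (TensorProduct.assoc A M N R).toLinearMap
      (tensorMap (tensor r r') r'' z) =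
      tensorMap r (tensor r' r'') (TensorProduct.assoc A M N R z) := by
  induction z with
  | zero => simp
  | add t t' h h' => simp only [map_add, h, h']
  | tmul z n =>
    induction z with
    | zero => simp
    | add t t' h h' => simp only [map_add, add_tmul, h, h']
    | tmul l m =>
      rw [assoc_tmul, tensorMap_tmul, tensorMap_tmul]
      exact assoc_mulT _ _ _

theorem lid_tensorMap (r : D.Coaction M) (z : A ⊗[A] M) :
    LinearMap.rTensor _ (TensorProduct.lid A M).toLinearMap (tensorMap (unit D) r z) =
      r.ρ (TensorProduct.lid A M z) := by
  induction z with
  | zero => simp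
  | add t t' h h' => simp only [map_add, h, h']
  | tmul a m =>
    rw [lid_tmul, r.map_smul]
    exact lid_mulT _ _

theorem rid_tensorMap (r : D.Coaction M) (z : M ⊗[A] A) :
    LinearMap.rTensor _ (TensorProduct.rid A M).toLinearMap (tensorMap r (unit D) z) =
      r.ρ (TensorProduct.rid A M z) := by
  induction z with
  | zero => simp
  | add t t' h h' => simp only [map_add, h, h']
  | tmul m a =>
    rw [rid_tmul, r.map_smul]
    exact rid_mulT' _ _

end Coaction

end CommBialgebroidData

/-- A commutative bialgebroid `(A, H)`: `Δ` is counital and coassociative. -/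
structure CommBialgebroid (A : Type u) (H : Type v) [CommRing A] [CommRing H] extends
    CommBialgebroidData A H where
  counit_left : ∀ h, TensorProduct.lid A (Along s)
    (LinearMap.rTensor (Along s) toCommBialgebroidData.εt.toLinearMap (Δ h)) = toAlong s h
  counit_right : ∀ h, TensorProduct.rid A (Along t)
    (LinearMap.lTensor (Along t) toCommBialgebroidData.εs.toLinearMap (Δ h)) = toAlong t h
  coassoc : ∀ h, LinearMap.lTensor (Along t) toCommBialgebroidData.comulAlg.toLinearMap (Δ h) =
    toCommBialgebroidData.coactTensor toCommBialgebroidData.Δadd toCommBialgebroidData.Δadd_smul (Δ h)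

/-- An antipode, which makes a commutative bialgebroid a commutative Hopf algebroid: `S` exchanges
`s` and `t`, `h₁ S h₂ = s (ε h)` and `S h₁ h₂ = t (ε h)`. -/
structure CommBialgebroid.Antipode {A : Type u} {H : Type v} [CommRing A] [CommRing H]
    (B : CommBialgebroid A H) where
  S : H →+* H
  S_s : ∀ a, S (B.s a) = B.t a
  S_t : ∀ a, S (B.t a) = B.s a
  mul_S : ∀ (h : H) {n : ℕ} (x y : Fin n → H),
    B.Δ h = ∑ i, toAlong B.t (x i) ⊗ₜ toAlong B.s (y i) → ∑ i, x i * S (y i) = B.s (B.ε h)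
  S_mul : ∀ (h : H) {n : ℕ} (x y : Fin n → H),
    B.Δ h = ∑ i, toAlong B.t (x i) ⊗ₜ toAlong B.s (y i) → ∑ i, S (x i) * y i = B.t (B.ε h)


/-- An `A`-profinite right comodule: a right comodule, finitely generated and projective over `A`. -/
structure ProfComod {A : Type u} {H : Type v} [CommRing A] [CommRing H]
    (B : CommBialgebroid A H) where
  carrier : Type u
  [addCommGroup : AddCommGroup carrier]
  [moduleA : Module A carrier]
  [finite : Module.Finite A carrier]
  [projective : Module.Projective A carrier]
  coaction : B.Coaction carrier

namespace ProfComod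
open CommBialgebroidData
variable {A : Type u} {H : Type v} [CommRing A] [CommRing H] {B : CommBialgebroid A H}

instance : CoeSort (ProfComod B) (Type u) := ⟨carrier⟩

attribute [instance] addCommGroup moduleA finite projective

/-- The coaction. -/
abbrev ρ (P : ProfComod B) : P →+ P ⊗[A] Along B.s := P.coaction.ρ

/-- Morphisms are the `A`-linear maps compatible with the coactions. -/
@[ext] structure Hom (P Q : ProfComod B) where
  lin : P →ₗ[A] Q
  map_coact : ∀ p : P, LinearMap.rTensor (Along B.s) lin (P.ρ p) = Q.ρ (lin p)

instance : Category (ProfComod B) where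
  Hom := Hom
  id P := ⟨LinearMap.id, fun _ => by simp⟩
  comp f g := ⟨g.lin ∘ₗ f.lin, fun p => by
    rw [LinearMap.rTensor_comp_apply, f.map_coact, g.map_coact]; rfl⟩

@[ext] theorem hom_ext {P Q : ProfComod B} {f g : P ⟶ Q} (h : Hom.lin f = Hom.lin g) : f = g :=
  Hom.ext h

variable (B) in
/-- The forgetful functor to `A`-modules. -/
def forget : ProfComod B ⥤ ModuleCat.{u} A where
  obj P := ModuleCat.of A P
  map f := ModuleCat.ofHom (Hom.lin f)

instance : (forget B).Faithful where
  map_injective h := hom_ext (ModuleCat.hom_ext_iff.mp h)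

/-- An isomorphism from a bijective colinear map. -/
def mkIso {P Q : ProfComod B} (e : P ≃ₗ[A] Q)
    (h : ∀ p : P, LinearMap.rTensor (Along B.s) e.toLinearMap (P.ρ p) = Q.ρ (e p)) : P ≅ Q where
  hom := ⟨e, h⟩
  inv := ⟨e.symm, fun q => by
    have h' := h (e.symm q)
    rw [e.apply_symm_apply] at h'
    rw [← h', ← LinearMap.rTensor_comp_apply]
    simp⟩
  hom_inv_id := hom_ext (LinearMap.ext e.symm_apply_apply)
  inv_hom_id := hom_ext (LinearMap.ext e.apply_symm_apply)

/-- The tensor product over `A` with the diagonal coaction. -/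
noncomputable def tensorObj (P Q : ProfComod B) : ProfComod B where
  carrier := P ⊗[A] Q
  coaction := P.coaction.tensor Q.coaction

variable (B) in
/-- The unit comodule. -/
noncomputable def unitObj : ProfComod B where
  carrier := A
  coaction := Coaction.unit B.toCommBialgebroidData

/-- The tensor product of two morphisms. -/
noncomputable def tensorMap {P Q P' Q' : ProfComod B} (f : P ⟶ P') (g : Q ⟶ Q') :
    tensorObj P Q ⟶ tensorObj P' Q' where
  lin := TensorProduct.map (Hom.lin f) (Hom.lin g)
  map_coact := Coaction.map_tensorMap _ _ _ _ _ _ (Hom.map_coact f) (Hom.map_coact g)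

noncomputable instance : MonoidalCategoryStruct (ProfComod B) where
  tensorObj := tensorObj
  tensorUnit := unitObj B
  tensorHom := tensorMap
  whiskerLeft P _ _ g := tensorMap (𝟙 P) g
  whiskerRight f Q := tensorMap f (𝟙 Q)
  associator P Q R := mkIso (P := tensorObj (tensorObj P Q) R) (Q := tensorObj P (tensorObj Q R))
    (TensorProduct.assoc A P Q R)
    (Coaction.assoc_tensorMap P.coaction Q.coaction R.coaction)
  leftUnitor P := mkIso (P := tensorObj (unitObj B) P) (Q := P) (TensorProduct.lid A P)
    (Coaction.lid_tensorMap P.coaction)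
  rightUnitor P := mkIso (P := tensorObj P (unitObj B)) (Q := P) (TensorProduct.rid A P)
    (Coaction.rid_tensorMap P.coaction)

/-- The constraints are those of `A`-modules. -/
noncomputable instance : MonoidalCategory (ProfComod B) :=
  Monoidal.induced (forget B)
    { μIso := fun P Q => Iso.refl _
      εIso := Iso.refl _
      whiskerLeft_eq := fun X Y Z f => by ext; rfl
      whiskerRight_eq := fun f Z => by ext; rfl
      tensorHom_eq := fun f g => by ext; rfl
      associator_eq := fun X Y Z => ModuleCat.hom_ext <|
        TensorProduct.ext_threefold fun x y z => rfl
      leftUnitor_eq := fun X => ModuleCat.hom_ext <| TensorProduct.ext' fun a x => rfl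
      rightUnitor_eq := fun X => ModuleCat.hom_ext <| TensorProduct.ext' fun a x => rfl }

noncomputable instance : (forget B).Monoidal := Monoidal.fromInducedMonoidal _ _

/-- The braiding is the flip. -/
noncomputable instance : BraidedCategory (ProfComod B) :=
  .ofFaithful (forget B) (fun P Q => mkIso (P := tensorObj P Q) (Q := tensorObj Q P)
    (TensorProduct.comm A P Q) (Coaction.comm_tensorMap P.coaction Q.coaction))
    (fun P Q => by ext; rfl)

noncomputable instance : SymmetricCategory (ProfComod B) where
  symmetry P Q := by
    apply hom_ext
    exact LinearMap.ext (TensorProduct.comm_comm A Q P)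

end ProfComod


section DualBasis
variable {A : Type u} [CommRing A]

/-- A finite dual basis: `∑ e' i x • e i = x` for all `x`. -/
def IsDualBasis {P : Type*} [AddCommGroup P] [Module A P] {ι : Type*} [Fintype ι] (e : ι → P)
    (e' : ι → Module.Dual A P) : Prop := ∀ x, ∑ i, e' i x • e i = x

theorem exists_dualBasis (P : Type*) [AddCommGroup P] [Module A P] [Module.Finite A P]
    [Module.Projective A P] :
    ∃ (n : ℕ) (e : Fin n → P) (e' : Fin n → Module.Dual A P), IsDualBasis e e' := by
  obtain ⟨n, f, g, -, -, h⟩ := Module.Finite.exists_comp_eq_id_of_projective A P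
  refine ⟨n, fun i => f (Pi.single i 1), fun i => LinearMap.proj i ∘ₗ g, fun x => ?_⟩
  have h2 := LinearMap.congr_fun h x
  rw [LinearMap.comp_apply, LinearMap.pi_apply_eq_sum_univ f] at h2
  refine Eq.trans (Finset.sum_congr rfl fun i _ => ?_) h2
  exact congrArg (g x i • f ·) (funext fun j => by simp [Pi.single_apply, eq_comm])

theorem IsDualBasis.dual {P : Type*} [AddCommGroup P] [Module A P] {ι : Type*} [Fintype ι]
    {e : ι → P} {e' : ι → Module.Dual A P} (h : IsDualBasis e e') (φ : Module.Dual A P) :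
    ∑ i, φ (e i) • e' i = φ := by
  ext x
  conv_rhs => rw [← h x]
  simp [mul_comm]

theorem IsDualBasis.sum_eq {P Q : Type*} [AddCommGroup P] [Module A P] [AddCommGroup Q] [Module A Q]
    {ι κ : Type*} [Fintype ι] [Fintype κ]
    {e : ι → P} {e' : ι → Module.Dual A P} (h : IsDualBasis e e')
    {f : κ → Q} {f' : κ → Module.Dual A Q} (hf : IsDualBasis f f') (t : P →ₗ[A] Q)
    {X : Type*} [AddCommGroup X] (b : Q →+ Module.Dual A P →+ X)
    (hb : ∀ (a : A) q φ, b (a • q) φ = b q (a • φ)) :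
    ∑ i, b (t (e i)) (e' i) = ∑ j, b (f j) (f' j ∘ₗ t) := by
  have h1 : ∀ i, b (t (e i)) (e' i) = ∑ j, b (f j) (f' j (t (e i)) • e' i) := fun i => by
    conv_lhs => rw [← hf (t (e i))]
    simp [hb]
  simp_rw [h1]
  rw [Finset.sum_comm]
  refine Finset.sum_congr rfl fun j _ => ?_
  rw [← map_sum]
  congr 1
  exact h.dual (f' j ∘ₗ t)

end DualBasis

section FinDual
variable (A : Type u) (U : Type v) [CommRing A] [Ring U] [RightARing A U]

variable {A U} in
/-- The group `P* ⊗ P`. -/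
def Summand (P : ProfMod A U) : Type u := Module.Dual A P ⊗[ℤ] P

variable {A U} in
noncomputable instance (P : ProfMod A U) : AddCommGroup (Summand P) :=
  inferInstanceAs (AddCommGroup (Module.Dual A P ⊗[ℤ] P))

/-- The direct sum of the groups `P* ⊗ P`, over all `A`-profinite right `U`-modules `P`. -/
abbrev PreFinDual : Type (max (u + 1) v) :=
  DirectSum (ProfMod A U) Summand

variable {A U} in
open Classical in
/-- The element `φ ⊗ p` in the summand of `P`. -/
noncomputable def preMk (P : ProfMod A U) : Module.Dual A P →+ P →+ PreFinDual A U :=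
  AddMonoidHom.mk' (fun φ => (DirectSum.of Summand P).comp
      (TensorProduct.mk ℤ (Module.Dual A P) P φ).toAddMonoidHom)
    (fun φ φ' => AddMonoidHom.ext fun p =>
      (congrArg (DirectSum.of Summand P) (add_tmul φ φ' p)).trans (map_add _ _ _))

/-- The relations `φ ⊗ f p = (φ ∘ f) ⊗ p` for all morphisms `f : P → Q` of `A`-profinite modules,
`φ` in `Q*` and `p` in `P`. For `P = Q` they make the tensor products balanced over the
endomorphism rings. -/
noncomputable def relations : AddSubgroup (PreFinDual A U) :=
  AddSubgroup.closure {z | ∃ (P Q : ProfMod A U) (f : P ⟶ Q) (φ : Module.Dual A Q) (p : P),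
    z = preMk Q φ (ProfMod.Hom.lin f p) - preMk P (φ ∘ₗ ProfMod.Hom.lin f) p}

/-- The finite dual `U°` as an abelian group. -/
def FinDual : Type (max (u + 1) v) := PreFinDual A U ⧸ relations A U

noncomputable instance : AddCommGroup (FinDual A U) :=
  inferInstanceAs (AddCommGroup (PreFinDual A U ⧸ relations A U))

namespace FinDual
variable {A U}

variable (A U) in
/-- The quotient map. -/
noncomputable def toFinDual : PreFinDual A U →+ FinDual A U := QuotientAddGroup.mk' (relations A U)

section mk
variable (M : Type u) [AddCommGroup M] [Module A M] [Module Uᵐᵒᵖ M] [IsScalarTower A Uᵐᵒᵖ M]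
  [Module.Finite A M] [Module.Projective A M]

/-- The class of `φ ⊗ p`, for `p` in `M` and `φ` in its dual. -/
noncomputable def mk : Module.Dual A M →+ M →+ FinDual A U :=
  AddMonoidHom.mk' (fun φ => (toFinDual A U).comp (preMk (ProfMod.mk M) φ))
    (fun φ φ' => AddMonoidHom.ext fun p => by simp)

variable {M}

theorem mk_map {N : Type u} [AddCommGroup N] [Module A N] [Module Uᵐᵒᵖ N] [IsScalarTower A Uᵐᵒᵖ N]
    [Module.Finite A N] [Module.Projective A N] (f : M →ₗ[A] N)
    (hf : ∀ (x : Uᵐᵒᵖ) (p : M), f (x • p) = x • f p) (φ : Module.Dual A N) (p : M) :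
    (mk N φ (f p) : FinDual A U) = mk M (φ ∘ₗ f) p := by
  refine (QuotientAddGroup.eq_iff_sub_mem (N := relations A U)).2
    (AddSubgroup.subset_closure ⟨.mk M, .mk N, ⟨f, hf⟩, φ, p, rfl⟩)

end mk

@[elab_as_elim]
theorem induction {p : FinDual A U → Prop} (h0 : p 0)
    (hmk : ∀ (P : Type u) [AddCommGroup P] [Module A P] [Module Uᵐᵒᵖ P] [IsScalarTower A Uᵐᵒᵖ P]
      [Module.Finite A P] [Module.Projective A P] (φ : Module.Dual A P) (x : P), p (mk P φ x))
    (hadd : ∀ x y, p x → p y → p (x + y)) (x : FinDual A U) : p x := by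
  classical
  obtain ⟨x, rfl⟩ := QuotientAddGroup.mk_surjective x
  induction x using DirectSum.induction_on with
  | zero => exact h0
  | of P z =>
    refine TensorProduct.induction_on (motive := fun z : Module.Dual A P ⊗[ℤ] P =>
      p (toFinDual A U (DirectSum.of Summand P z))) z ?_ (hmk P) (fun x y hx hy => ?_)
    · exact (congrArg p ((congrArg _ (map_zero _)).trans (map_zero _))).mpr h0
    · exact (congrArg p ((congrArg _ (map_add _ _ _)).trans (map_add _ _ _))).mpr (hadd _ _ hx hy)
  | add x y hx hy => exact hadd _ _ hx hy

theorem hom_ext {X : Type*} [AddCommGroup X] {f g : FinDual A U →+ X}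
    (h : ∀ (P : Type u) [AddCommGroup P] [Module A P] [Module Uᵐᵒᵖ P] [IsScalarTower A Uᵐᵒᵖ P]
      [Module.Finite A P] [Module.Projective A P] (φ : Module.Dual A P) (x : P),
      f (mk P φ x) = g (mk P φ x)) : f = g := by
  ext x
  induction x using induction with
  | h0 => simp
  | hmk P φ x => exact h P φ x
  | hadd x y hx hy => rw [map_add, map_add, hx, hy]

section lift
variable {X : Type*} [AddCommGroup X] (f : ∀ (P : Type u) [AddCommGroup P] [Module A P]
  [Module Uᵐᵒᵖ P] [IsScalarTower A Uᵐᵒᵖ P] [Module.Finite A P] [Module.Projective A P],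
    Module.Dual A P →+ P →+ X)

/-- The map on one summand. -/
noncomputable def liftSummand (P : ProfMod A U) : Summand P →+ X :=
  liftAddHom (R := ℤ) (f P) (fun n φ p => by simp)

open Classical in
/-- The map on the direct sum. -/
noncomputable def preLift : PreFinDual A U →+ X := DirectSum.toAddMonoid (liftSummand f)

theorem preLift_preMk (P : ProfMod A U) (φ : Module.Dual A P) (p : P) :
    preLift f (preMk P φ p) = f P φ p := by
  classical
  exact DirectSum.toAddMonoid_of (liftSummand f) P _

variable (hf : ∀ (P Q : ProfMod A U) (t : P →ₗ[A] Q) (_ : ∀ (x : Uᵐᵒᵖ) p, t (x • p) = x • t p)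
  (φ : Module.Dual A Q) (p : P), f Q φ (t p) = f P (φ ∘ₗ t) p)

/-- A natural family of biadditive maps on `P* × P` induces a map on `U°`. -/
noncomputable def lift : FinDual A U →+ X :=
  QuotientAddGroup.lift (relations A U) (preLift f)
    ((AddSubgroup.closure_le _).2 (by
      rintro _ ⟨P, Q, t, φ, p, rfl⟩
      simp [preLift_preMk, hf P Q t.1 t.2]))

@[simp] theorem lift_mk (P : Type u) [AddCommGroup P] [Module A P] [Module Uᵐᵒᵖ P]
    [IsScalarTower A Uᵐᵒᵖ P] [Module.Finite A P] [Module.Projective A P] (φ : Module.Dual A P)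
    (p : P) : lift f hf (mk P φ p) = f P φ p := preLift_preMk f (.mk P) φ p

end lift

/-- The canonical map `ζ : U° → U*`, `ζ (φ ⊗ p) x = φ (p x)`. -/
noncomputable def zeta : FinDual A U →+ Module.Dual A U :=
  lift (fun P => AddMonoidHom.mk' (fun φ => AddMonoidHom.mk' (fun p => φ ∘ₗ ProfMod.orbit p)
      (fun p p' => by ext x; simp)) (fun φ φ' => by ext p x; simp))
    (fun P Q t ht φ p => by ext x; simp [← ht])

theorem zeta_mk (P : Type u) [AddCommGroup P] [Module A P] [Module Uᵐᵒᵖ P]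
    [IsScalarTower A Uᵐᵒᵖ P] [Module.Finite A P] [Module.Projective A P]
    (φ : Module.Dual A P) (p : P) (x : U) :
    (zeta (mk P φ p) : Module.Dual A U) x = φ (op x • p) := by
  rw [zeta, lift_mk]; rfl

end FinDual
end FinDual

namespace FinDual
variable {A : Type u} {U : Type v} [CommRing A] [Ring U] [RightARing A U]

section mul
variable [CocommRightBialgebroid A U]

attribute [local instance] ProfMod.tensorModule ProfMod.tensorTower ProfMod.unitModule
  ProfMod.unitTower

section
variable (P Q : Type u) [AddCommGroup P] [Module A P] [Module Uᵐᵒᵖ P] [IsScalarTower A Uᵐᵒᵖ P]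
  [Module.Finite A P] [Module.Projective A P]
  [AddCommGroup Q] [Module A Q] [Module Uᵐᵒᵖ Q] [IsScalarTower A Uᵐᵒᵖ Q]
  [Module.Finite A Q] [Module.Projective A Q]

/-- `(φ ⊗ p) (ψ ⊗ q) = (ψ ⋆ φ) ⊗ (q ⊗ p)`, in the summand of `Q ⊗ P`, where
`(ψ ⋆ φ) (q ⊗ p) = ψ q * φ p`. -/
noncomputable def mulMk (φ : Module.Dual A P) (p : P) : Module.Dual A Q →+ Q →+ FinDual A U :=
  AddMonoidHom.mk' (fun ψ => (mk (Q ⊗[A] P) (dualDistrib A Q P (ψ ⊗ₜ φ))).comp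
      ((TensorProduct.mk A Q P).flip p).toAddMonoidHom)
    (fun ψ ψ' => by rw [add_tmul, map_add, map_add]; rfl)

theorem mulMk_apply (φ : Module.Dual A P) (p : P) (ψ : Module.Dual A Q) (q : Q) :
    (mulMk P Q φ p ψ q : FinDual A U) = mk (Q ⊗[A] P) (dualDistrib A Q P (ψ ⊗ₜ φ)) (q ⊗ₜ[A] p) := rfl

/-- Multiplication by `φ ⊗ p`. -/
noncomputable def mulLeft : Module.Dual A P →+ P →+ FinDual A U →+ FinDual A U :=
  AddMonoidHom.mk' (fun φ => AddMonoidHom.mk' (fun p => lift (fun Q => mulMk P Q φ p)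
      (fun Q Q' t ht ψ q => by
        rw [mulMk_apply, mulMk_apply]
        refine (mk_map (TensorProduct.map t LinearMap.id)
          (ProfMod.map_smul_tensor _ _ ht fun _ _ => rfl) _ (q ⊗ₜ[A] p)).trans ?_
        congr 2
        exact TensorProduct.ext' fun _ _ => rfl))
      (fun p p' => hom_ext fun Q _ _ _ _ _ _ ψ q => by
        simp only [lift_mk, AddMonoidHom.add_apply, mulMk_apply, tmul_add, map_add]))
    (fun φ φ' => AddMonoidHom.ext fun p => hom_ext fun Q _ _ _ _ _ _ ψ q => by
      simp only [AddMonoidHom.mk'_apply, lift_mk, AddMonoidHom.add_apply, mulMk_apply, tmul_add,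
        map_add])

theorem mulLeft_mk (φ : Module.Dual A P) (p : P) (ψ : Module.Dual A Q) (q : Q) :
    (mulLeft P φ p (mk Q ψ q) : FinDual A U) =
      mk (Q ⊗[A] P) (dualDistrib A Q P (ψ ⊗ₜ φ)) (q ⊗ₜ[A] p) := by
  simp only [mulLeft, AddMonoidHom.mk'_apply, lift_mk, mulMk_apply]

end

variable (A U) in
/-- The product of `U°`. -/
noncomputable def mulHom : FinDual A U →+ FinDual A U →+ FinDual A U :=
  lift mulLeft (fun P P' t ht φ p => hom_ext fun Q _ _ _ _ _ _ ψ q => by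
    rw [mulLeft_mk, mulLeft_mk]
    refine (mk_map (TensorProduct.map LinearMap.id t)
      (ProfMod.map_smul_tensor _ _ (fun _ _ => rfl) ht) _ (q ⊗ₜ[A] p)).trans ?_
    congr 2
    exact TensorProduct.ext' fun _ _ => rfl)

section
variable (P Q : Type u) [AddCommGroup P] [Module A P] [Module Uᵐᵒᵖ P] [IsScalarTower A Uᵐᵒᵖ P]
  [Module.Finite A P] [Module.Projective A P]
  [AddCommGroup Q] [Module A Q] [Module Uᵐᵒᵖ Q] [IsScalarTower A Uᵐᵒᵖ Q]
  [Module.Finite A Q] [Module.Projective A Q]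

theorem mulHom_mk (φ : Module.Dual A P) (p : P) (ψ : Module.Dual A Q) (q : Q) :
    mulHom A U (mk P φ p) (mk Q ψ q) =
      mk (Q ⊗[A] P) (dualDistrib A Q P (ψ ⊗ₜ φ)) (q ⊗ₜ[A] p) := by
  rw [mulHom, lift_mk, mulLeft_mk]
end

theorem mulHom_comm (x y : FinDual A U) : mulHom A U x y = mulHom A U y x := by
  induction x using induction with
  | h0 => simp
  | hadd x x' h h' => simp only [map_add, AddMonoidHom.add_apply, h, h']
  | hmk P φ p =>
    induction y using induction with
    | h0 => simp
    | hadd x x' h h' => simp only [map_add, AddMonoidHom.add_apply, h, h']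
    | hmk Q ψ q =>
      rw [mulHom_mk, mulHom_mk]
      refine (mk_map (TensorProduct.comm A P Q).toLinearMap ProfMod.comm_smul _ (p ⊗ₜ[A] q)).trans ?_
      congr 2
      exact TensorProduct.ext' fun _ _ => mul_comm _ _

/-- The unit of `U°`, the class of `id ⊗ 1` for the unit object. -/
noncomputable def one : FinDual A U := mk A LinearMap.id (1 : A)

theorem one_mulHom (x : FinDual A U) : mulHom A U one x = x := by
  induction x using induction with
  | h0 => simp
  | hadd x x' h h' => simp only [map_add, h, h']
  | hmk P φ p =>
    rw [one, mulHom_mk]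
    have h : (TensorProduct.rid A P) (p ⊗ₜ[A] (1 : A)) = p := by simp
    conv_rhs => rw [← h]
    refine Eq.trans ?_ (mk_map (TensorProduct.rid A P).toLinearMap ProfMod.rid_smul
      φ (p ⊗ₜ[A] (1 : A))).symm
    congr 2
    refine TensorProduct.ext' fun p a => ?_
    simp [mul_comm]

theorem mulHom_assoc (x y z : FinDual A U) :
    mulHom A U (mulHom A U x y) z = mulHom A U x (mulHom A U y z) := by
  induction x using induction with
  | h0 => simp
  | hadd x x' h h' => simp only [map_add, AddMonoidHom.add_apply, h, h']
  | hmk P φ p =>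
    induction y using induction with
    | h0 => simp
    | hadd x x' h h' => simp only [map_add, AddMonoidHom.add_apply, h, h']
    | hmk Q ψ q =>
      induction z using induction with
      | h0 => simp
      | hadd x x' h h' => simp only [map_add, h, h']
      | hmk R χ r =>
        rw [mulHom_mk, mulHom_mk, mulHom_mk, mulHom_mk]
        refine (mk_map (TensorProduct.assoc A R Q P).toLinearMap ProfMod.assoc_smul _
          ((r ⊗ₜ[A] q) ⊗ₜ[A] p)).trans ?_
        congr 2
        refine TensorProduct.ext_threefold fun a b c => ?_
        simp [mul_assoc]

noncomputable instance : CommRing (FinDual A U) where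
  __ := (inferInstance : AddCommGroup (FinDual A U))
  mul x y := mulHom A U x y
  one := one
  left_distrib x y z := map_add (mulHom A U x) y z
  right_distrib x y z := by
    change mulHom A U (x + y) z = mulHom A U x z + mulHom A U y z
    rw [map_add]; rfl
  zero_mul x := by
    change mulHom A U 0 x = 0
    rw [map_zero]; rfl
  mul_zero x := map_zero (mulHom A U x)
  mul_assoc := mulHom_assoc
  one_mul := one_mulHom
  mul_one x := (mulHom_comm _ _).trans (one_mulHom x)
  mul_comm := mulHom_comm

section
variable (P Q : Type u) [AddCommGroup P] [Module A P] [Module Uᵐᵒᵖ P] [IsScalarTower A Uᵐᵒᵖ P]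
  [Module.Finite A P] [Module.Projective A P]
  [AddCommGroup Q] [Module A Q] [Module Uᵐᵒᵖ Q] [IsScalarTower A Uᵐᵒᵖ Q]
  [Module.Finite A Q] [Module.Projective A Q]

theorem mk_mul_mk (φ : Module.Dual A P) (p : P) (ψ : Module.Dual A Q) (q : Q) :
    (mk P φ p * mk Q ψ q : FinDual A U) =
      mk (Q ⊗[A] P) (dualDistrib A Q P (ψ ⊗ₜ φ)) (q ⊗ₜ[A] p) := mulHom_mk P Q φ p ψ q

theorem one_def : (1 : FinDual A U) = mk A LinearMap.id (1 : A) := rfl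

theorem mk_mul_unit (φ : Module.Dual A P) (p : P) (a b : A) :
    (mk P φ p * mk A (a • LinearMap.id) b : FinDual A U) = mk P (a • φ) (b • p) := by
  rw [mk_mul_mk]
  have h : (TensorProduct.lid A P) (b ⊗ₜ[A] p) = b • p := by simp
  rw [← h]
  refine Eq.trans ?_ (mk_map (TensorProduct.lid A P).toLinearMap ProfMod.lid_smul _ _).symm
  congr 2
  refine TensorProduct.ext' fun x y => ?_
  simp only [dualDistrib_apply, LinearMap.smul_apply, LinearMap.id_apply, LinearMap.comp_apply,
    LinearEquiv.coe_coe, lid_tmul, map_smul, smul_eq_mul]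
  ring

end

variable (A U)

/-- The source `a ↦ a ⊗ 1`, in the summand of the unit object. -/
noncomputable def s : A →+* FinDual A U where
  toFun a := mk A (a • LinearMap.id) 1
  map_one' := by rw [one_smul, one_def]
  map_zero' := by simp
  map_add' a b := by simp [add_smul]
  map_mul' a b := by rw [mk_mul_unit, smul_smul, mul_comm b, one_smul]

/-- The target `a ↦ 1 ⊗ a`, in the summand of the unit object. -/
noncomputable def t : A →+* FinDual A U where
  toFun a := mk A LinearMap.id a
  map_one' := rfl
  map_zero' := by simp
  map_add' a b := by simp
  map_mul' a b := by
    have := mk_mul_unit (U := U) A LinearMap.id a 1 b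
    rw [one_smul] at this
    rw [this, smul_eq_mul, mul_comm]

theorem s_apply (a : A) : s A U a = mk A (a • LinearMap.id) 1 := rfl
theorem t_apply (a : A) : t A U a = mk A LinearMap.id a := rfl

variable {A U}

section
variable (P : Type u) [AddCommGroup P] [Module A P] [Module Uᵐᵒᵖ P] [IsScalarTower A Uᵐᵒᵖ P]
  [Module.Finite A P] [Module.Projective A P]

theorem s_mul_mk (a : A) (φ : Module.Dual A P) (p : P) :
    s A U a * mk P φ p = mk P (a • φ) p := by
  rw [mul_comm, s_apply, mk_mul_unit, one_smul]

theorem t_mul_mk (a : A) (φ : Module.Dual A P) (p : P) :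
    t A U a * mk P φ p = mk P φ (a • p) := by
  have := mk_mul_unit (U := U) P φ p 1 a
  rw [one_smul, one_smul] at this
  rw [mul_comm, t_apply, this]

end

/-- The counit `φ ⊗ p ↦ φ p`. -/
noncomputable def counitHom : FinDual A U →+ A :=
  lift (fun _ => AddMonoidHom.mk' (fun φ => φ.toAddMonoidHom) (fun _ _ => rfl))
    (fun _ _ _ _ _ _ => rfl)

theorem counitHom_mk (P : Type u) [AddCommGroup P] [Module A P] [Module Uᵐᵒᵖ P]
    [IsScalarTower A Uᵐᵒᵖ P] [Module.Finite A P] [Module.Projective A P] (φ : Module.Dual A P)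
    (p : P) : counitHom (mk P φ p : FinDual A U) = φ p := lift_mk _ _ P φ p

variable (A U) in
/-- The counit as a ring homomorphism. -/
noncomputable def ε : FinDual A U →+* A where
  __ := counitHom
  map_one' := counitHom_mk A _ _
  map_mul' x y := by
    change counitHom (x * y) = counitHom x * counitHom y
    induction x using induction with
    | h0 => simp
    | hadd x x' h h' => simp only [map_add, add_mul, h, h']
    | hmk P φ p =>
      induction y using induction with
      | h0 => simp
      | hadd x x' h h' => simp only [map_add, mul_add, h, h']
      | hmk Q ψ q =>
        rw [mk_mul_mk, counitHom_mk, counitHom_mk, counitHom_mk, dualDistrib_apply, mul_comm]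

theorem ε_mk (P : Type u) [AddCommGroup P] [Module A P] [Module Uᵐᵒᵖ P]
    [IsScalarTower A Uᵐᵒᵖ P] [Module.Finite A P] [Module.Projective A P] (φ : Module.Dual A P)
    (p : P) : ε A U (mk P φ p) = φ p := counitHom_mk P φ p

/-- `U° ⊗ U°`. -/
abbrev HtHs (A : Type u) (U : Type v) [CommRing A] [Ring U] [RightARing A U]
    [CocommRightBialgebroid A U] := Along (t A U) ⊗[A] Along (s A U)

section
variable (P : Type u) [AddCommGroup P] [Module A P] [Module Uᵐᵒᵖ P] [IsScalarTower A Uᵐᵒᵖ P]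
  [Module.Finite A P] [Module.Projective A P]

/-- `(q, ψ) ↦ (φ ⊗ q) ⊗ (ψ ⊗ p)`. -/
noncomputable def pairing (φ : Module.Dual A P) (p : P) : P →+ Module.Dual A P →+ HtHs A U :=
  AddMonoidHom.mk' (fun q => (TensorProduct.mk A _ _ (toAlong (t A U) (mk P φ q))).toAddMonoidHom.comp
      ((toAlong (s A U)).toAddMonoidHom.comp ((mk P).flip p)))
    (fun q q' => AddMonoidHom.ext fun ψ => by simp)

theorem pairing_apply (φ : Module.Dual A P) (p : P) (q : P) (ψ : Module.Dual A P) :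
    (pairing P φ p q ψ : HtHs A U) = toAlong (t A U) (mk P φ q) ⊗ₜ toAlong (s A U) (mk P ψ p) := rfl

theorem pairing_smul (φ : Module.Dual A P) (p : P) (a : A) (q : P) (ψ : Module.Dual A P) :
    (pairing P φ p (a • q) ψ : HtHs A U) = pairing P φ p q (a • ψ) := by
  rw [pairing_apply, pairing_apply, ← t_mul_mk, ← s_mul_mk, ← smul_along, ← smul_along, smul_tmul]

open Classical in
/-- `φ ⊗ p ↦ ∑ (φ ⊗ e i) ⊗ (e' i ⊗ p)` for a dual basis of `P`; by `comulMk_apply` it does not depend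
on the dual basis. -/
noncomputable def comulMk : Module.Dual A P →+ P →+ HtHs A U :=
  let h := exists_dualBasis (A := A) P
  ∑ i, AddMonoidHom.mk' (fun φ => AddMonoidHom.mk'
      (fun p => pairing P φ p (h.choose_spec.choose i) (h.choose_spec.choose_spec.choose i))
      (fun p p' => by simp [pairing_apply, tmul_add]))
    (fun φ φ' => AddMonoidHom.ext fun p => by simp [pairing_apply, add_tmul])

theorem comulMk_apply {ι : Type*} [Fintype ι] {e : ι → P} {e' : ι → Module.Dual A P}
    (he : IsDualBasis e e') (φ : Module.Dual A P) (p : P) :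
    (comulMk P φ p : HtHs A U) =
      ∑ i, toAlong (t A U) (mk P φ (e i)) ⊗ₜ toAlong (s A U) (mk P (e' i) p) := by
  have h := exists_dualBasis (A := A) P
  have := IsDualBasis.sum_eq h.choose_spec.choose_spec.choose_spec he LinearMap.id
    (pairing (U := U) P φ p) (pairing_smul P φ p)
  simp only [LinearMap.id_apply, LinearMap.comp_id, pairing_apply] at this
  rw [← this]
  simp [comulMk, pairing_apply]

end

variable (A U) in
/-- The comultiplication. -/
noncomputable def comulHom : FinDual A U →+ HtHs A U :=
  lift comulMk (fun P Q f hf φ p => by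
    obtain ⟨n, e, e', he⟩ := exists_dualBasis (A := A) P
    obtain ⟨m, d, d', hd⟩ := exists_dualBasis (A := A) Q
    rw [comulMk_apply Q hd, comulMk_apply P he]
    have := IsDualBasis.sum_eq he hd f (X := HtHs A U)
      (AddMonoidHom.mk' (fun q => (TensorProduct.mk A _ _ (toAlong (t A U) (mk Q φ q))).toAddMonoidHom.comp
      ((toAlong (s A U)).toAddMonoidHom.comp ((mk P).flip p)))
        (fun q q' => AddMonoidHom.ext fun ψ => by simp)) (fun a q ψ => by
          change toAlong (t A U) (mk Q φ (a • q)) ⊗ₜ[A] toAlong (s A U) (mk P ψ p) =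
            toAlong (t A U) (mk Q φ q) ⊗ₜ[A] toAlong (s A U) (mk P (a • ψ) p)
          rw [← t_mul_mk, ← s_mul_mk, ← smul_along, ← smul_along, smul_tmul])
    refine (Finset.sum_congr rfl fun j _ => ?_).trans (this.symm.trans
      (Finset.sum_congr rfl fun i _ => ?_))
    · change _ = toAlong (t A U) (mk Q φ (d j)) ⊗ₜ[A] toAlong (s A U) (mk P (d' j ∘ₗ f) p)
      rw [mk_map f hf]
    · change toAlong (t A U) (mk Q φ (f (e i))) ⊗ₜ[A] toAlong (s A U) (mk P (e' i) p) = _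
      rw [mk_map f hf])

theorem comulHom_mk (P : Type u) [AddCommGroup P] [Module A P] [Module Uᵐᵒᵖ P]
    [IsScalarTower A Uᵐᵒᵖ P] [Module.Finite A P] [Module.Projective A P]
    {ι : Type*} [Fintype ι] {e : ι → P} {e' : ι → Module.Dual A P}
    (he : IsDualBasis e e') (φ : Module.Dual A P) (p : P) :
    comulHom A U (mk P φ p) =
      ∑ i, toAlong (t A U) (mk P φ (e i)) ⊗ₜ toAlong (s A U) (mk P (e' i) p) := by
  rw [comulHom, lift_mk, comulMk_apply P he]

end mul
end FinDual


namespace CommBialgebroidData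
variable {A : Type u} {H : Type v} [CommRing A] [CommRing H] (D : CommBialgebroidData A H)

theorem lid_counit {ι : Type*} [Fintype ι] {h : H} {x y : ι → H}
    (hx : D.Δ h = ∑ i, toAlong D.t (x i) ⊗ₜ toAlong D.s (y i)) :
    TensorProduct.lid A (Along D.s) (LinearMap.rTensor (Along D.s) D.εt.toLinearMap (D.Δ h)) =
      toAlong D.s (∑ i, D.s (D.ε (x i)) * y i) := by
  rw [hx, map_sum, map_sum, map_sum]; rfl

theorem rid_counit {ι : Type*} [Fintype ι] {h : H} {x y : ι → H}
    (hx : D.Δ h = ∑ i, toAlong D.t (x i) ⊗ₜ toAlong D.s (y i)) :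
    TensorProduct.rid A (Along D.t) (LinearMap.lTensor (Along D.t) D.εs.toLinearMap (D.Δ h)) =
      toAlong D.t (∑ i, D.t (D.ε (y i)) * x i) := by
  rw [hx, map_sum, map_sum, map_sum]; rfl

theorem coassoc_of_sum {ι : Type*} [Fintype ι] {h : H} {x y : ι → H} (z : ι → ι → H)
    (hh : D.Δ h = ∑ i, toAlong D.t (x i) ⊗ₜ toAlong D.s (y i))
    (hx : ∀ i, D.Δ (x i) = ∑ j, toAlong D.t (x j) ⊗ₜ toAlong D.s (z j i))
    (hy : ∀ i, D.Δ (y i) = ∑ j, toAlong D.t (z i j) ⊗ₜ toAlong D.s (y j)) :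
    LinearMap.lTensor (Along D.t) D.comulAlg.toLinearMap (D.Δ h) =
      D.coactTensor D.Δadd D.Δadd_smul (D.Δ h) := by
  rw [hh, map_sum, map_sum]
  have h1 (i) : LinearMap.lTensor (Along D.t) D.comulAlg.toLinearMap
      (toAlong D.t (x i) ⊗ₜ toAlong D.s (y i)) = ∑ j, toAlong D.t (x i) ⊗ₜ[A] (toAlong _
        (toAlong D.t (z i j) ⊗ₜ[A] toAlong D.s (y j)) : D.HH) := by
    rw [← tmul_sum, ← map_sum, ← hy]; rfl
  have h2 (i) : D.coactTensor D.Δadd D.Δadd_smul (toAlong D.t (x i) ⊗ₜ toAlong D.s (y i)) =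
      ∑ j, toAlong D.t (x j) ⊗ₜ[A] (toAlong _
        (toAlong D.t (z j i) ⊗ₜ[A] toAlong D.s (y i)) : D.HH) := by
    refine (D.coactTensor_tmul _ _ _ _).trans ?_
    change mulR _ _ (LinearMap.lTensor _ _ (D.Δ (x i))) = _
    rw [hx, map_sum, map_sum]
    refine Finset.sum_congr rfl fun j _ => ?_
    change toAlong D.t (x j) ⊗ₜ[A] (toAlong _ ((1 ⊗ₜ[A] toAlong D.s (y i)) *
        (toAlong D.t (z j i) ⊗ₜ[A] 1)) : D.HH) = _
    rw [Algebra.TensorProduct.tmul_mul_tmul, one_mul, mul_one]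
  simp_rw [h1, h2]
  exact Finset.sum_comm

end CommBialgebroidData

theorem IsDualBasis.tensor {A : Type*} [CommRing A] {P Q : Type*} [AddCommGroup P] [Module A P]
    [AddCommGroup Q] [Module A Q] {ι κ : Type*} [Fintype ι] [Fintype κ]
    {e : ι → P} {e' : ι → Module.Dual A P} (h : IsDualBasis e e')
    {f : κ → Q} {f' : κ → Module.Dual A Q} (hf : IsDualBasis f f') :
    IsDualBasis (fun k : κ × ι => f k.1 ⊗ₜ[A] e k.2)
      (fun k => dualDistrib A Q P (f' k.1 ⊗ₜ e' k.2)) := by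
  intro x
  induction x with
  | zero => simp
  | add x y hx hy => simp only [map_add, add_smul, Finset.sum_add_distrib, hx, hy]
  | tmul q p =>
    conv_rhs => rw [← h p, ← hf q]
    simp only [sum_tmul, tmul_sum, smul_tmul_smul, Fintype.sum_prod_type_right, dualDistrib_apply]

namespace FinDual
variable {A : Type u} {U : Type v} [CommRing A] [Ring U] [RightARing A U]
variable [CocommRightBialgebroid A U]
attribute [local instance] ProfMod.tensorModule ProfMod.tensorTower ProfMod.unitModule
  ProfMod.unitTower

theorem isDualBasis_one : IsDualBasis (A := A) (fun _ : Unit => (1 : A)) (fun _ => LinearMap.id) := by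
  intro x; simp

variable (A U) in
/-- The comultiplication as a ring homomorphism. -/
noncomputable def Δ : FinDual A U →+* HtHs A U where
  __ := comulHom A U
  map_one' := by
    change comulHom A U (mk A LinearMap.id 1) = _
    rw [comulHom_mk A isDualBasis_one]
    simp [Algebra.TensorProduct.one_def]
    rfl
  map_mul' x y := by
    change comulHom A U (x * y) = comulHom A U x * comulHom A U y
    induction x using induction with
    | h0 => simp
    | hadd x x' h h' => simp only [map_add, add_mul, h, h']
    | hmk P φ p =>
      induction y using induction with
      | h0 => simp
      | hadd x x' h h' => simp only [map_add, mul_add, h, h']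
      | hmk Q ψ q =>
        obtain ⟨n, e, e', he⟩ := exists_dualBasis (A := A) P
        obtain ⟨m, d, d', hd⟩ := exists_dualBasis (A := A) Q
        rw [mk_mul_mk, comulHom_mk _ (he.tensor hd), comulHom_mk _ he, comulHom_mk _ hd,
          Finset.sum_mul_sum, Fintype.sum_prod_type_right]
        refine Finset.sum_congr rfl fun i _ => Finset.sum_congr rfl fun j _ => ?_
        rw [Algebra.TensorProduct.tmul_mul_tmul, ← map_mul, ← map_mul, mk_mul_mk, mk_mul_mk]

section
variable (P : Type u) [AddCommGroup P] [Module A P] [Module Uᵐᵒᵖ P] [IsScalarTower A Uᵐᵒᵖ P]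
  [Module.Finite A P] [Module.Projective A P]

theorem Δ_mk {ι : Type*} [Fintype ι] {e : ι → P} {e' : ι → Module.Dual A P}
    (he : IsDualBasis e e') (φ : Module.Dual A P) (p : P) : Δ A U (mk P φ p) =
      ∑ i, toAlong (t A U) (mk P φ (e i)) ⊗ₜ toAlong (s A U) (mk P (e' i) p) := comulHom_mk P he φ p

end

variable (A U) in
/-- The structure maps of `U°`. -/
noncomputable def bialgebroidData : CommBialgebroidData A (FinDual A U) where
  s := s A U
  t := t A U
  Δ := Δ A U
  ε := ε A U
  Δ_s a := by
    rw [s_apply, Δ_mk A isDualBasis_one]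
    simp [← one_def]
  Δ_t a := by
    rw [t_apply, Δ_mk A isDualBasis_one]
    simp [← one_def]
  ε_s a := by rw [s_apply, ε_mk]; simp
  ε_t a := by rw [t_apply, ε_mk]; simp

theorem bialgebroidData_Δ (P : Type u) [AddCommGroup P] [Module A P] [Module Uᵐᵒᵖ P]
    [IsScalarTower A Uᵐᵒᵖ P] [Module.Finite A P] [Module.Projective A P] {ι : Type*} [Fintype ι]
    {e : ι → P} {e' : ι → Module.Dual A P} (he : IsDualBasis e e') (φ : Module.Dual A P) (p : P) :
    (bialgebroidData A U).Δ (mk P φ p) = ∑ i, toAlong (bialgebroidData A U).t (mk P φ (e i)) ⊗ₜ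
      toAlong (bialgebroidData A U).s (mk P (e' i) p) := Δ_mk P he φ p

end FinDual

open FinDual in
/-- The finite dual `U°` as a commutative bialgebroid over `A`. -/
noncomputable def finiteDual (A : Type u) (U : Type v) [CommRing A] [Ring U] [RightARing A U]
    [CocommRightBialgebroid A U] : CommBialgebroid A (FinDual A U) where
  toCommBialgebroidData := bialgebroidData A U
  counit_left h := by
    induction h using FinDual.induction with
    | h0 => simp
    | hadd x x' h h' => simp only [map_add, h, h']
    | hmk P φ p =>
      obtain ⟨n, e, e', he⟩ := exists_dualBasis (A := A) P
      refine (CommBialgebroidData.lid_counit _ (bialgebroidData_Δ P he φ p)).trans (congrArg _ ?_)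
      change ∑ i, s A U (ε A U _) * _ = _
      simp only [ε_mk, s_mul_mk]
      conv_rhs => rw [← he.dual φ]
      simp
  counit_right h := by
    induction h using FinDual.induction with
    | h0 => simp
    | hadd x x' h h' => simp only [map_add, h, h']
    | hmk P φ p =>
      obtain ⟨n, e, e', he⟩ := exists_dualBasis (A := A) P
      refine (CommBialgebroidData.rid_counit _ (bialgebroidData_Δ P he φ p)).trans (congrArg _ ?_)
      change ∑ i, t A U (ε A U _) * _ = _
      simp only [ε_mk, t_mul_mk]
      conv_rhs => rw [← he p]
      simp
  coassoc h := by
    induction h using FinDual.induction with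
    | h0 => simp
    | hadd x x' h h' => simp only [map_add, h, h']
    | hmk P φ p =>
      obtain ⟨n, e, e', he⟩ := exists_dualBasis (A := A) P
      exact CommBialgebroidData.coassoc_of_sum _ (fun i j => mk P (e' i) (e j))
        (bialgebroidData_Δ P he φ p) (fun i => bialgebroidData_Δ P he φ (e i))
        (fun i => bialgebroidData_Δ P he (e' i) p)


section hopf
variable (A : Type u) (U : Type v) [CommRing A] [Ring U] [RightARing A U]

/-- `U` as an `A`-module by left multiplication. -/
def LeftMod (_A : Type u) (U : Type v) : Type v := U

instance : AddCommGroup (LeftMod A U) := inferInstanceAs (AddCommGroup U)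

instance : Module A (LeftMod A U) := Module.compHom U (src : A →+* U)

/-- The identity map. -/
def toLeftMod : U ≃+ LeftMod A U := AddEquiv.refl U

variable [CocommRightBialgebroid A U]

theorem comul_src_mul (a : A) (x : U) :
    comul (R := A) (src a * x) = mulBoth A (src a) 1 (comul (R := A) x) := by
  have h : comul (R := A) (src a : U) = ∑ _i : Fin 1, (src a : U) ⊗ₜ[A] (1 : U) := by
    rw [src_eq, map_smul, CocommRightBialgebroid.comul_one, smul_tmul', Finset.sum_const]; simp
  rw [CocommRightBialgebroid.comul_mul (src a) x _ _ h]; simp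

/-- The map `x ⊗ u ↦ x u₁ ⊗ u₂`, defined on the tensor product with `x src a ⊗ u = x ⊗ src a u`. -/
noncomputable def hopfMap : U ⊗[A] LeftMod A U →+ U ⊗[A] U :=
  liftAddHom
    (AddMonoidHom.mk' (fun x => (mulBoth A x 1).toAddMonoidHom.comp
        ((comul (R := A) (A := U)).toAddMonoidHom.comp (toLeftMod A U).symm.toAddMonoidHom))
      (fun x x' => AddMonoidHom.ext fun u => by
        have : LinearMap.mulLeft A (x + x') = LinearMap.mulLeft A x + LinearMap.mulLeft A x' := by
          ext; simp [add_mul]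
        rw [mulBoth, this, TensorProduct.map_add_left]; rfl))
    (fun a x u => by
      change mulBoth A (a • x) 1 (comul (R := A) ((toLeftMod A U).symm u)) =
        mulBoth A x 1 (comul (R := A) (src a * (toLeftMod A U).symm u))
      rw [comul_src_mul, RightARing.smul_eq, mulBoth, mulBoth, mulBoth, TensorProduct.map_map]
      congr 2 <;> ext <;> simp)

/-- `U` is a right Hopf algebroid. -/
def IsRightHopf : Prop := Function.Bijective (hopfMap A U)

end hopf


section LieRinehart
variable (K : Type w) (A : Type u) (L : Type x) [CommRing K] [CommRing A] [LieRing L] [Module A L]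
  [LieRingModule L A] [Algebra K A] [LieAlgebra K L]

/-- The defining relations of the enveloping algebra: those of the universal enveloping algebra of
the Lie algebra `A ⊕ L`, whose bracket is `[(a, X), (b, Y)] = (X(b) - Y(a), [X, Y])`, together with
`(a, 0) · (b, Y) = (a b, a Y)` and `(1, 0) = 1`. -/
inductive EnvRel : TensorAlgebra K (A × L) → TensorAlgebra K (A × L) → Prop
  | one : EnvRel (TensorAlgebra.ι K (1, 0)) 1
  | mul (a b : A) (Y : L) : EnvRel (TensorAlgebra.ι K (a, 0) * TensorAlgebra.ι K (b, Y))
      (TensorAlgebra.ι K (a * b, a • Y))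
  | lie (a b : A) (X Y : L) : EnvRel (TensorAlgebra.ι K (a, X) * TensorAlgebra.ι K (b, Y))
      (TensorAlgebra.ι K (b, Y) * TensorAlgebra.ι K (a, X) +
        TensorAlgebra.ι K (⁅X, b⁆ - ⁅Y, a⁆, ⁅X, Y⁆))

/-- The universal enveloping algebra of a Lie-Rinehart algebra `(A, L)` over `K`. -/
def EnvAlg : Type (max u w x) := RingQuot (EnvRel K A L)

namespace EnvAlg

noncomputable instance : Ring (EnvAlg K A L) := inferInstanceAs (Ring (RingQuot (EnvRel K A L)))

noncomputable instance : Algebra K (EnvAlg K A L) :=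
  inferInstanceAs (Algebra K (RingQuot (EnvRel K A L)))

/-- The canonical map. -/
noncomputable def ι : A × L →ₗ[K] EnvAlg K A L :=
  (RingQuot.mkAlgHom K (EnvRel K A L)).toLinearMap ∘ₗ TensorAlgebra.ι K

theorem ι_one : ι K A L (1, 0) = 1 :=
  (RingQuot.mkAlgHom_rel K (EnvRel.one (L := L))).trans (map_one _)

theorem ι_mul (a b : A) (Y : L) : ι K A L (a, 0) * ι K A L (b, Y) = ι K A L (a * b, a • Y) :=
  (map_mul (RingQuot.mkAlgHom K (EnvRel K A L)) _ _).symm.trans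
    (RingQuot.mkAlgHom_rel K (EnvRel.mul a b Y))

theorem ι_lie (a b : A) (X Y : L) : ι K A L (a, X) * ι K A L (b, Y) =
    ι K A L (b, Y) * ι K A L (a, X) + ι K A L (⁅X, b⁆ - ⁅Y, a⁆, ⁅X, Y⁆) :=
  (map_mul (RingQuot.mkAlgHom K (EnvRel K A L)) _ _).symm.trans
    ((RingQuot.mkAlgHom_rel K (EnvRel.lie a b X Y)).trans (by
    rw [map_add, map_mul]; rfl))

/-- The canonical map on `A`. -/
noncomputable def ιA : A →+* EnvAlg K A L where
  toFun a := ι K A L (a, 0)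
  map_one' := ι_one K A L
  map_zero' := map_zero (ι K A L)
  map_add' a b := by rw [← map_add, Prod.mk_add_mk, add_zero]
  map_mul' a b := by rw [ι_mul, smul_zero]

/-- The canonical map on `L`. -/
noncomputable def ιL : L →+ EnvAlg K A L := (ι K A L).toAddMonoidHom.comp (AddMonoidHom.inr A L)

variable {K A L}

theorem ι_apply (a : A) (X : L) : ι K A L (a, X) = ιA K A L a + ιL K A L X := by
  change _ = ι K A L (a, 0) + ι K A L (0, X)
  rw [← map_add, Prod.mk_add_mk, add_zero, zero_add]

theorem algebraMap_eq (k : K) : algebraMap K (EnvAlg K A L) k = ιA K A L (algebraMap K A k) := by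
  change _ = ι K A L (algebraMap K A k, 0)
  rw [Algebra.algebraMap_eq_smul_one, Algebra.algebraMap_eq_smul_one, ← ι_one, ← map_smul,
    Prod.smul_mk, smul_zero]

theorem ιA_mul_ιL (a : A) (X : L) : ιA K A L a * ιL K A L X = ιL K A L (a • X) := by
  change ι K A L (a, 0) * ι K A L (0, X) = ι K A L (0, a • X)
  rw [ι_mul, mul_zero]

theorem ιL_mul_ιA (X : L) (a : A) : ιL K A L X * ιA K A L a =
    ιA K A L a * ιL K A L X + ιA K A L ⁅X, a⁆ := by
  refine (ι_lie K A L 0 a X 0).trans ?_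
  rw [lie_zero, lie_zero, sub_zero]
  rfl

theorem ιL_lie (X Y : L) : ιL K A L ⁅X, Y⁆ =
    ιL K A L X * ιL K A L Y - ιL K A L Y * ιL K A L X := by
  refine eq_sub_of_add_eq ?_
  rw [add_comm]
  refine ((ι_lie K A L 0 0 X Y).trans ?_).symm
  rw [lie_zero, lie_zero, sub_zero]
  rfl

@[elab_as_elim]
theorem induction {p : EnvAlg K A L → Prop} (hA : ∀ a, p (ιA K A L a)) (hL : ∀ X, p (ιL K A L X))
    (hadd : ∀ x y, p x → p y → p (x + y)) (hmul : ∀ x y, p x → p y → p (x * y))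
    (x : EnvAlg K A L) : p x := by
  obtain ⟨x, rfl⟩ := RingQuot.mkAlgHom_surjective K (EnvRel K A L) x
  induction x using TensorAlgebra.induction with
  | algebraMap k => rw [AlgHom.commutes]; exact (algebraMap_eq (A := A) (L := L) k) ▸ hA _
  | ι y => exact (ι_apply (K := K) y.1 y.2) ▸ hadd _ _ (hA _) (hL _)
  | mul x y hx hy => rw [map_mul]; exact hmul _ _ hx hy
  | add x y hx hy => rw [map_add]; exact hadd _ _ hx hy

/-- `A` acts by left multiplication, `a • x = ιA a * x`. -/
noncomputable instance : Module A (EnvAlg K A L) := Module.compHom _ (ιA K A L)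

theorem smul_def (a : A) (x : EnvAlg K A L) : a • x = ιA K A L a * x := rfl

instance : IsScalarTower A (EnvAlg K A L) (EnvAlg K A L) := ⟨fun a x y => mul_assoc (ιA K A L a) x y⟩

instance : IsScalarTower K A (EnvAlg K A L) := ⟨fun k a x => by
  rw [Algebra.smul_def, Algebra.smul_def, smul_def, smul_def, map_mul, algebraMap_eq, mul_assoc]⟩

end EnvAlg

/-- A representation of `L` on the `A`-module `M`, that is, a flat `L`-connection. -/
structure Conn (A : Type u) (L : Type x) [CommRing A] [LieRing L] [Module A L]
    [LieRingModule L A] (M : Type*) [AddCommGroup M] [Module A M] where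
  nabla : L →+ M →+ M
  smul : ∀ (a : A) (X : L) m, nabla (a • X) m = a • nabla X m
  leibniz : ∀ (X : L) (a : A) m, nabla X (a • m) = a • nabla X m + ⁅X, a⁆ • m
  flat : ∀ (X Y : L) m, nabla ⁅X, Y⁆ m = nabla X (nabla Y m) - nabla Y (nabla X m)

namespace Conn
variable {K A L}
variable [LieRinehartRing A L] [LieRinehartAlgebra K A L]
variable {M : Type*} [AddCommGroup M] [Module A M] [Module K M] [IsScalarTower K A M]

theorem lie_algebraMap (X : L) (k : K) : ⁅X, algebraMap K A k⁆ = 0 := by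
  have h : ⁅X, (1 : A)⁆ = 0 := by
    have := LieRinehartRing.leibniz_mul_right X (1 : A) 1
    simpa using this
  rw [Algebra.algebraMap_eq_smul_one, LieModule.lie_smul k X (1 : A), h, smul_zero]

variable (K) in
/-- The action of `A ⊕ L`. -/
noncomputable def act (c : Conn A L M) : A × L →ₗ[K] Module.End K M where
  toFun z :=
    { toFun m := z.1 • m + c.nabla z.2 m
      map_add' m m' := by rw [smul_add, map_add]; abel
      map_smul' k m := by
        rw [← algebraMap_smul A k m, c.leibniz, lie_algebraMap, zero_smul, add_zero,
          smul_comm, ← smul_add, algebraMap_smul]; rfl }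
  map_add' z z' := by
    ext m
    simp only [Prod.fst_add, Prod.snd_add, add_smul, map_add, AddMonoidHom.add_apply,
      LinearMap.add_apply, LinearMap.coe_mk, AddHom.coe_mk]
    abel
  map_smul' k z := by
    ext m
    simp only [Prod.smul_fst, Prod.smul_snd, RingHom.id_apply, LinearMap.smul_apply,
      LinearMap.coe_mk, AddHom.coe_mk, smul_add, smul_assoc]
    rw [← algebraMap_smul A k z.2, c.smul, algebraMap_smul]

theorem act_apply (c : Conn A L M) (a : A) (X : L) (m : M) :
    c.act K (a, X) m = a • m + c.nabla X m := rfl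

variable (K) in
/-- The action of the enveloping algebra. -/
noncomputable def toHom (c : Conn A L M) : EnvAlg K A L →ₐ[K] Module.End K M :=
  RingQuot.liftAlgHom K ⟨TensorAlgebra.lift K (c.act K), by
    rintro _ _ (_ | ⟨a, b, Y⟩ | ⟨a, b, X, Y⟩)
    · ext m
      simp [act_apply]
    · ext m
      simp [act_apply, c.smul, mul_smul]
    · ext m
      simp only [map_mul, map_add, TensorAlgebra.lift_ι_apply, Module.End.mul_apply, act_apply,
        LinearMap.add_apply, c.leibniz, c.flat, map_add, sub_smul, smul_comm a b]
      abel⟩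

variable (K) in
/-- A representation of `L` is a left module over the enveloping algebra. -/
@[reducible] noncomputable def module (c : Conn A L M) : Module (EnvAlg K A L) M :=
  Module.compHom M (c.toHom K).toRingHom

theorem toHom_ι (c : Conn A L M) (z : A × L) : c.toHom K (EnvAlg.ι K A L z) = c.act K z := by
  refine (RingQuot.liftAlgHom_mkAlgHom_apply K _ _ _).trans ?_
  exact TensorAlgebra.lift_ι_apply _ _

end Conn

namespace EnvAlg
variable {K A L}

section
variable {M N : Type*} [AddCommGroup M] [Module A M] [Module (EnvAlg K A L) M]
  [IsScalarTower A (EnvAlg K A L) M] [AddCommGroup N] [Module A N] [Module (EnvAlg K A L) N]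
  [IsScalarTower A (EnvAlg K A L) N]

theorem ιA_smul (a : A) (m : M) : ιA K A L a • m = a • m := by
  rw [← mul_one (ιA K A L a), ← smul_def, smul_assoc, one_smul]

theorem ιL_smul_smul (X : L) (a : A) (m : M) :
    ιL K A L X • a • m = a • ιL K A L X • m + ⁅X, a⁆ • m := by
  rw [← ιA_smul (K := K) (L := L) a m, smul_smul, ιL_mul_ιA, add_smul, mul_smul, ιA_smul, ιA_smul]

theorem smul_ιL_smul (X : L) (a : A) (m : M) :
    ιL K A L (a • X) • m = a • ιL K A L X • m := by
  rw [← ιA_mul_ιL, mul_smul, ιA_smul]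

theorem map_smul_of (f : M →ₗ[A] N) (hf : ∀ (X : L) m, f (ιL K A L X • m) = ιL K A L X • f m)
    (x : EnvAlg K A L) (m : M) : f (x • m) = x • f m := by
  induction x using EnvAlg.induction generalizing m with
  | hA a => rw [ιA_smul, ιA_smul, map_smul]
  | hL X => exact hf X m
  | hadd x y hx hy => rw [add_smul, add_smul, map_add, hx, hy]
  | hmul x y hx hy => rw [mul_smul, mul_smul, hx, hy]

/-- The map `x ↦ x m`. -/
noncomputable def orbit (m : M) : EnvAlg K A L →ₗ[A] M where
  toFun x := x • m
  map_add' x y := add_smul x y m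
  map_smul' a x := smul_assoc a x m

theorem orbit_apply (m : M) (x : EnvAlg K A L) : orbit m x = x • m := rfl

/-- `X (m ⊗ n) = X m ⊗ n + m ⊗ X n`. -/
noncomputable def tensorNabla (X : L) : M ⊗[A] N →+ M ⊗[A] N :=
  liftAddHom
    (AddMonoidHom.mk' (fun m => AddMonoidHom.mk'
      (fun n => (ιL K A L X • m) ⊗ₜ n + m ⊗ₜ (ιL K A L X • n))
      (fun n n' => by simp only [tmul_add, smul_add]; abel))
      (fun m m' => by ext n; simp only [add_tmul, smul_add, AddMonoidHom.mk'_apply, AddMonoidHom.add_apply]; abel))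
    (fun a m n => by
      simp only [AddMonoidHom.mk'_apply, ιL_smul_smul, add_tmul, tmul_add, smul_tmul]
      abel)

theorem tensorNabla_tmul (X : L) (m : M) (n : N) : tensorNabla (K := K) X (m ⊗ₜ[A] n) =
    (ιL K A L X • m) ⊗ₜ n + m ⊗ₜ (ιL K A L X • n) := rfl

variable (K L M N) in
/-- The tensor product of two representations. -/
noncomputable def tensorConn : Conn A L (M ⊗[A] N) where
  nabla := AddMonoidHom.mk' (fun X => tensorNabla (K := K) X) (fun X Y => by
    ext z
    induction z with
    | zero => simp
    | add x y hx hy => rw [map_add, map_add, hx, hy]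
    | tmul m n =>
      simp only [AddMonoidHom.add_apply, tensorNabla_tmul, map_add, add_smul, add_tmul, tmul_add]
      abel)
  smul a X z := by
    change tensorNabla (a • X) z = a • tensorNabla X z
    induction z with
    | zero => simp
    | add x y hx hy => rw [map_add, map_add, hx, hy, smul_add]
    | tmul m n =>
      simp only [tensorNabla_tmul, smul_ιL_smul, smul_add, smul_tmul', smul_tmul]
  leibniz X a z := by
    change tensorNabla X (a • z) = a • tensorNabla X z + _
    induction z with
    | zero => simp
    | add x y hx hy => simp only [smul_add, map_add, hx, hy]; abel
    | tmul m n =>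
      simp only [smul_tmul', tensorNabla_tmul, ιL_smul_smul, smul_add, add_tmul]
      abel
  flat X Y z := by
    change tensorNabla ⁅X, Y⁆ z = tensorNabla X (tensorNabla Y z) - tensorNabla Y (tensorNabla X z)
    induction z with
    | zero => simp
    | add x y hx hy => simp only [map_add, hx, hy]; abel
    | tmul m n =>
      simp only [tensorNabla_tmul, map_add, ιL_lie, sub_smul, mul_smul, sub_tmul, tmul_sub]
      abel

variable (L) in
/-- The representation of `L` on `A` through the anchor. -/
noncomputable def baseConn [LieRinehartRing A L] : Conn A L A where
  nabla := AddMonoidHom.mk' (fun X => AddMonoidHom.mk' (fun a : A => ⁅X, a⁆) (lie_add X))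
    (fun X Y => AddMonoidHom.ext fun a => add_lie X Y a)
  smul a X b := LieRinehartRing.lie_smul_eq_mul a b X
  leibniz X a b := by
    change ⁅X, a * b⁆ = _
    rw [LieRinehartRing.leibniz_mul_right]; rfl
  flat X Y a := lie_lie X Y a
end
end EnvAlg
end LieRinehart


section LieRinehart
variable {K : Type w} {A : Type u} {L : Type x} [CommRing K] [CommRing A] [LieRing L] [Module A L]
  [LieRingModule L A] [Algebra K A] [LieAlgebra K L] [LieRinehartRing A L] [LieRinehartAlgebra K A L]

namespace Conn
variable {M : Type*} [AddCommGroup M] [Module A M] [Module K M] [IsScalarTower K A M]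

theorem ιL_smul (c : Conn A L M) (X : L) (m : M) :
    letI := c.module K
    EnvAlg.ιL K A L X • m = c.nabla X m := by
  change c.toHom K (EnvAlg.ι K A L (0, X)) m = _
  rw [toHom_ι, act_apply, zero_smul, zero_add]

theorem tower (c : Conn A L M) :
    letI := c.module K
    IsScalarTower A (EnvAlg K A L) M :=
  letI := c.module K
  ⟨fun a x m => by
    change c.toHom K (EnvAlg.ι K A L (a, 0) * x) m = a • c.toHom K x m
    rw [map_mul, toHom_ι, Module.End.mul_apply, act_apply, map_zero, AddMonoidHom.zero_apply,
      add_zero]⟩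

end Conn

namespace EnvAlg

section tensor
variable (M N R : Type*) [AddCommGroup M] [Module A M] [Module K M] [IsScalarTower K A M]
  [Module (EnvAlg K A L) M] [IsScalarTower A (EnvAlg K A L) M]
  [AddCommGroup N] [Module A N] [Module (EnvAlg K A L) N] [IsScalarTower A (EnvAlg K A L) N]

/-- The tensor product of two left modules. -/
@[reducible] noncomputable def tensorModule : Module (EnvAlg K A L) (M ⊗[A] N) :=
  (tensorConn K L M N).module K

attribute [local instance] tensorModule

theorem tensorTower : IsScalarTower A (EnvAlg K A L) (M ⊗[A] N) := (tensorConn K L M N).tower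

/-- `A` as a left module. -/
@[reducible] noncomputable def baseModule : Module (EnvAlg K A L) A := (baseConn L).module K

attribute [local instance] tensorTower baseModule

theorem baseTower : IsScalarTower A (EnvAlg K A L) A := (baseConn L).tower

attribute [local instance] baseTower

variable {M N}

theorem ιL_smul_tmul (X : L) (m : M) (n : N) : ιL K A L X • (m ⊗ₜ[A] n) =
    (ιL K A L X • m) ⊗ₜ n + m ⊗ₜ (ιL K A L X • n) := (tensorConn K L M N).ιL_smul X _

theorem ιL_smul_base (X : L) (a : A) : ιL K A L X • a = ⁅X, a⁆ := (baseConn L).ιL_smul X a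

variable (K A L) in
/-- `Δ x = x • (1 ⊗ 1)` and `ε x = x • 1`. On generators: `ιL X ↦ ιL X ⊗ 1 + 1 ⊗ ιL X`,
`ιA a ↦ ιA a ⊗ 1`, `ε (ιL X) = 0` and `ε (ιA a) = a`. -/
noncomputable instance : CoalgebraStruct A (EnvAlg K A L) where
  comul := orbit ((1 : EnvAlg K A L) ⊗ₜ[A] (1 : EnvAlg K A L))
  counit := orbit (1 : A)

theorem comul_apply (x : EnvAlg K A L) : comul (R := A) x =
    x • ((1 : EnvAlg K A L) ⊗ₜ[A] (1 : EnvAlg K A L)) := rfl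

theorem counit_apply (x : EnvAlg K A L) : counit (R := A) x = x • (1 : A) := rfl

theorem tensor_map_smul {M' N' : Type*} [AddCommGroup M'] [Module A M'] [Module K M']
    [IsScalarTower K A M'] [Module (EnvAlg K A L) M'] [IsScalarTower A (EnvAlg K A L) M']
    [AddCommGroup N'] [Module A N'] [Module (EnvAlg K A L) N'] [IsScalarTower A (EnvAlg K A L) N']
    (f : M →ₗ[A] M') (g : N →ₗ[A] N') (hf : ∀ (x : EnvAlg K A L) m, f (x • m) = x • f m)
    (hg : ∀ (x : EnvAlg K A L) n, g (x • n) = x • g n) (x : EnvAlg K A L) (z : M ⊗[A] N) :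
    TensorProduct.map f g (x • z) = x • TensorProduct.map f g z := by
  refine map_smul_of _ (fun X z => ?_) x z
  induction z with
  | zero => simp
  | add z z' h h' => simp only [smul_add, map_add, h, h']
  | tmul m n => simp only [ιL_smul_tmul, map_add, map_tmul, hf, hg]

theorem comul_ιL (X : L) : comul (R := A) (ιL K A L X) =
    ιL K A L X ⊗ₜ 1 + 1 ⊗ₜ ιL K A L X := by
  rw [comul_apply, ιL_smul_tmul, smul_eq_mul, mul_one]

theorem comul_ιA (a : A) : comul (R := A) (ιA K A L a) = ιA K A L a ⊗ₜ 1 := by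
  rw [comul_apply, ιA_smul, smul_tmul', smul_def, mul_one]

theorem counit_ιL (X : L) : counit (R := A) (ιL K A L X) = 0 := by
  rw [counit_apply, ιL_smul_base]
  simpa using LieRinehartRing.leibniz_mul_right X (1 : A) 1

theorem counit_ιA (a : A) : counit (R := A) (ιA K A L a) = a := by
  rw [counit_apply, ιA_smul, smul_eq_mul, mul_one]

/-- `x (m ⊗ n) = x₁ m ⊗ x₂ n`. -/
theorem smul_tmul_eq (x : EnvAlg K A L) (m : M) (n : N) : x • (m ⊗ₜ[A] n) =
    TensorProduct.map (orbit m) (orbit n) (comul (R := A) x) := by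
  rw [comul_apply, tensor_map_smul (orbit m) (orbit n) (fun x y => mul_smul x y m)
    (fun x y => mul_smul x y n), map_tmul, orbit_apply, orbit_apply, one_smul, one_smul]

theorem assoc_smul [AddCommGroup R] [Module A R] [Module (EnvAlg K A L) R]
    [IsScalarTower A (EnvAlg K A L) R] [Module K N] [IsScalarTower K A N] (x : EnvAlg K A L)
    (z : (M ⊗[A] N) ⊗[A] R) : TensorProduct.assoc A M N R (x • z) =
      x • TensorProduct.assoc A M N R z := by
  refine map_smul_of (TensorProduct.assoc A M N R).toLinearMap (fun X z => ?_) x z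
  induction z with
  | zero => simp
  | add z z' h h' => simp only [smul_add, map_add, h, h']
  | tmul z n =>
    induction z with
    | zero => simp
    | add z z' h h' => simp only [add_tmul, smul_add, map_add, h, h']
    | tmul l m =>
      simp only [LinearEquiv.coe_coe, assoc_tmul, ιL_smul_tmul, add_tmul, tmul_add, map_add]
      abel

theorem comm_smul [Module K N] [IsScalarTower K A N] (x : EnvAlg K A L) (z : M ⊗[A] N) :
    TensorProduct.comm A M N (x • z) = x • TensorProduct.comm A M N z := by
  refine map_smul_of (TensorProduct.comm A M N).toLinearMap (fun X z => ?_) x z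
  induction z with
  | zero => simp
  | add z z' h h' => simp only [smul_add, map_add, h, h']
  | tmul m n =>
    simp only [LinearEquiv.coe_coe, comm_tmul, ιL_smul_tmul, map_add]
    abel

theorem lid_smul (x : EnvAlg K A L) (z : A ⊗[A] M) :
    TensorProduct.lid A M (x • z) = x • TensorProduct.lid A M z := by
  refine map_smul_of (TensorProduct.lid A M).toLinearMap (fun X z => ?_) x z
  induction z with
  | zero => simp
  | add z z' h h' => simp only [smul_add, map_add, h, h']
  | tmul m n =>
    simp only [LinearEquiv.coe_coe, lid_tmul, ιL_smul_tmul, map_add, ιL_smul_base, ιL_smul_smul]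
    abel

variable (K A L) in
noncomputable instance : Coalgebra A (EnvAlg K A L) where
  coassoc := LinearMap.ext fun x => by
    change TensorProduct.assoc A _ _ _ (TensorProduct.map
        (orbit ((1 : EnvAlg K A L) ⊗ₜ[A] (1 : EnvAlg K A L))) LinearMap.id (comul x)) =
      TensorProduct.map LinearMap.id (orbit ((1 : EnvAlg K A L) ⊗ₜ[A] (1 : EnvAlg K A L))) (comul x)
    have h : (LinearMap.id : EnvAlg K A L →ₗ[A] EnvAlg K A L) = orbit 1 := by
      ext x; simp [orbit_apply]
    rw [h, ← smul_tmul_eq, ← smul_tmul_eq, assoc_smul, assoc_tmul]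
  rTensor_counit_comp_comul := LinearMap.ext fun x => by
    change TensorProduct.map (orbit (1 : A)) LinearMap.id (comul x) = (1 : A) ⊗ₜ x
    have h : (LinearMap.id : EnvAlg K A L →ₗ[A] EnvAlg K A L) = orbit 1 := by
      ext x; simp [orbit_apply]
    apply (TensorProduct.lid A _).injective
    rw [h, ← smul_tmul_eq, lid_smul]
    simp
  lTensor_counit_comp_comul := LinearMap.ext fun x => by
    change TensorProduct.map LinearMap.id (orbit (1 : A)) (comul x) = x ⊗ₜ (1 : A)
    have h : (LinearMap.id : EnvAlg K A L →ₗ[A] EnvAlg K A L) = orbit 1 := by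
      ext x; simp [orbit_apply]
    apply (TensorProduct.comm A _ _).injective
    apply (TensorProduct.lid A _).injective
    rw [h, ← smul_tmul_eq, comm_smul, comm_tmul, lid_smul]
    simp

end tensor

end EnvAlg

variable (K A L) in
/-- The opposite of the enveloping algebra. Its right modules are the left modules over the
enveloping algebra, that is, the representations of `L`. -/
abbrev EnvOp : Type (max u w x) := (EnvAlg K A L)ᵐᵒᵖ

variable (K A L) in
/-- The source map is `ιA`. -/
noncomputable instance : RightARing A (EnvOp K A L) where
  src :=
    { toFun a := op (EnvAlg.ιA K A L a)
      map_one' := by simp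
      map_zero' := by simp
      map_add' a b := by simp
      map_mul' a b := by rw [mul_comm a, map_mul, op_mul] }
  smul_eq a x := rfl

theorem EnvOp.src_eq (a : A) : (src a : EnvOp K A L) = op (EnvAlg.ιA K A L a) := rfl

section
attribute [local instance] EnvAlg.tensorModule EnvAlg.tensorTower EnvAlg.baseModule
  EnvAlg.baseTower


/-- `x ⊗ y ↦ op x ⊗ op y`. -/
noncomputable abbrev opMap : EnvAlg K A L ⊗[A] EnvAlg K A L →ₗ[A] EnvOp K A L ⊗[A] EnvOp K A L :=
  TensorProduct.map (opLinearEquiv A).toLinearMap (opLinearEquiv A).toLinearMap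

theorem EnvOp.comul_op (x : EnvAlg K A L) : comul (R := A) (op x) = opMap (comul (R := A) x) := rfl

theorem EnvOp.mulBoth_comul (x y z : EnvAlg K A L) :
    mulBoth A (op y) (op z) (comul (R := A) (op x)) = opMap (x • (y ⊗ₜ[A] z)) := by
  rw [EnvAlg.smul_tmul_eq, comul_op, mulBoth, TensorProduct.map_map, TensorProduct.map_map]
  rfl

variable (K A L) in
noncomputable instance : CocommRightBialgebroid A (EnvOp K A L) where
  comm_comp_comul := LinearMap.ext fun x => by
    change TensorProduct.comm A _ _ (opMap (comul x.unop)) = opMap (comul x.unop)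
    rw [← TensorProduct.map_comm, EnvAlg.comul_apply, EnvAlg.comm_smul, comm_tmul]
  comul_one := by
    rw [← op_one, EnvOp.comul_op, EnvAlg.comul_apply, one_smul, map_tmul]; rfl
  src_comul a x := by
    have h : (1 : EnvOp K A L) = op 1 := rfl
    rw [EnvOp.src_eq, h, ← op_unop x, EnvOp.mulBoth_comul, EnvOp.mulBoth_comul]
    have : EnvAlg.ιA K A L a = a • 1 := (mul_one _).symm
    rw [this, smul_tmul]
  comul_mul x y n l r h := by
    have h' : comul (R := A) x.unop = ∑ i, (l i).unop ⊗ₜ[A] (r i).unop := by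
      have := congrArg (TensorProduct.map (opLinearEquiv A).symm.toLinearMap
        (opLinearEquiv A).symm.toLinearMap) h
      rw [← op_unop x, EnvOp.comul_op, TensorProduct.map_map] at this
      simpa using this
    rw [← op_unop x, ← op_unop y, ← op_mul, EnvOp.comul_op, EnvAlg.comul_apply, mul_smul,
      ← EnvAlg.comul_apply, h', Finset.smul_sum, map_sum]
    exact Finset.sum_congr rfl fun i _ => (EnvOp.mulBoth_comul _ _ _).symm
  counit_one := one_smul (EnvAlg K A L) (1 : A)
  counit_mul x y := by
    change (y.unop * x.unop) • (1 : A) =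
      (y.unop * EnvAlg.ιA K A L (x.unop • (1 : A))) • (1 : A)
    rw [mul_smul, mul_smul, EnvAlg.ιA_smul, smul_eq_mul, mul_one]

end
end LieRinehart

section main
variable {A : Type u} {U : Type v} [CommRing A] [Ring U] [RightARing A U]
  [CocommRightBialgebroid A U]

/-- The braided functor `F`, from the `A`-profinite right `U`-modules to the `A`-profinite right
comodules over `U°`, is an isomorphism of symmetric monoidal categories: it is an isomorphism of
categories, it commutes with the forgetful functors to `A`-modules, and it is strict monoidal. -/
structure IsSymmMonoidalIso (F : ProfMod A U ⥤ ProfComod (finiteDual A U)) [F.Braided] : Prop where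
  isIso : F.IsIso
  comp_forget : F ⋙ ProfComod.forget (finiteDual A U) = ProfMod.forget A U
  strict_tensor : ∀ P Q : ProfMod A U, ∃ h : F.obj P ⊗ F.obj Q = F.obj (P ⊗ Q),
    Functor.LaxMonoidal.μ F P Q = eqToHom h
  strict_unit : ∃ h : 𝟙_ (ProfComod (finiteDual A U)) = F.obj (𝟙_ (ProfMod A U)),
    Functor.LaxMonoidal.ε F = eqToHom h

end main

end FiniteDual

/-!
Let `U` be a cocommutative right Hopf algebroid over `A`. Bijectivity of the Hopf map
`x ⊗ y ↦ x y₁ ⊗ y₂` makes `U` act on the `A`-linear maps `f : M → T` between two right `U`-modules: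
if `y₋ ⊗ y₊` is the inverse image of `1 ⊗ y`, then `(f y) m = f (m y₋) y₊`. The inverse image enters
only through the map `ProfMod.homAct f m : U ⊗ U → T`, which is characterized by
`x y₁ ⊗ y₂ ↦ f (m x) y`, so that identities are checked on the tensors `x y₁ ⊗ y₂`. Evaluation
`P ⊗ P* → A` and coevaluation `A → P* ⊗ P` are `U`-linear, so the profinite right `U`-modules form a
rigid category (`ProfMod.nonempty_rigid`), and `φ ⊗ p ↦ ev_p ⊗ φ` defines an antipode of the finite
dual `U°` (`finiteDualAntipode`). Its two axioms are the relations of `U°` for the morphisms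
coevaluation and evaluation.

Without the Hopf condition on `U`, the coaction `p ↦ ∑ e i ⊗ (e' i ⊗ p)`, for a dual basis of `P`,
defines a functor `FinDual.toComod` to comodules over `U°`. It keeps the underlying modules, so it is strictly
symmetric monoidal. It has the left inverse `FinDual.ofComod` on objects, where `x` acts on a comodule
by `m ↦ ζ(m₁)(x) m₀`; hence it is fully faithful and injective on objects. If `ζ` is injective, a
coaction is determined by this action, so the functor is an isomorphism of categories
(`FinDual.toComod_isSymmMonoidalIso`), and rigidity carries over to comodules.

If `A` is a Dedekind domain, `ζ` is injective (`FinDual.zeta_injective`): each element of `U°` is the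
class of a single tensor `φ ⊗ p`, the submodule `p U` of `P` is again profinite, and if
`φ (p x) = 0` for all `x`, then `φ ⊗ p` is the image of `φ|_{p U} ⊗ p = 0`.

For a Lie-Rinehart algebra `L` with enveloping algebra `V`, the Hopf map of `V^op` is
`x ⊗ y ↦ y (x ⊗ 1)`, with `V` acting on the target by the tensor product of representations. Both
sides are representations of `L`, and so are the `A`-linear maps from `V` to either of them. The
inverse sends `x ⊗ y` to `(y f) x`, where `f x = x ⊗ 1` (`EnvAlg.hopfInv`). That the two maps are
inverse to each other holds because linear maps compatible with the action of `L` are `V`-linear, and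
hence determined by their values on generators.
-/

namespace FiniteDual

open RightARing (src)
open Coalgebra (comul counit)

/-! ### Internal homs over a right Hopf algebroid -/

section HopfMap
variable {A : Type u} {U : Type v} [CommRing A] [Ring U] [RightARing A U]
  [CocommRightBialgebroid A U]

theorem hopfMap_tmul (x y : U) :
    hopfMap A U (x ⊗ₜ toLeftMod A U y) = mulBoth A x 1 (comul (R := A) y) := rfl

theorem mulBoth_mulBoth (x y x' y' : U) (z : U ⊗[A] U) :
    mulBoth A x y (mulBoth A x' y' z) = mulBoth A (x * x') (y * y') z := by
  rw [mulBoth, mulBoth, mulBoth, TensorProduct.map_map, ← LinearMap.mulLeft_mul,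
    ← LinearMap.mulLeft_mul]

/-- The map `l ⊗ r ↦ l y₁ ⊗ r y₂`, that is, right multiplication by `Δ y`. -/
noncomputable def mulComul (y : U) : U ⊗[A] U →+ U ⊗[A] U :=
  liftAddHom
    (AddMonoidHom.mk' (fun l => AddMonoidHom.mk' (fun r => mulBoth A l r (comul (R := A) y))
      (fun r r' => by
        have : LinearMap.mulLeft A (r + r') = LinearMap.mulLeft A r + LinearMap.mulLeft A r' := by
          ext; simp [add_mul]
        rw [mulBoth, this, TensorProduct.map_add_right]; rfl))
      (fun l l' => by
        ext r
        have : LinearMap.mulLeft A (l + l') = LinearMap.mulLeft A l + LinearMap.mulLeft A l' := by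
          ext; simp [add_mul]
        simp [mulBoth, this, TensorProduct.map_add_left]))
    (fun a l r => by
      have := congrArg (mulBoth A l r) (CocommRightBialgebroid.src_comul a y)
      rw [mulBoth_mulBoth, mulBoth_mulBoth, mul_one, mul_one] at this
      simpa [RightARing.smul_eq] using this)

theorem mulComul_tmul (y l r : U) :
    mulComul y (l ⊗ₜ[A] r) = mulBoth A l r (comul (R := A) y) := rfl

theorem mulComul_comul (x y : U) :
    mulComul y (comul (R := A) x) = comul (R := A) (x * y) := by
  obtain ⟨n, l, r, h⟩ := TensorProduct.exists_sum_tmul_eq (comul (R := A) x)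
  rw [CocommRightBialgebroid.comul_mul x y l r h, h, map_sum]
  rfl

theorem mulComul_mulBoth (y l r : U) (z : U ⊗[A] U) :
    mulComul y (mulBoth A l r z) = mulBoth A l r (mulComul y z) := by
  induction z with
  | zero => simp
  | add z z' h h' => simp only [map_add, h, h']
  | tmul x x' =>
    rw [mulComul_tmul, mulBoth_mulBoth]
    rfl

/-- The tensors `x y₁ ⊗ y₂` span `U ⊗ U`, by surjectivity of the Hopf map. -/
theorem IsRightHopf.induction (hU : IsRightHopf A U) {p : U ⊗[A] U → Prop}
    (hmul : ∀ x y : U, p (mulBoth A x 1 (comul (R := A) y)))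
    (hadd : ∀ z z', p z → p z' → p (z + z')) (z : U ⊗[A] U) : p z := by
  obtain ⟨w, rfl⟩ := hU.2 z
  induction w with
  | zero => simpa using hmul 0 0
  | add z z' h h' => rw [map_add]; exact hadd _ _ h h'
  | tmul x y => exact hmul x y

end HopfMap

namespace ProfMod

section Hom
variable {A : Type u} {U : Type v} [CommRing A] [Ring U] [RightARing A U]
  [CocommRightBialgebroid A U]
variable {M N T : Type*} [AddCommGroup M] [Module A M] [Module Uᵐᵒᵖ M] [IsScalarTower A Uᵐᵒᵖ M]
  [AddCommGroup T] [Module A T] [Module Uᵐᵒᵖ T] [IsScalarTower A Uᵐᵒᵖ T]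
  [AddCommGroup N] [Module A N] [Module Uᵐᵒᵖ N] [IsScalarTower A Uᵐᵒᵖ N]

/-- The map `x ⊗ y ↦ f (m x) y`. -/
noncomputable def preHomAct (f : M →ₗ[A] T) (m : M) : U ⊗[A] LeftMod A U →+ T :=
  liftAddHom
    (AddMonoidHom.mk' (fun x => AddMonoidHom.mk'
      (fun y => op ((toLeftMod A U).symm y) • f (op x • m))
      (fun y y' => by rw [map_add, MulOpposite.op_add, add_smul]))
      (fun x x' => by ext y; simp [add_smul]))
    (fun a x y => by
      change op ((toLeftMod A U).symm y) • f ((a • op x) • m) =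
        op (src a * (toLeftMod A U).symm y) • f (op x • m)
      rw [op_mul, mul_smul, src_smul, smul_assoc, map_smul])

theorem preHomAct_tmul (f : M →ₗ[A] T) (m : M) (x y : U) :
    preHomAct f m (x ⊗ₜ toLeftMod A U y) = op y • f (op x • m) := rfl

variable [hU : Fact (IsRightHopf A U)]

/-- The map `U ⊗ U → T` sending `x y₁ ⊗ y₂` to `f (m x) y`: the map `x ⊗ y ↦ f (m x) y`, transported
along the Hopf map. Its value at `1 ⊗ y` is that of `f · y` at `m`. -/
noncomputable def homAct (f : M →ₗ[A] T) (m : M) : U ⊗[A] U →ₗ[A] T where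
  toFun z := preHomAct f m ((AddEquiv.ofBijective (hopfMap A U) hU.out).symm z)
  map_add' z z' := by simp
  map_smul' a z := by
    have key (w : U ⊗[A] LeftMod A U) : ∃ w', hopfMap A U w' = a • hopfMap A U w ∧
        preHomAct f m w' = a • preHomAct f m w := by
      induction w with
      | zero => exact ⟨0, by simp⟩
      | add z z' h h' =>
        obtain ⟨w, h1, h2⟩ := h
        obtain ⟨w', h1', h2'⟩ := h'
        exact ⟨w + w', by simp [h1, h1'], by simp [h2, h2']⟩
      | tmul x y =>
        refine ⟨x ⊗ₜ toLeftMod A U (a • (toLeftMod A U).symm y), ?_, ?_⟩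
        · rw [hopfMap_tmul, map_smul, map_smul]; rfl
        · rw [preHomAct_tmul, op_smul, smul_assoc]; rfl
    obtain ⟨w, rfl⟩ := hU.out.2 z
    obtain ⟨w', h, h'⟩ := key w
    rw [← h]
    have h3 (w) : (AddEquiv.ofBijective (hopfMap A U) hU.out).symm (hopfMap A U w) = w :=
      (AddEquiv.ofBijective (hopfMap A U) hU.out).symm_apply_apply w
    rw [h3, h3, h']
    rfl

theorem homAct_mulBoth_comul (f : M →ₗ[A] T) (m : M) (x y : U) :
    homAct f m (mulBoth A x 1 (comul (R := A) y)) = op y • f (op x • m) := by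
  rw [← hopfMap_tmul, ← preHomAct_tmul]
  exact congrArg (preHomAct f m)
    ((AddEquiv.ofBijective (hopfMap A U) hU.out).symm_apply_apply (x ⊗ₜ toLeftMod A U y))

theorem homAct_comul (f : M →ₗ[A] T) (m : M) (y : U) :
    homAct f m (comul (R := A) y) = op y • f m := by
  have := homAct_mulBoth_comul f m 1 y
  simpa [mulBoth] using this

/-- The defining property of `homAct` determines it. -/
theorem eq_homAct (f : M →ₗ[A] T) (m : M) (g : U ⊗[A] U →+ T)
    (hg : ∀ x y : U, g (mulBoth A x 1 (comul (R := A) y)) = op y • f (op x • m)) (z : U ⊗[A] U) :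
    g z = homAct f m z := by
  induction z using hU.out.induction with
  | hmul x y => rw [hg, homAct_mulBoth_comul]
  | hadd z z' h h' => rw [map_add, map_add, h, h']

theorem homAct_add_left (f g : M →ₗ[A] T) (m : M) (z : U ⊗[A] U) :
    homAct (f + g) m z = homAct f m z + homAct g m z :=
  (eq_homAct (f + g) m (homAct f m + homAct g m).toAddMonoidHom (fun x y => by
    simp only [LinearMap.toAddMonoidHom_coe, LinearMap.add_apply, homAct_mulBoth_comul,
      smul_add]) z).symm

theorem homAct_add_right (f : M →ₗ[A] T) (m m' : M) (z : U ⊗[A] U) :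
    homAct f (m + m') z = homAct f m z + homAct f m' z :=
  (eq_homAct f (m + m') (homAct f m + homAct f m').toAddMonoidHom (fun x y => by
    simp only [LinearMap.toAddMonoidHom_coe, LinearMap.add_apply, homAct_mulBoth_comul,
      smul_add, map_add]) z).symm

theorem homAct_smul_right (f : M →ₗ[A] T) (m : M) (x : U) (z : U ⊗[A] U) :
    homAct f (op x • m) z = homAct f m (mulBoth A x 1 z) :=
  (eq_homAct f (op x • m) ((homAct f m) ∘ₗ mulBoth A x 1).toAddMonoidHom (fun y y' => by
    rw [LinearMap.toAddMonoidHom_coe, LinearMap.comp_apply, mulBoth_mulBoth, mul_one,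
      homAct_mulBoth_comul, op_mul, mul_smul]) z).symm

theorem homAct_mulComul (f : M →ₗ[A] T) (m : M) (y : U) (z : U ⊗[A] U) :
    homAct f m (mulComul y z) = op y • homAct f m z := by
  induction z using hU.out.induction with
  | hmul x y' =>
    rw [mulComul_mulBoth, mulComul_comul, homAct_mulBoth_comul, homAct_mulBoth_comul, op_mul,
      mul_smul]
  | hadd z z' h h' => rw [map_add, map_add, map_add, h, h', smul_add]

/-- The right action of `U` on `A`-linear maps, `f · y`. In terms of the translation map
`y ↦ y₋ ⊗ y₊`, the inverse image of `1 ⊗ y` under the Hopf map, `(f · y) m = f (m y₋) y₊`. -/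
noncomputable def homSMul (y : U) (f : M →ₗ[A] T) : M →ₗ[A] T where
  toFun m := homAct f m (1 ⊗ₜ y)
  map_add' m m' := homAct_add_right f m m' _
  map_smul' a m := by
    rw [← src_smul (U := U), homAct_smul_right, RingHom.id_apply, ← map_smul, smul_tmul', map_tmul,
      LinearMap.mulLeft_apply, LinearMap.mulLeft_apply, mul_one, one_mul, src_eq]

theorem homSMul_apply (y : U) (f : M →ₗ[A] T) (m : M) : homSMul y f m = homAct f m (1 ⊗ₜ y) := rfl

theorem homSMul_apply_smul (x y : U) (f : M →ₗ[A] T) (m : M) :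
    homSMul y f (op x • m) = homAct f m (x ⊗ₜ y) := by
  rw [homSMul_apply, homAct_smul_right]
  simp

theorem homAct_homSMul (y : U) (f : M →ₗ[A] T) (m : M) (z : U ⊗[A] U) :
    homAct (homSMul y f) m z = homAct f m (mulBoth A 1 y z) :=
  (eq_homAct (homSMul y f) m (homAct f m ∘ₗ mulBoth A 1 y).toAddMonoidHom (fun x y' => by
    rw [LinearMap.toAddMonoidHom_coe, LinearMap.comp_apply, mulBoth_mulBoth, mul_one, one_mul,
      homSMul_apply_smul, ← mulComul_tmul, homAct_mulComul]) z).symm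

variable (U M T) in
/-- The `A`-linear maps between two right `U`-modules form a right `U`-module: the internal hom. -/
@[reducible] noncomputable def homModule : Module Uᵐᵒᵖ (M →ₗ[A] T) where
  smul y f := homSMul y.unop f
  one_smul f := by
    ext m
    change homAct f m (1 ⊗ₜ 1) = f m
    rw [← CocommRightBialgebroid.comul_one, homAct_comul, op_one, one_smul]
  mul_smul y y' f := by
    ext m
    change homAct f m (1 ⊗ₜ (y'.unop * y.unop)) = homAct (homSMul y'.unop f) m (1 ⊗ₜ y.unop)
    rw [homAct_homSMul]
    simp
  smul_zero y := by
    ext m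
    have := homAct_add_left (0 : M →ₗ[A] T) 0 m (1 ⊗ₜ y.unop)
    rw [add_zero, left_eq_add] at this
    exact this
  smul_add y f g := LinearMap.ext fun m => homAct_add_left f g m _
  add_smul y y' f := LinearMap.ext fun m => by
    change homAct f m (1 ⊗ₜ (y.unop + y'.unop)) = homAct f m (1 ⊗ₜ y.unop) + _
    rw [tmul_add, map_add]; rfl
  zero_smul f := LinearMap.ext fun m => by
    change homAct f m (1 ⊗ₜ (0 : U)) = 0
    rw [tmul_zero, map_zero]

attribute [local instance] homModule

variable (U M T) in
theorem homTower : IsScalarTower A Uᵐᵒᵖ (M →ₗ[A] T) := ⟨fun a y f => LinearMap.ext fun m => by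
  change homAct f m (1 ⊗ₜ (a • y.unop)) = a • homAct f m (1 ⊗ₜ y.unop)
  rw [tmul_smul, map_smul]⟩

attribute [local instance] homTower tensorModule tensorTower

/-- Evaluation is `U`-linear. -/
theorem eval_smul (y : Uᵐᵒᵖ) (z : M ⊗[A] (M →ₗ[A] T)) :
    TensorProduct.lift LinearMap.applyₗ (y • z) = y • TensorProduct.lift LinearMap.applyₗ z := by
  induction z with
  | zero => simp
  | add z z' h h' => simp only [smul_add, map_add, h, h']
  | tmul m f =>
    have key (z : U ⊗[A] U) : TensorProduct.lift LinearMap.applyₗ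
        (TensorProduct.map (orbit (A := A) m) (orbit (A := A) f) z) = homAct f m z := by
      induction z with
      | zero => simp
      | add z z' h h' => simp only [map_add, h, h']
      | tmul x x' => exact homSMul_apply_smul x x' f m
    rw [tensor_smul, key, homAct_comul]
    rfl

/-- A `U`-linear map out of a tensor product is `U`-linear in curried form. -/
theorem curry_smul (b : M ⊗[A] N →ₗ[A] T) (hb : ∀ (y : Uᵐᵒᵖ) z, b (y • z) = y • b z) (y : Uᵐᵒᵖ)
    (n : N) : (TensorProduct.curry b).flip (y • n) = y • (TensorProduct.curry b).flip n := by
  ext m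
  have key := eq_homAct ((TensorProduct.curry b).flip n) m
    (b ∘ₗ TensorProduct.map (orbit m) (orbit n)).toAddMonoidHom (fun x y => by
      have : orbit (A := A) m ∘ₗ LinearMap.mulLeft A x = orbit (op x • m) := by
        ext; simp [mul_smul]
      rw [LinearMap.toAddMonoidHom_coe, LinearMap.comp_apply, mulBoth, map_map,
        LinearMap.mulLeft_one, LinearMap.comp_id, this]
      exact hb (op y) ((op x • m) ⊗ₜ n)) (1 ⊗ₜ y.unop)
  refine Eq.trans ?_ key
  simp

/-- Precomposition with a `U`-linear map is `U`-linear. -/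
theorem comp_homSMul {M' : Type*} [AddCommGroup M'] [Module A M'] [Module Uᵐᵒᵖ M']
    [IsScalarTower A Uᵐᵒᵖ M'] (g : M' →ₗ[A] M) (hg : ∀ (y : Uᵐᵒᵖ) m, g (y • m) = y • g m)
    (y : Uᵐᵒᵖ) (f : M →ₗ[A] T) : (y • f) ∘ₗ g = y • (f ∘ₗ g) :=
  LinearMap.ext fun m => eq_homAct (f ∘ₗ g) m (homAct f (g m)).toAddMonoidHom (fun x y => by
    rw [LinearMap.toAddMonoidHom_coe, homAct_mulBoth_comul, LinearMap.comp_apply, hg]) _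

end Hom
end ProfMod

/-! ### Duals of profinite modules and the antipode of the finite dual -/

section Dual
variable {A : Type u} {U : Type v} [CommRing A] [Ring U] [RightARing A U]
  [CocommRightBialgebroid A U] [hU : Fact (IsRightHopf A U)]

namespace ProfMod

section
variable (P : Type*) [AddCommGroup P] [Module A P]

/-- The dual basis tensor `∑ e' i ⊗ e i`, as a map `A → P* ⊗ P`. -/
noncomputable def coevLin {ι : Type*} [Fintype ι] (e : ι → P) (e' : ι → Module.Dual A P) :
    A →ₗ[A] Module.Dual A P ⊗[A] P :=
  LinearMap.toSpanSingleton A _ (∑ i, e' i ⊗ₜ[A] e i)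

theorem coevLin_apply {ι : Type*} [Fintype ι] (e : ι → P) (e' : ι → Module.Dual A P) (a : A) :
    coevLin P e e' a = a • ∑ i, e' i ⊗ₜ[A] e i := rfl

theorem dualTensorHom_coevLin {ι : Type*} [Fintype ι] {e : ι → P} {e' : ι → Module.Dual A P}
    (he : IsDualBasis e e') (a : A) (x : P) :
    dualTensorHom A P P (coevLin P e e' a) x = a • x := by
  rw [coevLin_apply, map_smul, map_sum, LinearMap.smul_apply, LinearMap.sum_apply]
  simp only [dualTensorHom_apply]
  rw [he x]

end

section
variable (P Q : Type*) [AddCommGroup P] [Module A P] [Module Uᵐᵒᵖ P] [IsScalarTower A Uᵐᵒᵖ P]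
  [AddCommGroup Q] [Module A Q] [Module Uᵐᵒᵖ Q] [IsScalarTower A Uᵐᵒᵖ Q]

/-- The right `U`-module structure of the dual `P*`. -/
@[reducible] noncomputable def dualModule : Module Uᵐᵒᵖ (Module.Dual A P) :=
  letI := unitModule (A := A) (U := U)
  letI := unitTower (A := A) (U := U)
  homModule U P A

theorem dualTower :
    letI := dualModule (A := A) (U := U) P
    IsScalarTower A Uᵐᵒᵖ (Module.Dual A P) :=
  letI := unitModule (A := A) (U := U)
  letI := unitTower (A := A) (U := U)
  homTower U P A

end

/-- The dual of a profinite right `U`-module. -/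
noncomputable def dualObj (P : ProfMod A U) : ProfMod A U :=
  letI := dualModule (A := A) (U := U) P
  { carrier := Module.Dual A P
    tower := dualTower P }

/-- The evaluation `P ⊗ P* → A`. -/
noncomputable def ev (P : ProfMod A U) : P ⊗ dualObj P ⟶ 𝟙_ (ProfMod A U) where
  lin := TensorProduct.lift LinearMap.applyₗ
  map_act :=
    letI := unitModule (A := A) (U := U)
    letI := unitTower (A := A) (U := U)
    eval_smul (M := P) (T := A)

/-- The curried form of a morphism out of a tensor product. -/
noncomputable def curryLin {P N T : ProfMod A U} (b : P ⊗ N ⟶ T) : N →ₗ[A] P →ₗ[A] T :=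
  (TensorProduct.curry (Hom.lin b : P ⊗[A] N →ₗ[A] T)).flip

theorem curryLin_smul {P N T : ProfMod A U} (b : P ⊗ N ⟶ T) (y : Uᵐᵒᵖ) (n : N) :
    letI := homModule (A := A) U P T
    curryLin b (y • n) = y • curryLin b n :=
  curry_smul (M := P) (T := T) (N := N) (Hom.lin b) (Hom.map_act b) y n

/-- The curried form of a morphism `P ⊗ N → 𝟙`. -/
noncomputable def curryDual {P N : ProfMod A U} (b : P ⊗ N ⟶ 𝟙_ (ProfMod A U)) :
    N ⟶ dualObj P where
  lin := curryLin b
  map_act := curryLin_smul b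

/-- The transpose of a morphism. -/
noncomputable def dualMap {P Q : ProfMod A U} (f : P ⟶ Q) : dualObj Q ⟶ dualObj P where
  lin := (Hom.lin f).dualMap
  map_act :=
    letI := unitModule (A := A) (U := U)
    letI := unitTower (A := A) (U := U)
    comp_homSMul (M := Q) (T := A) (M' := P) (Hom.lin f) (Hom.map_act f)

/-- The `U`-linear map `Q* ⊗ P* → (Q ⊗ P)*`. -/
noncomputable def dualDistribHom (Q P : ProfMod A U) :
    dualObj Q ⊗ dualObj P ⟶ dualObj (Q ⊗ P) :=
  curryDual (tensorμ Q P (dualObj Q) (dualObj P) ≫ (ev Q ⊗ₘ ev P) ≫ (λ_ (𝟙_ (ProfMod A U))).hom)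

theorem dualDistribHom_lin (Q P : ProfMod A U) :
    Hom.lin (dualDistribHom Q P) = dualDistrib A Q P :=
  TensorProduct.ext' fun _ _ => TensorProduct.ext' fun _ _ => rfl

/-- The map `A → A*`. -/
noncomputable def unitDual : 𝟙_ (ProfMod A U) ⟶ dualObj (𝟙_ (ProfMod A U)) :=
  curryDual (λ_ (𝟙_ (ProfMod A U))).hom

/-- The coevaluation `A → P* ⊗ P` is `U`-linear, because it corresponds to the curried form of
`P ⊗ A → P` under the isomorphism of `P* ⊗ P` with the internal hom of `P` and `P`. -/
noncomputable def coev (P : ProfMod A U) {ι : Type*} [Fintype ι] {e : ι → P}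
    {e' : ι → Module.Dual A P} (he : IsDualBasis e e') : 𝟙_ (ProfMod A U) ⟶ dualObj P ⊗ P where
  lin := coevLin P e e'
  map_act y a := by
    let := homModule (A := A) U P P
    have h1 (z : (dualObj P ⊗ P : ProfMod A U)) :
        dualTensorHom A P P (y • z) = y • dualTensorHom A P P z := by
      have key : dualTensorHom A P P =
          curryLin ((α_ P (dualObj P) P).inv ≫ ev P ▷ P ≫ (λ_ P).hom) :=
        TensorProduct.ext' fun φ p => LinearMap.ext fun x => rfl
      rw [key]
      exact curryLin_smul _ y z
    have h2 (a : A) : dualTensorHom A P P (coevLin P e e' a) = curryLin (ρ_ P).hom a :=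
      LinearMap.ext fun x => dualTensorHom_coevLin P he a x
    have h3 : Function.Injective (dualTensorHom A P P) := (dualTensorHomEquiv A P P).injective
    refine h3 (((h2 (y • a)).trans (curryLin_smul _ y a)).trans ?_)
    exact (congrArg (y • ·) (h2 a)).symm.trans (h1 (coevLin P e e' a)).symm

/-- `P*` and `P` form an exact pairing. -/
@[reducible] noncomputable def exactPairing (P : ProfMod A U) {ι : Type*} [Fintype ι]
    {e : ι → P} {e' : ι → Module.Dual A P} (he : IsDualBasis e e') :
    ExactPairing (dualObj P) P where
  coevaluation' := coev P he
  evaluation' := ev P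
  coevaluation_evaluation' := hom_ext <| TensorProduct.ext' fun (x : P) (a : A) => by
    change (TensorProduct.map (TensorProduct.lift LinearMap.applyₗ) LinearMap.id)
      ((TensorProduct.assoc A P (Module.Dual A P) P).symm (x ⊗ₜ coevLin P e e' a)) =
        (1 : A) ⊗ₜ[A] (a • x)
    have h (c : A) (y : P) : c ⊗ₜ[A] y = 1 ⊗ₜ (c • y) := by
      rw [← smul_tmul, smul_eq_mul, mul_one]
    rw [coevLin_apply, tmul_smul, tmul_sum, map_smul, map_smul, map_sum, map_sum, tmul_smul]
    simp only [assoc_symm_tmul, map_tmul, lift.tmul, LinearMap.applyₗ_apply_apply,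
      LinearMap.id_apply, h (e' _ x)]
    rw [← tmul_sum, he x]
  evaluation_coevaluation' := hom_ext <| TensorProduct.ext' fun (a : A) (φ : Module.Dual A P) => by
    change (TensorProduct.map LinearMap.id (TensorProduct.lift LinearMap.applyₗ))
      (TensorProduct.assoc A (Module.Dual A P) P (Module.Dual A P) (coevLin P e e' a ⊗ₜ φ)) =
        (a • φ) ⊗ₜ[A] (1 : A)
    have h (c : A) (χ : Module.Dual A P) : χ ⊗ₜ[A] c = (c • χ) ⊗ₜ 1 := by
      rw [smul_tmul, smul_eq_mul, mul_one]
    rw [coevLin_apply, ← smul_tmul', sum_tmul, map_smul, map_smul, map_sum, map_sum, ← smul_tmul']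
    simp only [assoc_tmul, map_tmul, lift.tmul, LinearMap.applyₗ_apply_apply,
      LinearMap.id_apply, h (φ _)]
    rw [← sum_tmul, he.dual φ]

variable (A U) in
theorem nonempty_rigid : Nonempty (RigidCategory (ProfMod A U)) := by
  have h (P : ProfMod A U) : Nonempty (HasLeftDual P) :=
    let ⟨_, _, _, he⟩ := exists_dualBasis (A := A) P
    ⟨@HasLeftDual.mk _ _ _ P (dualObj P) (exactPairing P he)⟩
  let : LeftRigidCategory (ProfMod A U) := { leftDual := fun P => (h P).some }
  exact ⟨BraidedCategory.rigidCategoryOfLeftRigidCategory⟩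

end ProfMod

end Dual

section Antipode
variable {A : Type u} {U : Type v} [CommRing A] [Ring U] [RightARing A U]
  [CocommRightBialgebroid A U]

namespace FinDual
open ProfMod

/-- The class of `φ ⊗ p`, in the summand of the object `P`. -/
noncomputable def cls (P : ProfMod A U) : Module.Dual A P →+ P →+ FinDual A U := mk P

theorem cls_hom {P Q : ProfMod A U} (f : P ⟶ Q) (φ : Module.Dual A Q) (p : P) :
    cls Q φ (Hom.lin f p) = cls P (φ ∘ₗ Hom.lin f) p :=
  mk_map (Hom.lin f) (Hom.map_act f) φ p

theorem cls_mul (P Q : ProfMod A U) (φ : Module.Dual A P) (p : P) (ψ : Module.Dual A Q) (q : Q) :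
    cls P φ p * cls Q ψ q = cls (Q ⊗ P) (dualDistrib A Q P (ψ ⊗ₜ φ)) (q ⊗ₜ[A] p) :=
  mulHom_mk P Q φ p ψ q

theorem cls_sum_left (P : ProfMod A U) {ι : Type*} [Fintype ι] (φ : ι → Module.Dual A P) (p : P) :
    cls P (∑ i, φ i) p = ∑ i, cls P (φ i) p := by
  rw [map_sum, AddMonoidHom.finsetSum_apply]

theorem s_eq_cls (a : A) : s A U a = cls (𝟙_ _) (a • LinearMap.id : Module.Dual A A) (1 : A) := rfl

theorem t_eq_cls (a : A) : t A U a = cls (𝟙_ _) (LinearMap.id : Module.Dual A A) a := rfl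

@[elab_as_elim]
theorem induction_cls {p : FinDual A U → Prop} (h0 : p 0)
    (hcls : ∀ (P : ProfMod A U) (φ : Module.Dual A P) (x : P), p (cls P φ x))
    (hadd : ∀ x y, p x → p y → p (x + y)) (x : FinDual A U) : p x :=
  induction h0 (fun P _ _ _ _ _ _ => hcls (.mk P)) hadd x

theorem Δ_cls (P : ProfMod A U) {ι : Type*} [Fintype ι] {e : ι → P} {e' : ι → Module.Dual A P}
    (he : IsDualBasis e e') (φ : Module.Dual A P) (p : P) : Δ A U (cls P φ p) =
      ∑ i, toAlong (t A U) (cls P φ (e i)) ⊗ₜ toAlong (s A U) (cls P (e' i) p) := Δ_mk P he φ p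

variable [hU : Fact (IsRightHopf A U)]

/-- The map `φ ⊗ p ↦ ev_p ⊗ φ`, where `ev_p ⊗ φ` is in the summand of `P*`. -/
noncomputable def antipodeMk (P : ProfMod A U) : Module.Dual A P →+ P →+ FinDual A U :=
  AddMonoidHom.mk' (fun φ => AddMonoidHom.mk'
      (fun p => cls (dualObj P) (Module.Dual.eval A P p) φ)
      (fun p p' => by rw [map_add]; exact DFunLike.congr_fun (map_add (cls (dualObj P)) _ _) φ))
    (fun φ φ' => AddMonoidHom.ext fun p => map_add (cls (dualObj P) (Module.Dual.eval A P p)) φ φ')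

/-- The antipode, as an additive map. -/
noncomputable def antipodeHom : FinDual A U →+ FinDual A U :=
  lift (fun P => antipodeMk (.mk P))
    (fun P Q f hf φ p =>
      (cls_hom (dualMap (P := P) (Q := Q) ⟨f, hf⟩) (Module.Dual.eval A P p) φ).symm)

theorem antipodeHom_cls (P : ProfMod A U) (φ : Module.Dual A P) (p : P) :
    antipodeHom (cls P φ p) = cls (dualObj P) (Module.Dual.eval A P p) φ :=
  lift_mk _ _ P φ p

theorem antipodeHom_mul (x y : FinDual A U) :
    antipodeHom (x * y) = antipodeHom x * antipodeHom y := by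
  induction x using induction_cls with
  | h0 => simp
  | hadd x x' h h' => simp only [map_add, add_mul, h, h']
  | hcls P φ p =>
    induction y using induction_cls with
    | h0 => simp
    | hadd x x' h h' => simp only [map_add, mul_add, h, h']
    | hcls Q ψ q =>
      refine (congrArg antipodeHom (cls_mul P Q φ p ψ q)).trans ?_
      refine (antipodeHom_cls (Q ⊗ P) _ _).trans ?_
      refine Eq.trans ?_ (congrArg₂ (· * ·) (antipodeHom_cls P φ p) (antipodeHom_cls Q ψ q)).symm
      refine Eq.trans ?_ (cls_mul (dualObj P) (dualObj Q) _ _ _ _).symm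
      have h := cls_hom (dualDistribHom Q P) (Module.Dual.eval A (Q ⊗[A] P) (q ⊗ₜ p)) (ψ ⊗ₜ[A] φ)
      rw [dualDistribHom_lin] at h
      refine h.trans ?_
      congr 2
      exact TensorProduct.ext' fun _ _ => rfl

theorem antipodeHom_unit (a b : A) :
    antipodeHom (cls (𝟙_ (ProfMod A U)) (a • LinearMap.id : Module.Dual A A) b) =
      cls (𝟙_ (ProfMod A U)) (b • LinearMap.id : Module.Dual A A) a := by
  have h : Hom.lin (unitDual (A := A) (U := U)) a = (a • LinearMap.id : Module.Dual A A) :=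
    LinearMap.ext fun x : A => mul_comm x a
  have h' : Module.Dual.eval A (𝟙_ (ProfMod A U)) b ∘ₗ Hom.lin (unitDual (A := A) (U := U)) =
    (b • LinearMap.id : Module.Dual A A) := LinearMap.ext fun x => rfl
  refine (antipodeHom_cls (𝟙_ (ProfMod A U)) (a • LinearMap.id : Module.Dual A A) b).trans ?_
  rw [← h', ← h]
  exact cls_hom unitDual _ a

variable (A U) in
/-- The antipode as a ring homomorphism. -/
noncomputable def antipodeRingHom : FinDual A U →+* FinDual A U where
  __ := antipodeHom
  map_one' := by
    have := antipodeHom_unit (U := U) (1 : A) 1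
    rw [one_smul] at this
    exact this
  map_mul' := antipodeHom_mul

theorem antipodeRingHom_cls (P : ProfMod A U) (φ : Module.Dual A P) (p : P) :
    antipodeRingHom A U (cls P φ p) = cls (dualObj P) (Module.Dual.eval A P p) φ :=
  antipodeHom_cls P φ p

theorem antipodeRingHom_s (a : A) : antipodeRingHom A U (s A U a) = t A U a := by
  refine (antipodeHom_unit a 1).trans ?_
  rw [one_smul, t_eq_cls]

theorem antipodeRingHom_t (a : A) : antipodeRingHom A U (t A U a) = s A U a := by
  have := antipodeHom_unit (U := U) 1 a
  rw [one_smul] at this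
  exact this

/-- The map `x ⊗ y ↦ x S(y)`. -/
noncomputable def mulAntipode : HtHs A U →+ FinDual A U :=
  liftAddHom
    (AddMonoidHom.mk' (fun x : Along (t A U) =>
        (AddMonoidHom.mulLeft ((toAlong (t A U)).symm x)).comp
          ((antipodeRingHom A U).toAddMonoidHom.comp (toAlong (s A U)).symm.toAddMonoidHom))
      (fun x x' => by ext y; simp [add_mul]))
    (fun a (x : FinDual A U) (y : FinDual A U) => by
      change t A U a * x * antipodeRingHom A U y = x * antipodeRingHom A U (s A U a * y)
      rw [map_mul, antipodeRingHom_s]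
      ring)

theorem mulAntipode_tmul (x y : FinDual A U) :
    mulAntipode (toAlong (t A U) x ⊗ₜ toAlong (s A U) y) = x * antipodeRingHom A U y := rfl

/-- The map `x ⊗ y ↦ S(x) y`. -/
noncomputable def antipodeMul : HtHs A U →+ FinDual A U :=
  liftAddHom
    (AddMonoidHom.mk' (fun x : Along (t A U) =>
        (AddMonoidHom.mulLeft (antipodeRingHom A U ((toAlong (t A U)).symm x))).comp
          (toAlong (s A U)).symm.toAddMonoidHom)
      (fun x x' => by ext y; simp [add_mul]))
    (fun a (x : FinDual A U) (y : FinDual A U) => by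
      change antipodeRingHom A U (t A U a * x) * y = antipodeRingHom A U x * (s A U a * y)
      rw [map_mul, antipodeRingHom_t]
      ring)

theorem antipodeMul_tmul (x y : FinDual A U) :
    antipodeMul (toAlong (t A U) x ⊗ₜ toAlong (s A U) y) = antipodeRingHom A U x * y := rfl

/-- The coevaluation identifies the sum `∑ (φ ⊗ e i) (ev_p ⊗ e' i)` with a class in the summand of
the unit object. -/
theorem mulAntipode_Δ (h : FinDual A U) : mulAntipode (Δ A U h) = s A U (ε A U h) := by
  induction h using induction_cls with
  | h0 => simp
  | hadd x x' h h' => simp only [map_add, h, h']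
  | hcls P φ p =>
    obtain ⟨n, e, e', he⟩ := exists_dualBasis (A := A) P
    rw [Δ_cls P he, map_sum]
    simp only [mulAntipode_tmul, antipodeRingHom_cls]
    have h := cls_hom (coev P he)
      (dualDistrib A (Module.Dual A P) P (Module.Dual.eval A P p ⊗ₜ φ)) (1 : A)
    have h1 : Hom.lin (coev P he) (1 : A) = ∑ i, e' i ⊗ₜ[A] e i := one_smul A _
    rw [h1] at h
    refine (Finset.sum_congr rfl fun i _ => cls_mul P (dualObj P) φ (e i) _ (e' i)).trans ?_
    refine (map_sum _ _ _).symm.trans (h.trans ?_)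
    refine Eq.trans ?_ (congrArg (s A U) (ε_mk P φ p)).symm
    rw [s_eq_cls]
    congr 2
    refine LinearMap.ext_ring ?_
    refine (congrArg (dualDistrib A (Module.Dual A P) P (Module.Dual.eval A P p ⊗ₜ φ)) h1).trans ?_
    rw [map_sum]
    change ∑ i, e' i p * φ (e i) = φ p * 1
    conv_rhs => rw [← he p]
    simp

theorem antipodeMul_Δ (h : FinDual A U) : antipodeMul (Δ A U h) = t A U (ε A U h) := by
  induction h using induction_cls with
  | h0 => simp
  | hadd x x' h h' => simp only [map_add, h, h']
  | hcls P φ p =>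
    obtain ⟨n, e, e', he⟩ := exists_dualBasis (A := A) P
    rw [Δ_cls P he, map_sum]
    simp only [antipodeMul_tmul, antipodeRingHom_cls]
    have h := cls_hom (ev P) (LinearMap.id : Module.Dual A A) (p ⊗ₜ[A] φ)
    have h1 : (LinearMap.id : Module.Dual A A) ∘ₗ Hom.lin (ev P) =
        ∑ i, dualDistrib A P (Module.Dual A P) (e' i ⊗ₜ Module.Dual.eval A P (e i)) := by
      refine TensorProduct.ext' fun (x : P) (χ : Module.Dual A P) => ?_
      refine Eq.trans ?_ (LinearMap.sum_apply Finset.univ (fun i =>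
        dualDistrib A P (Module.Dual A P) (e' i ⊗ₜ Module.Dual.eval A P (e i))) (x ⊗ₜ χ)).symm
      change χ x = ∑ i, e' i x * χ (e i)
      conv_lhs => rw [← he x]
      simp
    refine (Finset.sum_congr rfl fun i _ =>
      cls_mul (dualObj P) P (Module.Dual.eval A P (e i)) φ (e' i) p).trans ?_
    refine Eq.trans ?_ (congrArg (t A U) (ε_mk P φ p)).symm
    refine Eq.trans ?_ h.symm
    refine Eq.trans ?_ (congrArg (cls (P ⊗ dualObj P) · (p ⊗ₜ[A] φ)) h1).symm
    exact (cls_sum_left (P ⊗ dualObj P) (fun i =>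
      dualDistrib A P (Module.Dual A P) (e' i ⊗ₜ Module.Dual.eval A P (e i))) _).symm

end FinDual

open FinDual in
variable (A U) in
/-- The antipode of the finite dual of a right Hopf algebroid. -/
noncomputable def finiteDualAntipode [Fact (IsRightHopf A U)] : (finiteDual A U).Antipode where
  S := antipodeRingHom A U
  S_s := antipodeRingHom_s
  S_t := antipodeRingHom_t
  mul_S h n x y hxy := by
    refine Eq.trans ?_ (mulAntipode_Δ h)
    refine Eq.trans ?_ (congrArg _ hxy).symm
    exact (map_sum (mulAntipode (A := A) (U := U)) (fun i =>
      toAlong (t A U) (x i) ⊗ₜ toAlong (s A U) (y i)) Finset.univ).symm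
  S_mul h n x y hxy := by
    refine Eq.trans ?_ (antipodeMul_Δ h)
    refine Eq.trans ?_ (congrArg _ hxy).symm
    exact (map_sum (antipodeMul (A := A) (U := U)) (fun i =>
      toAlong (t A U) (x i) ⊗ₜ toAlong (s A U) (y i)) Finset.univ).symm

end Antipode

/-! ### Comodules over the finite dual -/

section Comod
open CommBialgebroidData ProfMod

variable {A : Type u} {U : Type v} [CommRing A] [Ring U] [RightARing A U]
  [CocommRightBialgebroid A U]

namespace CommBialgebroidData

theorem Coaction.ext_ρ {H : Type*} [CommRing H] {D : CommBialgebroidData A H} {M : Type*}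
    [AddCommGroup M] [Module A M] {r r' : D.Coaction M} (h : ∀ m, r.ρ m = r'.ρ m) : r = r' := by
  obtain ⟨ρ, _, _, _⟩ := r
  obtain ⟨ρ', _, _, _⟩ := r'
  obtain rfl : ρ = ρ' := AddMonoidHom.ext h
  rfl

end CommBialgebroidData

theorem IsDualBasis.sum_eq_tmul {P : Type*} [AddCommGroup P] [Module A P] {X : Type*}
    [AddCommGroup X] [Module A X] {ι : Type*} [Fintype ι] {e : ι → P} {e' : ι → Module.Dual A P}
    (he : IsDualBasis e e') (z : P ⊗[A] X) :
    z = ∑ i, e i ⊗ₜ[A] TensorProduct.lid A X (LinearMap.rTensor X (e' i) z) := by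
  induction z with
  | zero => simp
  | add z z' h h' =>
    simp only [map_add, tmul_add, Finset.sum_add_distrib]
    rw [← h, ← h']
  | tmul p x =>
    simp only [LinearMap.rTensor_tmul, lid_tmul]
    conv_lhs => rw [← he p, sum_tmul]
    simp only [smul_tmul]

namespace FinDual

/-- The map `q ⊗ φ ↦ q ⊗ (φ ⊗ p)`. -/
noncomputable def coactPairing (P : ProfMod A U) (M : Type*) [AddCommGroup M] [Module A M]
    (p : P) : M →+ Module.Dual A P →+ M ⊗[A] Along ((finiteDual A U).s) :=
  AddMonoidHom.mk' (fun q => (TensorProduct.mk A _ _ q).toAddMonoidHom.comp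
      ((toAlong ((finiteDual A U).s)).toAddMonoidHom.comp ((cls P).flip p)))
    (fun q q' => AddMonoidHom.ext fun ψ => by simp)

theorem coactPairing_apply (P : ProfMod A U) (M : Type*) [AddCommGroup M] [Module A M]
    (p : P) (q : M) (φ : Module.Dual A P) :
    coactPairing P M p q φ = q ⊗ₜ toAlong ((finiteDual A U).s) (cls P φ p) := rfl

theorem s_mul_cls (P : ProfMod A U) (a : A) (φ : Module.Dual A P) (p : P) :
    (finiteDual A U).s a * cls P φ p = cls P (a • φ) p := s_mul_mk P a φ p

theorem t_mul_cls (P : ProfMod A U) (a : A) (φ : Module.Dual A P) (p : P) :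
    (finiteDual A U).t a * cls P φ p = cls P φ (a • p) := t_mul_mk P a φ p

theorem coactPairing_smul (P : ProfMod A U) (M : Type*) [AddCommGroup M] [Module A M]
    (p : P) (a : A) (q : M) (φ : Module.Dual A P) :
    coactPairing P M p (a • q) φ = coactPairing P M p q (a • φ) := by
  rw [coactPairing_apply, coactPairing_apply, ← s_mul_cls, ← smul_along, smul_tmul]

theorem coact_hom {P Q : ProfMod A U} {ι κ : Type*} [Fintype ι] [Fintype κ] {e : ι → P}
    {e' : ι → Module.Dual A P} (he : IsDualBasis e e') {d : κ → Q} {d' : κ → Module.Dual A Q}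
    (hd : IsDualBasis d d') (f : P ⟶ Q) (p : P) :
    ∑ i, Hom.lin f (e i) ⊗ₜ[A] toAlong ((finiteDual A U).s) (cls P (e' i) p) =
      ∑ j, d j ⊗ₜ[A] toAlong ((finiteDual A U).s) (cls Q (d' j) (Hom.lin f p)) := by
  have := IsDualBasis.sum_eq he hd (Hom.lin f) (coactPairing P Q p) (coactPairing_smul P Q p)
  simp only [coactPairing_apply] at this
  rw [this]
  exact Finset.sum_congr rfl fun j _ => by rw [cls_hom]

/-- The canonical coaction of `U°` on a profinite right `U`-module, `p ↦ ∑ e i ⊗ (e' i ⊗ p)`, for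
one dual basis of `P`; by `coactFun_apply` it does not depend on the dual basis. -/
noncomputable def coactFun (P : ProfMod A U) : P →+ P ⊗[A] Along ((finiteDual A U).s) :=
  let h := exists_dualBasis (A := A) P
  AddMonoidHom.mk' (fun p => ∑ i, h.choose_spec.choose i ⊗ₜ[A]
      toAlong ((finiteDual A U).s) (cls P (h.choose_spec.choose_spec.choose i) p))
    (fun p p' => by simp only [map_add, tmul_add, Finset.sum_add_distrib])

theorem coactFun_apply (P : ProfMod A U) {ι : Type*} [Fintype ι] {e : ι → P}
    {e' : ι → Module.Dual A P} (he : IsDualBasis e e') (p : P) :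
    coactFun P p = ∑ i, e i ⊗ₜ[A] toAlong ((finiteDual A U).s) (cls P (e' i) p) := by
  have h := exists_dualBasis (A := A) P
  exact coact_hom h.choose_spec.choose_spec.choose_spec he (𝟙 P) p

theorem coactFun_smul (P : ProfMod A U) (a : A) (p : P) :
    coactFun P (a • p) =
      mulR P (toAlong ((finiteDual A U).s) ((finiteDual A U).t a)) (coactFun P p) := by
  obtain ⟨n, e, e', he⟩ := exists_dualBasis (A := A) P
  rw [coactFun_apply P he, coactFun_apply P he, map_sum]
  refine Finset.sum_congr rfl fun i _ => ?_
  rw [← t_mul_cls, map_mul]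
  rfl

/-- The canonical coaction of `U°` on a profinite right `U`-module. -/
noncomputable def coaction (P : ProfMod A U) : (finiteDual A U).Coaction P where
  ρ := coactFun P
  map_smul := coactFun_smul P
  counit p := by
    obtain ⟨n, e, e', he⟩ := exists_dualBasis (A := A) P
    refine Eq.trans ?_ (he p)
    rw [coactFun_apply P he]
    refine (congrArg _ (map_sum _ _ _)).trans ((map_sum _ _ _).trans ?_)
    refine Finset.sum_congr rfl fun i _ => ?_
    change ε A U (cls P (e' i) p) • e i = _
    rw [cls, ε_mk]
  coassoc p := by
    obtain ⟨n, e, e', he⟩ := exists_dualBasis (A := A) P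
    have h (p : P) := coactFun_apply P he p
    have h1 (i) : LinearMap.lTensor P (finiteDual A U).comulAlg.toLinearMap
        (e i ⊗ₜ toAlong ((finiteDual A U).s) (cls P (e' i) p)) = ∑ j, e i ⊗ₜ[A] (toAlong _
          (toAlong ((finiteDual A U).t) (cls P (e' i) (e j)) ⊗ₜ[A]
            toAlong ((finiteDual A U).s) (cls P (e' j) p)) :
            (finiteDual A U).HH) := by
      rw [← tmul_sum, ← map_sum]
      exact congrArg (e i ⊗ₜ[A] ·) (Δ_cls P he (e' i) p)
    have h2 (i) : (finiteDual A U).coactTensor (coactFun P) (coactFun_smul P)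
        (e i ⊗ₜ toAlong ((finiteDual A U).s) (cls P (e' i) p)) = ∑ j, e j ⊗ₜ[A] (toAlong _
          (toAlong ((finiteDual A U).t) (cls P (e' j) (e i)) ⊗ₜ[A]
            toAlong ((finiteDual A U).s) (cls P (e' i) p)) :
            (finiteDual A U).HH) := by
      refine ((finiteDual A U).coactTensor_tmul _ _ _ _).trans ?_
      rw [h]
      refine (congrArg _ (map_sum _ _ _)).trans ((map_sum _ _ _).trans ?_)
      refine Finset.sum_congr rfl fun j _ => ?_
      change e j ⊗ₜ[A] (toAlong _ ((1 ⊗ₜ[A] toAlong ((finiteDual A U).s) (cls P (e' i) p)) *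
        (toAlong ((finiteDual A U).t) (cls P (e' j) (e i)) ⊗ₜ[A] 1)) : (finiteDual A U).HH) = _
      rw [Algebra.TensorProduct.tmul_mul_tmul, one_mul, mul_one]
    rw [h]
    refine (map_sum _ _ _).trans (Eq.trans ?_ (map_sum _ _ _).symm)
    refine (Finset.sum_congr rfl fun i _ => h1 i).trans
      (Eq.trans ?_ (Finset.sum_congr rfl fun i _ => h2 i).symm)
    exact Finset.sum_comm

theorem coaction_ρ (P : ProfMod A U) {ι : Type*} [Fintype ι] {e : ι → P}
    {e' : ι → Module.Dual A P} (he : IsDualBasis e e') (p : P) :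
    (coaction P).ρ p = ∑ i, e i ⊗ₜ[A] toAlong ((finiteDual A U).s) (cls P (e' i) p) :=
  coactFun_apply P he p

variable (A U) in
/-- The functor from profinite right `U`-modules to profinite right comodules over `U°`, which keeps
the underlying `A`-module. -/
noncomputable def toComod : ProfMod A U ⥤ ProfComod (finiteDual A U) where
  obj P := { carrier := P, coaction := coaction P }
  map {P Q} f := ⟨Hom.lin f, fun p => by
    obtain ⟨n, e, e', he⟩ := exists_dualBasis (A := A) P
    obtain ⟨m, d, d', hd⟩ := exists_dualBasis (A := A) Q
    refine (congrArg _ (coaction_ρ P he p)).trans ((map_sum _ _ _).trans ?_)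
    exact (coact_hom he hd f p).trans (coaction_ρ Q hd _).symm⟩

theorem coaction_tensor (P Q : ProfMod A U) :
    (coaction P).tensor (coaction Q) = coaction (P ⊗ Q) := by
  obtain ⟨n, e, e', he⟩ := exists_dualBasis (A := A) P
  obtain ⟨m, d, d', hd⟩ := exists_dualBasis (A := A) Q
  refine Coaction.ext_ρ fun z => ?_
  refine TensorProduct.induction_on (motive := fun z : P ⊗[A] Q =>
    ((coaction P).tensor (coaction Q)).ρ z = (coaction (P ⊗ Q)).ρ z) z ?_ (fun p q => ?_)
      (fun x y hx hy => ?_)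
  · exact (map_zero _).trans (map_zero (coaction (P ⊗ Q)).ρ).symm
  · refine (Coaction.tensorMap_tmul _ _ p q).trans ?_
    rw [coaction_ρ P he, coaction_ρ Q hd]
    refine Eq.trans ?_ (coaction_ρ (P ⊗ Q) (hd.tensor he) (p ⊗ₜ[A] q)).symm
    refine Eq.trans ?_ (Fintype.sum_prod_type _).symm
    simp only [map_sum, LinearMap.sum_apply]
    rw [Finset.sum_comm]
    refine Finset.sum_congr rfl fun i _ => ?_
    refine Finset.sum_congr rfl fun j _ => ?_
    refine (mulT_tmul _ _ _ _).trans ?_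
    refine congrArg (fun h : FinDual A U => (e i ⊗ₜ[A] d j) ⊗ₜ[A] toAlong ((finiteDual A U).s) h) ?_
    exact (mul_comm _ _).trans (cls_mul Q P (d' j) q (e' i) p)
  · exact (map_add _ _ _).trans ((congrArg₂ (· + ·) hx hy).trans
      (map_add (coaction (P ⊗ Q)).ρ x y).symm)

theorem coaction_unit :
    Coaction.unit (finiteDual A U).toCommBialgebroidData = coaction (𝟙_ (ProfMod A U)) :=
  Coaction.ext_ρ fun a => ((coaction_ρ (𝟙_ (ProfMod A U)) isDualBasis_one a).trans (by
    rw [Fintype.sum_unique]; rfl)).symm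

/-- The comodule with underlying module that of `P` and coaction `r`. -/
noncomputable def withCoaction (P : ProfMod A U) (r : (finiteDual A U).Coaction P) :
    ProfComod (finiteDual A U) := ⟨P, r⟩

/-- Comodules with the same underlying module and the same coaction are isomorphic through the
identity. -/
noncomputable def idIso (P : ProfMod A U) {r r' : (finiteDual A U).Coaction P} (h : r = r') :
    withCoaction P r ≅ withCoaction P r' :=
  ProfComod.mkIso (P := withCoaction P r) (Q := withCoaction P r') (LinearEquiv.refl A P)
    (fun p => by
      subst h
      exact DFunLike.congr_fun (LinearMap.rTensor_id (Along (finiteDual A U).s) P) (r.ρ p))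

theorem idIso_hom (P : ProfMod A U) {r r' : (finiteDual A U).Coaction P} (h : r = r') :
    ∃ h', (idIso P h).hom = eqToHom h' := by
  subst h
  exact ⟨rfl, rfl⟩

variable (A U) in
/-- The monoidal structure of the functor, with identity constraints. -/
noncomputable def toComodCore : (toComod A U).CoreMonoidal where
  εIso := idIso (𝟙_ (ProfMod A U)) coaction_unit
  μIso P Q := idIso (P ⊗ Q) (coaction_tensor P Q)
  μIso_hom_natural_left _ _ := ProfComod.hom_ext <| TensorProduct.ext' fun _ _ => rfl
  μIso_hom_natural_right _ _ := ProfComod.hom_ext <| TensorProduct.ext' fun _ _ => rfl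
  associativity _ _ _ := ProfComod.hom_ext <| TensorProduct.ext_threefold fun _ _ _ => rfl
  left_unitality _ := ProfComod.hom_ext <| TensorProduct.ext' fun _ _ => rfl
  right_unitality _ := ProfComod.hom_ext <| TensorProduct.ext' fun _ _ => rfl

noncomputable instance : (toComod A U).Monoidal := (toComodCore A U).toMonoidal

noncomputable instance : (toComod A U).Braided where
  braided _ _ := ProfComod.hom_ext <| TensorProduct.ext' fun _ _ => rfl

theorem zeta_cls (P : ProfMod A U) (φ : Module.Dual A P) (p : P) (x : U) :
    (zeta (cls P φ p) : Module.Dual A U) x = φ (op x • p) := zeta_mk P φ p x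

/-- The value of `ζ` at `x` as an `A`-linear map on `U°`, `A` acting through the source. -/
noncomputable def pair (x : U) : Along (finiteDual A U).s →ₗ[A] A where
  toFun h := zeta ((toAlong (finiteDual A U).s).symm h) x
  map_add' h h' := by simp
  map_smul' a h := by
    change zeta ((finiteDual A U).s a * (toAlong (finiteDual A U).s).symm h) x = a • _
    generalize (toAlong (finiteDual A U).s).symm h = h
    induction h using induction_cls with
    | h0 => simp
    | hadd h h' hh hh' => simp only [mul_add, map_add, LinearMap.add_apply, hh, hh', smul_add]
    | hcls P φ p =>
      rw [s_mul_cls, zeta_cls, zeta_cls]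
      rfl

theorem pair_apply (x : U) (h : FinDual A U) : pair x (toAlong (finiteDual A U).s h) = zeta h x :=
  rfl

theorem zeta_s_mul (a : A) (h : FinDual A U) (x : U) :
    (zeta ((finiteDual A U).s a * h) : Module.Dual A U) x = a * zeta h x :=
  (pair x).map_smul a (toAlong (finiteDual A U).s h)

theorem zeta_t_mul (a : A) (h : FinDual A U) (x : U) :
    (zeta ((finiteDual A U).t a * h) : Module.Dual A U) x = zeta h (src a * x) := by
  induction h using induction_cls with
  | h0 => simp
  | hadd h h' hh hh' => simp only [mul_add, map_add, LinearMap.add_apply, hh, hh']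
  | hcls P φ p => rw [t_mul_cls, zeta_cls, zeta_cls, op_mul, mul_smul, src_smul]

theorem zeta_one (h : FinDual A U) : (zeta h : Module.Dual A U) 1 = (finiteDual A U).ε h := by
  induction h using induction_cls with
  | h0 => simp
  | hadd h h' hh hh' => simp only [map_add, LinearMap.add_apply, hh, hh']
  | hcls P φ p =>
    rw [zeta_cls, op_one, one_smul]
    exact (ε_mk P φ p).symm

section act
variable (M : Type*) [AddCommGroup M] [Module A M] {N : Type*} [AddCommGroup N] [Module A N]

/-- The map `m ⊗ h ↦ ζ(h)(x) m`. -/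
noncomputable def act (x : U) : M ⊗[A] Along (finiteDual A U).s →ₗ[A] M :=
  (TensorProduct.rid A M).toLinearMap ∘ₗ LinearMap.lTensor M (pair x)

variable {M}

theorem act_tmul (x : U) (m : M) (h : Along (finiteDual A U).s) : act M x (m ⊗ₜ h) =
    pair x h • m := by
  simp [act]

theorem act_rTensor (x : U) (f : M →ₗ[A] N) (z : M ⊗[A] Along (finiteDual A U).s) :
    act N x (LinearMap.rTensor _ f z) = f (act M x z) := by
  induction z with
  | zero => simp
  | add z z' h h' => simp only [map_add, h, h']
  | tmul m h => rw [LinearMap.rTensor_tmul, act_tmul, act_tmul, map_smul]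

theorem act_coaction (P : ProfMod A U) (x : U) (p : P) : act P x ((coaction P).ρ p) = op x • p := by
  obtain ⟨n, e, e', he⟩ := exists_dualBasis (A := A) P
  rw [coaction_ρ P he, map_sum]
  simp only [act_tmul, pair_apply, zeta_cls]
  exact he _

theorem act_add (x y : U) (z : M ⊗[A] Along (finiteDual A U).s) :
    act M (x + y) z = act M x z + act M y z := by
  induction z with
  | zero => simp
  | add z z' h h' => simp only [map_add, h, h']; abel
  | tmul m h =>
    obtain ⟨h, rfl⟩ := (toAlong (finiteDual A U).s).surjective h
    simp only [act_tmul, pair_apply, map_add, add_smul]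

theorem act_smul (a : A) (x : U) (z : M ⊗[A] Along (finiteDual A U).s) :
    act M (a • x) z = a • act M x z := by
  induction z with
  | zero => simp
  | add z z' h h' => simp only [map_add, h, h', smul_add]
  | tmul m h =>
    obtain ⟨h, rfl⟩ := (toAlong (finiteDual A U).s).surjective h
    simp only [act_tmul, pair_apply, map_smul, smul_assoc]

/-- The map `h ⊗ k ↦ ζ(h)(ζ(k)(x) y)`, additively. -/
noncomputable def pairBothAdd (x y : U) :
    Along (finiteDual A U).t ⊗[A] Along (finiteDual A U).s →+ A :=
  liftAddHom
    (AddMonoidHom.mk' (fun h : Along (finiteDual A U).t => AddMonoidHom.mk'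
      (fun k : Along (finiteDual A U).s =>
        zeta ((toAlong (finiteDual A U).t).symm h) (src (pair x k) * y))
      (fun k k' => by simp only [map_add, add_mul]))
      (fun h h' => by ext k; simp))
    (fun a (h : FinDual A U) k => by
      change (zeta ((finiteDual A U).t a * h) : Module.Dual A U) (src (pair x k) * y) =
        zeta h (src (pair x (a • k)) * y)
      rw [zeta_t_mul, map_smul, smul_eq_mul, (src (A := A) (U := U)).map_mul, mul_assoc])

theorem pairBothAdd_tmul (x y : U) (h k : FinDual A U) :
    pairBothAdd x y (toAlong (finiteDual A U).t h ⊗ₜ toAlong (finiteDual A U).s k) =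
      (zeta h : Module.Dual A U) (src (zeta k x : A) * y) := rfl

/-- The map `h ⊗ k ↦ ζ(h)(ζ(k)(x) y)`. -/
noncomputable def pairBoth (x y : U) : (finiteDual A U).HH →ₗ[A] A where
  toFun := pairBothAdd x y
  map_add' z z' := map_add (pairBothAdd x y) z z'
  map_smul' a z := by
    change pairBothAdd x y ((toAlong (finiteDual A U).t ((finiteDual A U).s a) ⊗ₜ 1) *
      (show Along (finiteDual A U).t ⊗[A] Along (finiteDual A U).s from z)) =
      a • pairBothAdd x y z
    refine TensorProduct.induction_on
      (motive := fun z : Along (finiteDual A U).t ⊗[A] Along (finiteDual A U).s =>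
        pairBothAdd x y ((toAlong (finiteDual A U).t ((finiteDual A U).s a) ⊗ₜ 1) * z) =
          a • pairBothAdd x y z) z ?_ (fun h k => ?_) (fun z z' h h' => ?_)
    · simp
    · rw [Algebra.TensorProduct.tmul_mul_tmul, one_mul]
      exact zeta_s_mul a ((toAlong (finiteDual A U).t).symm h) (src (pair x k) * y)
    · rw [mul_add, map_add, map_add, h, h', smul_add]

theorem pairBoth_comul (x y : U) (h : FinDual A U) :
    pairBoth x y ((finiteDual A U).comulAlg (toAlong (finiteDual A U).s h)) =
      pair (x * y) (toAlong (finiteDual A U).s h) := by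
  change pairBothAdd x y ((finiteDual A U).Δ h) = zeta h (x * y)
  induction h using induction_cls with
  | h0 => simp
  | hadd h h' hh hh' => simp only [map_add, LinearMap.add_apply, hh, hh']
  | hcls P φ p =>
    obtain ⟨n, e, e', he⟩ := exists_dualBasis (A := A) P
    refine (congrArg _ (Δ_cls P he φ p)).trans ((map_sum _ _ _).trans ?_)
    refine (Finset.sum_congr rfl fun i _ => pairBothAdd_tmul x y _ _).trans ?_
    simp only [zeta_cls, op_mul, mul_smul, src_smul]
    rw [← map_sum, ← Finset.smul_sum, he]

theorem pairBoth_coactTensor (r : (finiteDual A U).Coaction M) (x y : U)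
    (z : M ⊗[A] Along (finiteDual A U).s) :
    TensorProduct.rid A M (LinearMap.lTensor M (pairBoth x y)
      ((finiteDual A U).coactTensor r.ρ r.map_smul z)) = act M y (r.ρ (act M x z)) := by
  induction z with
  | zero => simp
  | add z z' h h' => simp only [map_add, h, h']
  | tmul m h =>
    rw [coactTensor_tmul, act_tmul, r.map_smul]
    generalize r.ρ m = w
    induction w with
    | zero => simp
    | add z z' h h' => simp only [map_add, h, h']
    | tmul m k =>
      simp only [LinearMap.lTensor_tmul, act_tmul, TensorProduct.rid_tmul, LinearMap.mulLeft_apply]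
      congr 1
      have h1 : (finiteDual A U).inr h * (finiteDual A U).inl k =
          toAlong _ (toAlong (finiteDual A U).t ((toAlong (finiteDual A U).s).symm k) ⊗ₜ[A] h) := by
        refine (Algebra.TensorProduct.tmul_mul_tmul (1 : Along (finiteDual A U).t)
          (toAlong (finiteDual A U).t ((toAlong (finiteDual A U).s).symm k)) h
          (1 : Along (finiteDual A U).s)).trans ?_
        rw [one_mul, mul_one]
        rfl
      exact (congrArg (pairBoth x y) h1).trans
        (zeta_t_mul (pair x h) ((toAlong (finiteDual A U).s).symm k) y).symm

/-- The maps `act M x (r.ρ _)` are multiplicative in `x`, by coassociativity. -/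
theorem act_mul (r : (finiteDual A U).Coaction M) (x y : U) (m : M) :
    act M (x * y) (r.ρ m) = act M y (r.ρ (act M x (r.ρ m))) := by
  rw [← pairBoth_coactTensor, ← r.coassoc]
  generalize r.ρ m = w
  induction w with
  | zero => simp
  | add z z' h h' => simp only [map_add, h, h']
  | tmul m h =>
    rw [act_tmul, LinearMap.lTensor_tmul, LinearMap.lTensor_tmul, TensorProduct.rid_tmul]
    exact congrArg (· • m) (pairBoth_comul x y h).symm

theorem act_one (r : (finiteDual A U).Coaction M) (m : M) : act M 1 (r.ρ m) = m := by
  conv_rhs => rw [← r.counit m]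
  have : pair (1 : U) = (finiteDual A U).εs.toLinearMap := LinearMap.ext fun h => zeta_one h
  rw [act, this]
  rfl

/-- The right `U`-module structure of a comodule, `m · x = ζ(m₁)(x) m₀`. -/
@[reducible] noncomputable def comodModule (r : (finiteDual A U).Coaction M) : Module Uᵐᵒᵖ M where
  smul x m := act M x.unop (r.ρ m)
  one_smul := act_one r
  mul_smul x y m := act_mul r y.unop x.unop m
  smul_zero x := by
    change act M x.unop (r.ρ 0) = 0
    simp
  smul_add x m m' := by
    change act M x.unop (r.ρ (m + m')) = act M x.unop (r.ρ m) + act M x.unop (r.ρ m')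
    simp
  add_smul x y m := act_add x.unop y.unop (r.ρ m)
  zero_smul m := by
    have := act_smul (0 : A) (0 : U) (r.ρ m)
    rw [zero_smul, zero_smul] at this
    exact this

theorem comodTower (r : (finiteDual A U).Coaction M) :
    letI := comodModule r
    IsScalarTower A Uᵐᵒᵖ M :=
  letI := comodModule r
  ⟨fun a x m => act_smul a x.unop (r.ρ m)⟩

/-- Two tensors with the same images under all maps `m ⊗ h ↦ ζ(h)(x) m` are equal, if `ζ` is
injective and `M` is profinite. -/
theorem act_injective (hζ : Function.Injective (zeta : FinDual A U →+ Module.Dual A U))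
    [Module.Finite A M] [Module.Projective A M] {z z' : M ⊗[A] Along (finiteDual A U).s}
    (h : ∀ x, act M x z = act M x z') : z = z' := by
  obtain ⟨n, e, e', he⟩ := exists_dualBasis (A := A) M
  have key (φ : Module.Dual A M) (x : U) (z : M ⊗[A] Along (finiteDual A U).s) :
      pair x (TensorProduct.lid A _ (LinearMap.rTensor _ φ z)) = φ (act M x z) := by
    induction z with
    | zero => simp
    | add z z' h h' => simp only [map_add, h, h']
    | tmul m h => simp [act_tmul, mul_comm]
  rw [he.sum_eq_tmul z, he.sum_eq_tmul z']
  refine Finset.sum_congr rfl fun i _ => congrArg _ ?_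
  refine hζ (LinearMap.ext fun x => ?_)
  exact (key (e' i) x z).trans ((congrArg _ (h x)).trans (key (e' i) x z').symm)

end act

/-- The profinite right `U`-module given by a profinite comodule. -/
noncomputable def ofComod (M : ProfComod (finiteDual A U)) : ProfMod A U :=
  letI := comodModule M.coaction
  { carrier := M
    tower := comodTower M.coaction }

theorem ofComod_toComod (P : ProfMod A U) : ofComod ((toComod A U).obj P) = P := by
  have h : comodModule (coaction P) = P.moduleU :=
    Module.ext (by ext x p; exact act_coaction P x.unop p)
  obtain ⟨c⟩ := P
  change @ProfMod.mk A U _ _ _ c _ _ (comodModule _) (comodTower _) _ _ = _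
  congr 1
  exact proof_irrel_heq _ _

theorem toComod_ofComod (hζ : Function.Injective (zeta : FinDual A U →+ Module.Dual A U))
    (M : ProfComod (finiteDual A U)) : (toComod A U).obj (ofComod M) = M := by
  have h : coaction (ofComod M) = M.coaction := Coaction.ext_ρ fun m =>
    act_injective hζ fun x => act_coaction (ofComod M) x m
  exact congrArg (withCoaction (ofComod M)) h

instance : (toComod A U).Faithful where
  map_injective h := ProfMod.hom_ext (congrArg (fun f => ProfComod.Hom.lin f) h)

instance : (toComod A U).Full where
  map_surjective {P Q} f := ⟨⟨ProfComod.Hom.lin f, fun x p => by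
    have h := congrArg (act Q x.unop) (ProfComod.Hom.map_coact f p)
    refine Eq.trans ?_ (h.trans (act_coaction Q x.unop (ProfComod.Hom.lin f p)))
    refine Eq.trans ?_ (act_rTensor (M := P) (N := Q) x.unop (ProfComod.Hom.lin f) _).symm
    exact congrArg _ (act_coaction P x.unop p).symm⟩, rfl⟩

theorem toComod_isSymmMonoidalIso
    (hζ : Function.Injective (zeta : FinDual A U →+ Module.Dual A U)) :
    IsSymmMonoidalIso (toComod A U) where
  isIso :=
    { bijective_obj := ⟨Function.LeftInverse.injective ofComod_toComod,
        Function.RightInverse.surjective (toComod_ofComod hζ)⟩ }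
  comp_forget := rfl
  strict_tensor P Q := idIso_hom (P ⊗ Q) (coaction_tensor P Q)
  strict_unit := idIso_hom (𝟙_ (ProfMod A U)) coaction_unit


end FinDual
end Comod

/-! ### Injectivity of `ζ` over a Dedekind domain, and rigidity -/

section Dedekind
variable {A : Type u} {U : Type v} [CommRing A] [Ring U] [RightARing A U]

/-- A submodule of a finitely generated projective module over a Dedekind domain is projective, as
it is finitely presented and torsion-free. -/
theorem projective_submodule [IsDedekindDomain A] {P : Type*} [AddCommGroup P] [Module A P]
    [Module.Finite A P] [Module.Projective A P] (N : Submodule A P) : Module.Projective A N := by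
  have : Module.IsTorsionFree A N := inferInstance
  have : Module.FinitePresentation A N := Module.finitePresentation_of_finite A N
  exact Module.Flat.projective_of_finitePresentation

namespace FinDual

/-- Every element of the finite dual is the class of a single tensor, since sums of tensors can be
taken in direct sums of modules. -/
theorem exists_eq_mk (h : FinDual A U) : ∃ (P : ProfMod A U) (φ : Module.Dual A P) (p : P),
    h = mk P φ p := by
  induction h using induction with
  | h0 => exact ⟨⟨PUnit⟩, 0, 0, by simp⟩
  | hmk P φ p => exact ⟨.mk P, φ, p, rfl⟩
  | hadd x y hx hy =>
    obtain ⟨P, φ, p, rfl⟩ := hx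
    obtain ⟨Q, ψ, q, rfl⟩ := hy
    refine ⟨.mk (P × Q), φ.coprod ψ, (p, q), ?_⟩
    have h1 := mk_map (LinearMap.inl A P Q) (fun (x : Uᵐᵒᵖ) p => by simp) (φ.coprod ψ) p
    have h2 := mk_map (LinearMap.inr A P Q) (fun (x : Uᵐᵒᵖ) p => by simp) (φ.coprod ψ) q
    rw [LinearMap.coprod_inl] at h1
    rw [LinearMap.coprod_inr] at h2
    rw [← h1, ← h2, ← map_add]
    simp

/-- Over a Dedekind domain the submodule `p U` is again profinite, and `φ ⊗ p` is the image of
`φ|_{p U} ⊗ p`, which vanishes if `ζ (φ ⊗ p) = 0`. -/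
theorem zeta_injective [IsDedekindDomain A] :
    Function.Injective (zeta : FinDual A U →+ Module.Dual A U) := by
  rw [injective_iff_map_eq_zero]
  intro h hh
  obtain ⟨P, φ, p, rfl⟩ := exists_eq_mk h
  let N : Submodule Uᵐᵒᵖ P := Submodule.span Uᵐᵒᵖ {p}
  have : Module.Projective A N := projective_submodule (N.restrictScalars A)
  have : Module.Finite A N := inferInstanceAs (Module.Finite A (N.restrictScalars A))
  have hN : φ ∘ₗ N.subtype.restrictScalars A = 0 := by
    ext ⟨y, hy⟩
    obtain ⟨x, rfl⟩ := Submodule.mem_span_singleton.1 hy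
    have := LinearMap.congr_fun hh x.unop
    rwa [zeta_mk] at this
  have := mk_map (N.subtype.restrictScalars A) (fun x y => N.subtype.map_smul x y) φ
    ⟨p, Submodule.mem_span_singleton_self p⟩
  rw [hN, map_zero] at this
  exact this

end FinDual
end Dedekind

section Rigid
variable {A : Type u} {U : Type v} [CommRing A] [Ring U] [RightARing A U]
  [CocommRightBialgebroid A U]

theorem nonempty_rigid_of_isEquivalence {C D : Type*} [Category* C] [Category* D]
    [MonoidalCategory C] [MonoidalCategory D] [BraidedCategory D] [LeftRigidCategory C] (F : C ⥤ D)
    [F.Monoidal] [F.IsEquivalence] : Nonempty (RigidCategory D) :=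
  letI : F.asEquivalence.functor.Monoidal := ‹F.Monoidal›
  letI : F.asEquivalence.inverse.Monoidal := F.asEquivalence.inverseMonoidal
  letI : F.asEquivalence.symm.functor.Monoidal := ‹F.asEquivalence.inverse.Monoidal›
  letI : LeftRigidCategory D := leftRigidCategoryOfEquivalence F.asEquivalence.symm.toAdjunction
  ⟨BraidedCategory.rigidCategoryOfLeftRigidCategory⟩

theorem nonempty_rigid_comod [Fact (IsRightHopf A U)]
    (hζ : Function.Injective (FinDual.zeta : FinDual A U →+ Module.Dual A U)) :
    Nonempty (RigidCategory (ProfComod (finiteDual A U))) := by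
  obtain ⟨_⟩ := ProfMod.nonempty_rigid A U
  have := (FinDual.toComod_isSymmMonoidalIso hζ).isIso
  exact nonempty_rigid_of_isEquivalence (FinDual.toComod A U)

end Rigid

/-! ### The enveloping algebra of a Lie-Rinehart algebra -/

section LieRinehart
variable {K : Type w} {A : Type u} {L : Type x} [CommRing K] [CommRing A] [LieRing L] [Module A L]
  [LieRingModule L A] [Algebra K A] [LieAlgebra K L] [LieRinehartRing A L]
  [LieRinehartAlgebra K A L]

namespace EnvAlg

section hom
variable (M T : Type*) [AddCommGroup M] [Module A M] [Module (EnvAlg K A L) M]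
  [IsScalarTower A (EnvAlg K A L) M] [AddCommGroup T] [Module A T] [Module K T]
  [IsScalarTower K A T] [Module (EnvAlg K A L) T] [IsScalarTower A (EnvAlg K A L) T]

variable (K L) in
/-- The representation of `L` on the `A`-linear maps between two representations,
`(X f) m = X (f m) - f (X m)`. -/
noncomputable def homConn : Conn A L (M →ₗ[A] T) where
  nabla := AddMonoidHom.mk' (fun X => AddMonoidHom.mk' (fun f =>
      { toFun m := ιL K A L X • f m - f (ιL K A L X • m)
        map_add' m m' := by simp only [map_add, smul_add]; abel
        map_smul' a m := by
          simp only [map_smul, ιL_smul_smul, map_add, smul_sub, RingHom.id_apply]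
          abel })
      (fun f g => by
        ext m
        simp only [LinearMap.coe_mk, AddHom.coe_mk, LinearMap.add_apply, smul_add]
        abel))
    (fun X Y => by
      ext f m
      simp only [AddMonoidHom.mk'_apply, LinearMap.coe_mk, AddHom.coe_mk, map_add, add_smul,
        AddMonoidHom.add_apply, LinearMap.add_apply]
      abel)
  smul a X f := by
    ext m
    simp [smul_ιL_smul, smul_sub]
  leibniz X a f := by
    ext m
    simp only [AddMonoidHom.mk'_apply, LinearMap.coe_mk, AddHom.coe_mk, LinearMap.smul_apply,
      LinearMap.add_apply, ιL_smul_smul, smul_sub]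
    abel
  flat X Y f := by
    ext m
    simp only [AddMonoidHom.mk'_apply, LinearMap.coe_mk, AddHom.coe_mk, LinearMap.sub_apply,
      ιL_lie, sub_smul, mul_smul, map_sub, smul_sub]
    abel

/-- The `A`-linear maps between two left modules form a left module. -/
@[reducible] noncomputable def homModule : Module (EnvAlg K A L) (M →ₗ[A] T) :=
  (homConn K L M T).module K

attribute [local instance] homModule

theorem homTower : IsScalarTower A (EnvAlg K A L) (M →ₗ[A] T) := (homConn K L M T).tower

attribute [local instance] homTower

variable {M T}

theorem ιL_smul_hom (X : L) (f : M →ₗ[A] T) (m : M) :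
    (ιL K A L X • f) m = ιL K A L X • f m - f (ιL K A L X • m) :=
  LinearMap.congr_fun ((homConn K L M T).ιL_smul X f) m

end hom

section Hopf

/-- Right multiplication by `y`, on `U` as an `A`-module by left multiplication. -/
def rightMul {U : Type*} [Ring U] [RightARing A U] (y : U) : LeftMod A U →ₗ[A] LeftMod A U where
  toFun x := toLeftMod A U ((toLeftMod A U).symm x * y)
  map_add' x x' := by simp [add_mul]
  map_smul' a x := mul_assoc (src a) ((toLeftMod A U).symm x) y

variable (K A L) in
/-- The source `U ⊗ U` of the Hopf map of `U = EnvOp K A L`, with the left action of the enveloping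
algebra on the second factor and the corresponding action of `A`. This action of `A` is not the one
of the tensor product, which concerns the first factor. -/
def HopfSource : Type (max u w x) := EnvOp K A L ⊗[A] LeftMod A (EnvOp K A L)

namespace HopfSource

noncomputable instance : AddCommGroup (HopfSource K A L) :=
  inferInstanceAs (AddCommGroup (EnvOp K A L ⊗[A] LeftMod A (EnvOp K A L)))

/-- The class of `x ⊗ y`. -/
noncomputable def tmul (x y : EnvAlg K A L) : HopfSource K A L :=
  op x ⊗ₜ[A] toLeftMod A (EnvOp K A L) (op y)

@[elab_as_elim]
theorem induction {p : HopfSource K A L → Prop} (h0 : p 0) (htmul : ∀ x y, p (tmul x y))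
    (hadd : ∀ z z', p z → p z' → p (z + z')) (z : HopfSource K A L) : p z :=
  TensorProduct.induction_on (motive := p) z h0
    (fun x y => htmul x.unop (unop ((toLeftMod A _).symm y))) hadd

theorem tmul_add_left (x x' y : EnvAlg K A L) : tmul (x + x') y = tmul x y + tmul x' y :=
  TensorProduct.add_tmul _ _ _

theorem tmul_add_right (x y y' : EnvAlg K A L) : tmul x (y + y') = tmul x y + tmul x y' :=
  TensorProduct.tmul_add _ _ _

theorem tmul_smul_left (a : A) (x y : EnvAlg K A L) :
    tmul (a • x) y = tmul x (y * ιA K A L a) :=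
  TensorProduct.smul_tmul a (op x) (toLeftMod A (EnvOp K A L) (op y))

/-- Left multiplication on the second factor. -/
noncomputable def mulHom (v : EnvAlg K A L) : HopfSource K A L →+ HopfSource K A L :=
  (LinearMap.lTensor (EnvOp K A L) (rightMul (A := A) (op v))).toAddMonoidHom

theorem mulHom_tmul (v x y : EnvAlg K A L) : mulHom v (tmul x y) = tmul x (v * y) := rfl

noncomputable instance : Module (EnvAlg K A L) (HopfSource K A L) where
  smul v z := mulHom v z
  one_smul z := by
    change mulHom 1 z = z
    induction z using induction with
    | h0 => simp
    | htmul x y => rw [mulHom_tmul, one_mul]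
    | hadd z z' h h' => rw [map_add, h, h']
  mul_smul v v' z := by
    change mulHom (v * v') z = mulHom v (mulHom v' z)
    induction z using induction with
    | h0 => simp
    | htmul x y => rw [mulHom_tmul, mulHom_tmul, mulHom_tmul, mul_assoc]
    | hadd z z' h h' => rw [map_add, map_add, map_add, h, h']
  smul_zero v := map_zero (mulHom v)
  smul_add v := map_add (mulHom v)
  add_smul v v' z := by
    change mulHom (v + v') z = mulHom v z + mulHom v' z
    induction z using induction with
    | h0 => simp
    | htmul x y => rw [mulHom_tmul, mulHom_tmul, mulHom_tmul, add_mul, tmul_add_right]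
    | hadd z z' h h' => rw [map_add, map_add, map_add, h, h']; abel
  zero_smul z := by
    change mulHom 0 z = 0
    induction z using induction with
    | h0 => simp
    | htmul x y =>
      rw [mulHom_tmul, zero_mul]
      exact TensorProduct.tmul_zero _ _
    | hadd z z' h h' => rw [map_add, h, h', add_zero]

theorem smul_tmul (v x y : EnvAlg K A L) : v • tmul x y = tmul x (v * y) := rfl

noncomputable instance : Module A (HopfSource K A L) := Module.compHom _ (ιA K A L)

theorem smul_eq (a : A) (z : HopfSource K A L) : a • z = ιA K A L a • z := rfl

instance : IsScalarTower A (EnvAlg K A L) (HopfSource K A L) :=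
  ⟨fun a v z => by rw [smul_def, mul_smul, smul_eq]⟩

noncomputable instance : Module K (HopfSource K A L) := Module.compHom _ (algebraMap K A)

instance : IsScalarTower K A (HopfSource K A L) :=
  ⟨fun k a z => by rw [Algebra.smul_def, mul_smul]; rfl⟩

end HopfSource

open HopfSource

attribute [local instance] tensorModule tensorTower homModule homTower

/-- The Hopf map, in terms of the enveloping algebra: `x ⊗ y ↦ y (x ⊗ 1)`. -/
noncomputable def hopfHom : HopfSource K A L →+ EnvAlg K A L ⊗[A] EnvAlg K A L :=
  (TensorProduct.congr (opLinearEquiv A) (opLinearEquiv A)).symm.toLinearMap.toAddMonoidHom.comp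
    (hopfMap A (EnvOp K A L))

theorem hopfHom_tmul (x y : EnvAlg K A L) :
    hopfHom (HopfSource.tmul x y) = y • (x ⊗ₜ[A] (1 : EnvAlg K A L)) := by
  refine (congrArg (TensorProduct.congr (opLinearEquiv A) (opLinearEquiv A)).symm
    (EnvOp.mulBoth_comul y x 1)).trans ?_
  exact (TensorProduct.congr (opLinearEquiv A) (opLinearEquiv A)).symm_apply_apply _

theorem hopfHom_smul (v : EnvAlg K A L) (z : HopfSource K A L) :
    hopfHom (v • z) = v • hopfHom z := by
  induction z using HopfSource.induction with
  | h0 => simp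
  | htmul x y => rw [HopfSource.smul_tmul, hopfHom_tmul, hopfHom_tmul, mul_smul]
  | hadd z z' h h' => rw [smul_add, map_add, map_add, smul_add, h, h']

/-- The Hopf map as an `A`-linear map. -/
noncomputable def hopfLin : HopfSource K A L →ₗ[A] EnvAlg K A L ⊗[A] EnvAlg K A L where
  __ := hopfHom
  map_smul' a z := (hopfHom_smul (ιA K A L a) z).trans (ιA_smul a (hopfHom z))

variable (K A L) in
/-- The map `x ↦ x ⊗ 1`. -/
noncomputable def tmulOne : EnvAlg K A L →ₗ[A] HopfSource K A L where
  toFun x := HopfSource.tmul x 1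
  map_add' x x' := tmul_add_left x x' 1
  map_smul' a x := by
    rw [tmul_smul_left, one_mul, RingHom.id_apply, smul_eq, HopfSource.smul_tmul, mul_one]

variable (K A L) in
/-- The inverse of the Hopf map, `x ⊗ y ↦ (y f) x`, for the element `f : x ↦ x ⊗ 1` of the internal
hom from the enveloping algebra to the source of the Hopf map. -/
noncomputable def hopfInv : EnvAlg K A L ⊗[A] EnvAlg K A L →ₗ[A] HopfSource K A L :=
  TensorProduct.lift (orbit (tmulOne K A L)).flip

theorem hopfInv_tmul (x y : EnvAlg K A L) : hopfInv K A L (x ⊗ₜ y) = (y • tmulOne K A L) x := rfl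

theorem hopfInv_smul (v : EnvAlg K A L) (z : EnvAlg K A L ⊗[A] EnvAlg K A L) :
    hopfInv K A L (v • z) = v • hopfInv K A L z := by
  refine map_smul_of _ (fun X z => ?_) v z
  induction z with
  | zero => simp
  | add z z' h h' => simp only [smul_add, map_add, h, h']
  | tmul x y =>
    rw [ιL_smul_tmul, map_add, hopfInv_tmul, hopfInv_tmul, hopfInv_tmul,
      smul_eq_mul (_ : EnvAlg K A L) y, mul_smul, ιL_smul_hom]
    abel

theorem hopfInv_hopfLin (z : HopfSource K A L) : hopfInv K A L (hopfLin z) = z := by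
  induction z using HopfSource.induction with
  | h0 => simp
  | htmul x y =>
    refine (congrArg _ (hopfHom_tmul x y)).trans ?_
    rw [hopfInv_smul, hopfInv_tmul, one_smul]
    exact congrArg (HopfSource.tmul x) (mul_one y)
  | hadd z z' h h' => rw [map_add, map_add, h, h']

/-- Both `y ↦ hopfLin ∘ (y f)` and `y ↦ (x ↦ x ⊗ y)` are linear over the enveloping algebra,
and they agree at `y = 1`. -/
theorem hopfLin_hopfInv (z : EnvAlg K A L ⊗[A] EnvAlg K A L) : hopfLin (hopfInv K A L z) = z := by
  induction z with
  | zero => simp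
  | add z z' h h' => rw [map_add, map_add, h, h']
  | tmul x y =>
    have h1 := map_smul_of (K := K) (L := L) (M := EnvAlg K A L →ₗ[A] HopfSource K A L)
      (N := EnvAlg K A L →ₗ[A] EnvAlg K A L ⊗[A] EnvAlg K A L)
      (hopfLin.compRight A : (EnvAlg K A L →ₗ[A] HopfSource K A L) →ₗ[A]
        EnvAlg K A L →ₗ[A] EnvAlg K A L ⊗[A] EnvAlg K A L)
      (fun X f => LinearMap.ext fun x => by
        rw [ιL_smul_hom]
        change hopfLin ((ιL K A L X • f) x) = ιL K A L X • hopfLin (f x) - hopfLin (f _)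
        rw [ιL_smul_hom, map_sub]
        exact congrArg (· - _) (hopfHom_smul (ιL K A L X) (f x))) y (tmulOne K A L)
    have h2 := map_smul_of (K := K) (L := L) (M := EnvAlg K A L)
      (N := EnvAlg K A L →ₗ[A] EnvAlg K A L ⊗[A] EnvAlg K A L)
      (TensorProduct.mk A (EnvAlg K A L) (EnvAlg K A L)).flip
      (fun X (y : EnvAlg K A L) => LinearMap.ext fun x => by
        rw [ιL_smul_hom, LinearMap.flip_apply, LinearMap.flip_apply, LinearMap.flip_apply,
          mk_apply, mk_apply, mk_apply, ιL_smul_tmul, add_sub_cancel_left]) y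
      (1 : EnvAlg K A L)
    have h3 : (hopfLin.compRight A : (EnvAlg K A L →ₗ[A] HopfSource K A L) →ₗ[A]
        EnvAlg K A L →ₗ[A] EnvAlg K A L ⊗[A] EnvAlg K A L) (tmulOne K A L) =
          (TensorProduct.mk A (EnvAlg K A L) (EnvAlg K A L)).flip 1 :=
      LinearMap.ext fun x => (hopfHom_tmul x 1).trans (one_smul _ _)
    rw [h3, ← h2, smul_eq_mul, mul_one] at h1
    exact LinearMap.congr_fun h1 x

variable (K A L) in
theorem isRightHopf : IsRightHopf A (EnvOp K A L) := by
  have h : Function.Bijective (hopfHom (K := K) (A := A) (L := L)) :=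
    ⟨Function.LeftInverse.injective hopfInv_hopfLin,
      Function.RightInverse.surjective hopfLin_hopfInv⟩
  exact (Function.Bijective.of_comp_iff'
    (TensorProduct.congr (opLinearEquiv A) (opLinearEquiv A)).symm.bijective _).1 h

end Hopf

end EnvAlg

end LieRinehart

end FiniteDual

open FiniteDual in
theorem corollary4p7 :
    (∀ (A : Type u) (U : Type v) [CommRing A] [IsDedekindDomain A] [Ring U] [RightARing A U]
      [CocommRightBialgebroid A U], IsRightHopf A U →
        Nonempty (finiteDual A U).Antipode ∧
        ∃ (F : ProfMod A U ⥤ ProfComod (finiteDual A U)) (_ : F.Braided), IsSymmMonoidalIso F) ∧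
    (∀ (K : Type w) (A : Type u) (L : Type x) [CommRing K] [CommRing A] [LieRing L] [Module A L]
      [LieRingModule L A] [LieRinehartRing A L] [Algebra K A] [LieAlgebra K L]
      [LieRinehartAlgebra K A L],
        IsRightHopf A (EnvOp K A L) ∧
        Nonempty (finiteDual A (EnvOp K A L)).Antipode ∧
        (IsDedekindDomain A →
          Function.Injective (FinDual.zeta : FinDual A (EnvOp K A L) →+ _)) ∧
        (Function.Injective (FinDual.zeta : FinDual A (EnvOp K A L) →+ _) →
          Nonempty (RigidCategory (ProfMod A (EnvOp K A L))) ∧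
          Nonempty (RigidCategory (ProfComod (finiteDual A (EnvOp K A L)))) ∧
          ∃ (F : ProfMod A (EnvOp K A L) ⥤ ProfComod (finiteDual A (EnvOp K A L)))
            (_ : F.Braided), IsSymmMonoidalIso F)) :=
  ⟨fun A U _ _ _ _ _ hU =>
    haveI : Fact (IsRightHopf A U) := ⟨hU⟩
    ⟨⟨finiteDualAntipode A U⟩, FinDual.toComod A U, inferInstance,
      FinDual.toComod_isSymmMonoidalIso FinDual.zeta_injective⟩,
  fun K A L _ _ _ _ _ _ _ _ _ =>
    haveI : Fact (IsRightHopf A (EnvOp K A L)) := ⟨EnvAlg.isRightHopf K A L⟩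
    ⟨EnvAlg.isRightHopf K A L, ⟨finiteDualAntipode A _⟩, fun _ => FinDual.zeta_injective,
      fun hζ => ⟨ProfMod.nonempty_rigid A _, nonempty_rigid_comod hζ, FinDual.toComod A _,
        inferInstance, FinDual.toComod_isSymmMonoidalIso hζ⟩⟩⟩
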